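/- **Setting.** Let $(M,g)$ be a smooth Riemannian manifold of dimension $n$ and $\mathcal E$ a smooth complex vector bundle of rank $r$ over $M$ with a hermitian inner product $\gamma$. Let $H_\hbar=\hbar^2L+\hbar W+V\cdot\mathrm{id}$, where $L$ is a Laplace type operator, i.e. locally $L=-\sum g^{ij}\partial_i\partial_j+\sum b_j\partial_j+c$ with smooth endomorphism fields $b_j,c$, and $L$ is symmetric on compactly supported smooth sections with respect to $\int_M\gamma[\cdot,\cdot]$; $W$ is a smooth $\gamma$-symmetric endomorphism field; and $V\in C^\infty(M,\mathbb R)$ has a non-degenerate minimum at $p$ with $V(p)=0$. Let $\phi$ be a smooth real solution of the eikonal equation $|d\phi|^2=V$ on a neighbourhood $U$ of $p$, with $\phi(p)=0$ and a non-degenerate minimum at $p$. Choose normal coordinates $x$ at $p$ in which $\phi=\frac12\sum_\nu\lambda_\nu x_\nu^2+O(|x|^3)$, $\lambda_\nu>0$, and put $\Lambda=\mathrm{diag}(\lambda_1,\dots,\lambda_n)$. Trivialize $\mathcal E$ near $p$ by parallel translation along geodesics emanating from $p$, with respect to the metric connection $\nabla$ for which $L-\nabla^*\nabla$ is of order zero.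 Let $\tau_p$ denote Taylor expansion at $x=0$ of functions, sections, and coefficients of differential operators in these coordinates and this trivialization, and let $H_{\phi,\hbar}=e^{\phi/\hbar}\circ H_\hbar\circ e^{-\phi/\hbar}$. **Rescaling.** The operator $\tau_p(H_{\phi,\hbar})$ acts on $\mathfrak S=\mathcal E_p[[x]]((\hbar^{1/2}))$. The rescaling $R:\sum\hbar^ku_{\alpha,k}x^\alpha\mapsto\sum\hbar^{k+|\alpha|/2}u_{\alpha,k}y^\alpha$ is a $\mathbb C((\hbar^{1/2}))$-linear isomorphism of $\mathfrak S$ onto $$\mathfrak S_0=\Bigl\{\hbar^{-K}\sum_{j\in\mathbb N_0/2}\hbar^jP_j \;\Big|\; K\in\mathbb N_0/2,\ P_j\in\mathcal E_p[y],\ \deg P_j\le 2j\Bigr\}.$$ Let $Q=\hbar^{-1}R\circ\tau_p(H_{\phi,\hbar})\circ R^{-1}:\mathfrak S_0\to\mathfrak S_0$. Then $Q=\sum_{j\in\mathbb N_0/2}\hbar^jQ_j$ with differential operators $Q_j$ independent of $\hbar$; the leading term $Q_0$ acts on $\mathcal E_p[y]$. **Hermitian form.** On $\mathfrak S_0$ let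 $(\cdot,\cdot)_{\mathfrak S_0,\phi}$ be the $\mathbb C((\hbar^{1/2}))$-valued hermitian form given by the asymptotic expansion of $\hbar^{-n/2}\int\gamma[u,v]\,e^{-2\phi/\hbar}\,d\mathrm{vol}$ after substituting $x=\hbar^{1/2}y$. Explicitly: expand $\tau_p(\gamma)(\hbar^{1/2}y)$, write $e^{-2\phi(\hbar^{1/2}y)/\hbar}\,(\det g_{ij})^{1/2}(\hbar^{1/2}y)=e^{-\langle y,\Lambda y\rangle}\sum_{k\in\mathbb N_0/2}\hbar^k\omega_k(y)$ with polynomials $\omega_k$, multiply the series, and integrate term by term over $y\in\mathbb R^n$. **Spectrum of $Q_0$.** Let $\mu_1,\dots,\mu_r$ be the eigenvalues of $W(p)$, listed with multiplicity, and put $E_{\alpha,k}=\sum_{\nu=1}^n(2\alpha_\nu+1)\lambda_\nu+\mu_k$ for $\alpha\in\mathbb N_0^n$, $1\le k\le r$. For $E_0\in\mathbb R$ let $I_{E_0}=\{(\alpha,k): E_{\alpha,k}=E_0\}$. **Statement.** Let $E_0\in\mathrm{spec}(Q_0)$, where $Q_0$ is considered on $\mathcal E_p[y]$, and let $m_0$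 be the multiplicity of $E_0$, i.e. the dimension of the eigenspace of $Q_0$. Then the operator $Q:\mathfrak S_0\to\mathfrak S_0$ possesses $m_0$ (not necessarily distinct) eigenvalues of the form $$\boldsymbol E_j=E_0+\sum_{\ell\in\mathbb N/2}\hbar^\ell E_{j,\ell},\qquad E_{j,\ell}\in\mathbb R,\qquad j=1,\dots,m_0,$$ with associated eigenvectors $$\boldsymbol\psi_j=\sum_{\ell\in\mathbb N_0/2}\hbar^\ell\psi_{j,\ell}\in\mathfrak S_0,\qquad \psi_{j,\ell}\in\mathcal E_p[y],\qquad \deg\psi_{j,\ell}\le 2\ell+\max_{(\alpha,k)\in I_{E_0}}|\alpha|,$$ that are orthonormal: $(\boldsymbol\psi_i,\boldsymbol\psi_j)_{\mathfrak S_0,\phi}=\delta_{ij}$. -/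

import Mathlib

open scoped Manifold ContDiff Bundle Topology

noncomputable section

/-! ## Formal layer: the spaces `𝔖`, `𝔖₀`, the rescaling operator -/

/-- The coordinate space `ℝⁿ`. -/
abbrev Vec (n : ℕ) := EuclideanSpace ℝ (Fin n)

/-- The field `ℂ((ħ^{1/2}))`; the variable of the Laurent series is `t = ħ^{1/2}`. -/
abbrev Scal := LaurentSeries ℂ

/-- The monomial `t ^ k = ħ ^ (k / 2)`. -/
def tpow (k : ℤ) : Scal := HahnSeries.single k 1

/-- `ℰ_p[[x]]`, the fibre `ℰ_p` being identified with `ℂ^r` by a basis. -/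
abbrev SerX (n r : ℕ) := Fin r → MvPowerSeries (Fin n) ℂ

/-- `ℰ_p[y]`. -/
abbrev PolyY (n r : ℕ) := Fin r → MvPolynomial (Fin n) ℂ

/-- `𝔖 = ℰ_p[[x]]((ħ^{1/2}))`, a vector space over `ℂ((ħ^{1/2}))`. -/
abbrev FormalX (n r : ℕ) := HahnModule ℤ ℂ (SerX n r)

/-- `ℰ_p[y]((ħ^{1/2}))`, a vector space over `ℂ((ħ^{1/2}))`. -/
abbrev FormalY (n r : ℕ) := HahnModule ℤ ℂ (PolyY n r)

/-- The coefficient of `t ^ k = ħ ^ (k / 2)`. -/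
def tcoeff {V : Type*} [AddCommGroup V] [Module ℂ V] (u : HahnModule ℤ ℂ V) (k : ℤ) : V :=
  ((HahnModule.of ℂ).symm u).coeff k

theorem tcoeff_ext {V : Type*} [AddCommGroup V] [Module ℂ V] {u v : HahnModule ℤ ℂ V}
    (h : ∀ k, tcoeff u k = tcoeff v k) : u = v :=
  HahnModule.ext _ _ (funext h)

/-- A series with given coefficients, vanishing below some index. -/
def ofCoeff {V : Type*} [AddCommGroup V] [Module ℂ V] (f : ℤ → V) (m : ℤ)
    (h : ∀ k, k < m → f k = 0) : HahnModule ℤ ℂ V :=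
  HahnModule.of ℂ (HahnSeries.ofSuppBddBelow f
    ⟨m, fun k hk => not_lt.1 fun hlt => hk (h k hlt)⟩)

@[simp] theorem tcoeff_ofCoeff {V : Type*} [AddCommGroup V] [Module ℂ V] (f : ℤ → V) (m : ℤ)
    (h : ∀ k, k < m → f k = 0) (k : ℤ) : tcoeff (ofCoeff f m h) k = f k := rfl

@[simp] theorem tcoeff_add {V : Type*} [AddCommGroup V] [Module ℂ V] (u v : HahnModule ℤ ℂ V)
    (k : ℤ) : tcoeff (u + v) k = tcoeff u k + tcoeff v k := rfl

@[simp] theorem tcoeff_zero {V : Type*} [AddCommGroup V] [Module ℂ V] (k : ℤ) :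
    tcoeff (0 : HahnModule ℤ ℂ V) k = 0 := rfl

/-- Every Laurent series vanishes below some index. -/
theorem exists_lower {V : Type*} [AddCommGroup V] [Module ℂ V] (u : HahnModule ℤ ℂ V) :
    ∃ m : ℤ, ∀ k, k < m → tcoeff u k = 0 := by
  refine ⟨((HahnModule.of ℂ).symm u).order, fun k hk => ?_⟩
  exact HahnSeries.coeff_eq_zero_of_lt_order hk

/-- The action of `ℂ((t))`, as a Cauchy product over a fixed finite range. -/
theorem tcoeff_smul {V : Type*} [AddCommGroup V] [Module ℂ V] (s : Scal) (u : HahnModule ℤ ℂ V)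
    {a b : ℤ} (ha : ∀ i, i < a → s.coeff i = 0) (hb : ∀ i, i < b → tcoeff u i = 0) (k : ℤ) :
    tcoeff (s • u) k = ∑ i ∈ Finset.Icc a (k - b), s.coeff i • tcoeff u (k - i) := by
  unfold tcoeff
  rw [HahnModule.coeff_smul]
  refine Finset.sum_bij_ne_zero (fun ij _ _ => ij.1) ?_ ?_ ?_ ?_
  · rintro ⟨i, j⟩ h hne
    rw [Finset.mem_vaddAntidiagonal] at h
    obtain ⟨h1, h2, h3⟩ := h
    simp only [vadd_eq_add] at h3
    rw [Finset.mem_Icc]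
    constructor
    · by_contra hc
      exact h1 (ha i (not_le.1 hc))
    · by_contra hc
      exact h2 (hb j (by simp only at *; omega))
  · rintro ⟨i, j⟩ h _ ⟨i', j'⟩ h' _ heq
    rw [Finset.mem_vaddAntidiagonal] at h h'
    obtain ⟨-, -, h3⟩ := h
    obtain ⟨-, -, h3'⟩ := h'
    simp only [vadd_eq_add] at h3 h3' heq
    subst heq
    simp only [Prod.mk.injEq, true_and]
    omega
  · intro i _ hne
    refine ⟨(i, k - i), ?_, ?_, rfl⟩
    · rw [Finset.mem_vaddAntidiagonal]
      refine ⟨fun h0 => hne ?_, fun h0 => hne ?_, by simp⟩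
      · rw [h0, zero_smul]
      · rw [h0, smul_zero]
    · exact hne
  · rintro ⟨i, j⟩ h _
    rw [Finset.mem_vaddAntidiagonal] at h
    obtain ⟨-, -, h3⟩ := h
    simp only [vadd_eq_add] at h3
    have : j = k - i := by omega
    rw [this]

/-- The coefficientwise, `ℂ((t))`-linear extension of a `ℂ`-linear operator. -/
def lift {V : Type*} [AddCommGroup V] [Module ℂ V] (P : V →ₗ[ℂ] V) :
    HahnModule ℤ ℂ V →ₗ[Scal] HahnModule ℤ ℂ V where
  toFun u := HahnModule.of ℂ (((HahnModule.of ℂ).symm u).map P)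
  map_add' u v := tcoeff_ext fun k => P.map_add _ _
  map_smul' s u := by
    obtain ⟨a, ha⟩ : ∃ a : ℤ, ∀ k, k < a → s.coeff k = 0 :=
      ⟨s.order, fun k hk => HahnSeries.coeff_eq_zero_of_lt_order hk⟩
    obtain ⟨b, hb⟩ := exists_lower u
    refine tcoeff_ext fun k => ?_
    have hb' : ∀ i, i < b →
        tcoeff (HahnModule.of ℂ (((HahnModule.of ℂ).symm u).map P)) i = 0 := fun i hi => by
      change P (tcoeff u i) = 0
      rw [hb i hi, map_zero]
    rw [RingHom.id_apply, tcoeff_smul s _ ha hb']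
    change P (tcoeff (s • u) k) = _
    rw [tcoeff_smul s u ha hb, map_sum]
    exact Finset.sum_congr rfl fun i _ => P.map_smul _ _

@[simp] theorem tcoeff_lift {V : Type*} [AddCommGroup V] [Module ℂ V] (P : V →ₗ[ℂ] V)
    (u : HahnModule ℤ ℂ V) (k : ℤ) : tcoeff (lift P u) k = P (tcoeff u k) := rfl

/-- The space `𝔖₀` of the series `ħ^{-K} ∑_{j ∈ ℕ₀/2} P_j ħ^j`, `K ∈ ℕ₀/2`, with `P_j ∈ ℰ_p[y]` of
degree at most `2 j`: in powers of `t = ħ^{1/2}`, the coefficient of `t ^ k` has degree at most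
`k + N` for some `N = 2 K ∈ ℕ` (and is zero if `k + N < 0`). -/
def S0 (n r : ℕ) : Submodule Scal (FormalY n r) where
  carrier := {u | ∃ N : ℕ, ∀ (k : ℤ) (a : Fin r), ∀ α ∈ (tcoeff u k a).support,
    (α.degree : ℤ) ≤ k + N}
  zero_mem' := ⟨0, fun k a α h => by simp at h⟩
  add_mem' := by
    rintro u v ⟨N, hN⟩ ⟨N', hN'⟩
    refine ⟨max N N', fun k a α h => ?_⟩
    rw [tcoeff_add, Pi.add_apply] at h
    rcases Finset.mem_union.1 (MvPolynomial.support_add h) with h | h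
    · have := hN k a α h
      push_cast
      omega
    · have := hN' k a α h
      push_cast
      omega
  smul_mem' := by
    rintro s u ⟨N, hN⟩
    obtain ⟨a, ha⟩ : ∃ a : ℤ, ∀ k, k < a → s.coeff k = 0 :=
      ⟨s.order, fun k hk => HahnSeries.coeff_eq_zero_of_lt_order hk⟩
    obtain ⟨b, hb⟩ := exists_lower u
    refine ⟨N + a.natAbs, fun k c α h => ?_⟩
    rw [tcoeff_smul s u ha hb, Finset.sum_apply, MvPolynomial.mem_support_iff,
      MvPolynomial.coeff_sum] at h
    obtain ⟨i, hi, hne⟩ := Finset.exists_ne_zero_of_sum_ne_zero h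
    rw [Pi.smul_apply, MvPolynomial.coeff_smul] at hne
    have h2 := hN (k - i) c α (MvPolynomial.mem_support_iff.2 (right_ne_zero_of_smul hne))
    have h3 := (Finset.mem_Icc.1 hi).1
    rw [Nat.cast_add]
    omega

/-- The homogeneous component of degree `d` of a power series, as a polynomial. -/
def homPart {n : ℕ} (d : ℕ) (f : MvPowerSeries (Fin n) ℂ) : MvPolynomial (Fin n) ℂ :=
  ∑ α ∈ (Finset.univ : Finset (Fin n)).finsuppAntidiag d,
    MvPolynomial.monomial α (MvPowerSeries.coeff α f)

theorem coeff_homPart {n : ℕ} (d : ℕ) (f : MvPowerSeries (Fin n) ℂ) (α : Fin n →₀ ℕ) :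
    (homPart d f).coeff α = if α.degree = d then MvPowerSeries.coeff α f else 0 := by
  classical
  have hdeg : α ∈ (Finset.univ : Finset (Fin n)).finsuppAntidiag d ↔ α.degree = d := by
    simp [Finset.mem_finsuppAntidiag, Finsupp.degree_eq_sum]
  unfold homPart
  rw [MvPolynomial.coeff_sum]
  simp only [MvPolynomial.coeff_monomial]
  rw [Finset.sum_ite_eq']
  simp only [hdeg]

/-- The coefficient of `t ^ k` of `R u`, for `u` vanishing below the index `m`. -/
def rescaleCoeff {n r : ℕ} (u : FormalX n r) (m k : ℤ) : PolyY n r := fun a =>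
  ∑ d ∈ Finset.range ((k - m).toNat + 1), homPart d (tcoeff u (k - d) a)

theorem coeff_rescaleCoeff {n r : ℕ} (u : FormalX n r) (m : ℤ) (hm : ∀ k, k < m → tcoeff u k = 0)
    (k : ℤ) (a : Fin r) (α : Fin n →₀ ℕ) :
    (rescaleCoeff u m k a).coeff α = MvPowerSeries.coeff α (tcoeff u (k - α.degree) a) := by
  unfold rescaleCoeff
  rw [MvPolynomial.coeff_sum]
  simp only [coeff_homPart]
  rw [Finset.sum_ite_eq]
  split_ifs with h
  · rfl
  · rw [Finset.mem_range, not_lt] at h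
    rw [hm _ (by omega)]
    simp

/-- The underlying series of the rescaling `R u`. -/
def rescaleFun {n r : ℕ} (u : FormalX n r) : FormalY n r :=
  ofCoeff (rescaleCoeff u (exists_lower u).choose) (exists_lower u).choose fun k hk => by
    funext a
    ext α
    rw [coeff_rescaleCoeff u _ (exists_lower u).choose_spec,
      (exists_lower u).choose_spec _ (by omega)]
    simp

theorem coeff_rescaleFun {n r : ℕ} (u : FormalX n r) (k : ℤ) (a : Fin r) (α : Fin n →₀ ℕ) :
    (tcoeff (rescaleFun u) k a).coeff α =
      MvPowerSeries.coeff α (tcoeff u (k - α.degree) a) := by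
  rw [rescaleFun, tcoeff_ofCoeff, coeff_rescaleCoeff u _ (exists_lower u).choose_spec]

theorem rescaleFun_mem {n r : ℕ} (u : FormalX n r) : rescaleFun u ∈ S0 n r := by
  obtain ⟨m, hm⟩ := exists_lower u
  refine ⟨m.natAbs, fun k a α h => ?_⟩
  rw [MvPolynomial.mem_support_iff, coeff_rescaleFun] at h
  by_contra hc
  rw [hm _ (by omega)] at h
  exact h (by simp)

/-- The series `R⁻¹ w`, for `w ∈ 𝔖₀`. -/
def unscaleFun {n r : ℕ} (w : S0 n r) : FormalX n r :=
  ofCoeff (fun k a => fun α => (tcoeff (w : FormalY n r) (k + α.degree) a).coeff α)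
    (-((w.2.choose : ℕ) : ℤ)) fun k hk => by
      funext a α
      by_contra hc
      have := w.2.choose_spec (k + α.degree) a α (MvPolynomial.mem_support_iff.2 hc)
      omega

theorem coeff_unscaleFun {n r : ℕ} (w : S0 n r) (k : ℤ) (a : Fin r) (α : Fin n →₀ ℕ) :
    MvPowerSeries.coeff α (tcoeff (unscaleFun w) k a) =
      (tcoeff (w : FormalY n r) (k + α.degree) a).coeff α := rfl

/-- The rescaling operator `R`, substituting `x = ħ^{1/2} y`, that is
`∑ ħ^k u_{α,k} x^α ↦ ∑ ħ^{k + |α|/2} u_{α,k} y^α`, as an isomorphism of `𝔖` onto its image `𝔖₀`. -/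
def rescale (n r : ℕ) : FormalX n r ≃ₗ[Scal] S0 n r where
  toFun u := ⟨rescaleFun u, rescaleFun_mem u⟩
  map_add' u v := by
    refine Subtype.ext (tcoeff_ext fun k => ?_)
    funext a
    ext α
    change (tcoeff (rescaleFun (u + v)) k a).coeff α =
      (tcoeff (rescaleFun u + rescaleFun v) k a).coeff α
    rw [tcoeff_add, Pi.add_apply, MvPolynomial.coeff_add]
    simp only [coeff_rescaleFun, tcoeff_add, Pi.add_apply, map_add]
  map_smul' s u := by
    refine Subtype.ext (tcoeff_ext fun k => ?_)
    funext c
    ext α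
    change (tcoeff (rescaleFun (s • u)) k c).coeff α = (tcoeff (s • rescaleFun u) k c).coeff α
    obtain ⟨a, ha⟩ : ∃ a : ℤ, ∀ k, k < a → s.coeff k = 0 :=
      ⟨s.order, fun k hk => HahnSeries.coeff_eq_zero_of_lt_order hk⟩
    obtain ⟨b, hb⟩ := exists_lower u
    obtain ⟨b', hb'⟩ := exists_lower (rescaleFun u)
    have hd : (0 : ℤ) ≤ (α.degree : ℤ) := Int.natCast_nonneg _
    have e1 := tcoeff_smul s u ha (b := min b (b' - α.degree)) (fun i hi => hb i (by omega))
      (k - α.degree)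
    have e2 := tcoeff_smul s (rescaleFun u) ha (b := min b (b' - α.degree) + α.degree)
      (fun i hi => hb' i (by omega)) k
    rw [coeff_rescaleFun, e1, e2, Finset.sum_apply, Finset.sum_apply, map_sum,
      MvPolynomial.coeff_sum]
    refine Finset.sum_congr (by congr 1; omega) fun i _ => ?_
    rw [Pi.smul_apply, Pi.smul_apply, MvPolynomial.coeff_smul, coeff_rescaleFun, map_smul,
      sub_right_comm]
  invFun := unscaleFun
  left_inv u := by
    refine tcoeff_ext fun k => ?_
    funext a
    ext α
    rw [coeff_unscaleFun, coeff_rescaleFun, add_sub_cancel_right]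
  right_inv w := by
    refine Subtype.ext (tcoeff_ext fun k => ?_)
    funext a
    ext α
    change (tcoeff (rescaleFun (unscaleFun w)) k a).coeff α = _
    rw [coeff_rescaleFun, coeff_unscaleFun, sub_add_cancel]

/-- A polynomial, considered as a series that is constant in `ħ`; it lies in `𝔖₀`. -/
def constS0 (n r : ℕ) : PolyY n r →ₗ[ℂ] S0 n r where
  toFun q := ⟨HahnModule.of ℂ (HahnSeries.single 0 q), by
    classical
    refine ⟨Finset.univ.sup fun a => (q a).totalDegree, fun k a α h => ?_⟩
    change α ∈ ((HahnSeries.single (0 : ℤ) q).coeff k a).support at h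
    rw [HahnSeries.coeff_single] at h
    split_ifs at h with hk
    · have h1 : α.degree ≤ (q a).totalDegree := MvPolynomial.le_totalDegree h
      have h2 : (q a).totalDegree ≤ Finset.univ.sup fun a => (q a).totalDegree :=
        Finset.le_sup (f := fun a => (q a).totalDegree) (Finset.mem_univ a)
      omega
    · simp at h⟩
  map_add' p q := Subtype.ext (tcoeff_ext fun k =>
    congrFun (congrArg HahnSeries.coeff (HahnSeries.single_add (0 : ℤ) p q)) k)
  map_smul' s q := by
    classical
    refine Subtype.ext (tcoeff_ext fun k => ?_)
    change (HahnSeries.single (0 : ℤ) (s • q)).coeff k = s • (HahnSeries.single (0 : ℤ) q).coeff k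
    rw [HahnSeries.coeff_single, HahnSeries.coeff_single]
    split_ifs
    · rfl
    · rw [smul_zero]

/-! ## Taylor series of functions near the origin of `ℝⁿ` -/

/-- The partial derivative `∂_i f`. -/
def pd {n : ℕ} {F : Type*} [NormedAddCommGroup F] [NormedSpace ℝ F] (i : Fin n) (f : Vec n → F) :
    Vec n → F :=
  fun y => fderiv ℝ f y (EuclideanSpace.single i 1)

/-- The iterated partial derivative `∂^α f`. -/
def pdIter {n : ℕ} {F : Type*} [NormedAddCommGroup F] [NormedSpace ℝ F] (α : Fin n →₀ ℕ)
    (f : Vec n → F) : Vec n → F :=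
  (List.finRange n).foldr (fun i h => (pd i)^[α i] h) f

/-- The Taylor series `∑_α ∂^α f(0) / α! x^α` at the origin. -/
def taylor {n : ℕ} (f : Vec n → ℂ) : MvPowerSeries (Fin n) ℂ :=
  fun α => pdIter α f 0 / ((∏ i, (α i).factorial : ℕ) : ℂ)

/-- The Taylor series of a matrix-valued function. -/
def taylorMat {n r : ℕ} (A : Vec n → Matrix (Fin r) (Fin r) ℂ) :
    Matrix (Fin r) (Fin r) (MvPowerSeries (Fin n) ℂ) :=
  Matrix.of fun a b => taylor fun y => A y a b

/-! ## The data of the problem in a chart and a frame, and the operators built from them -/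

/-- The expressions of the geometric objects in a chart with values in `ℝⁿ` (centred at the point
under consideration) and a frame of the bundle: the metric `g_ij`, the Gram matrix of the inner
product of the bundle (conjugate-linear in the first argument), the coefficients of the operator
`L = -∑ g^{ij} ∂_i ∂_j + ∑ b_j ∂_j + c`, the endomorphism `W`, the potential `V` and the
solution `φ` of the eikonal equation. -/
structure LocalData (n r : ℕ) where
  metric : Vec n → Matrix (Fin n) (Fin n) ℝ
  gram : Vec n → Matrix (Fin r) (Fin r) ℂ
  b : Fin n → Vec n → Matrix (Fin r) (Fin r) ℂ
  c : Vec n → Matrix (Fin r) (Fin r) ℂ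
  w : Vec n → Matrix (Fin r) (Fin r) ℂ
  V : Vec n → ℝ
  φ : Vec n → ℝ

namespace LocalData

variable {n r : ℕ} (D : LocalData n r)

/-- The numbers `λ_i` in `τ_p(φ) = ½ ∑ λ_i x_i² + O(|x|³)`, for a chart in which the Hessian of
`φ` at the origin is diagonal. -/
def lam (i : Fin n) : ℝ := pd i (pd i D.φ) 0

/-- The Taylor series of `φ`. -/
def φSer : MvPowerSeries (Fin n) ℂ := taylor fun y => (D.φ y : ℂ)

/-- Multiplication of `ℰ_p[[x]]` by a scalar power series. -/
def mulSer (f : MvPowerSeries (Fin n) ℂ) : SerX n r →ₗ[ℂ] SerX n r :=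
  LinearMap.pi fun a => LinearMap.mulLeft ℂ f ∘ₗ LinearMap.proj a

/-- Multiplication of `ℰ_p[[x]]` by a matrix of power series. -/
def mulMat (A : Matrix (Fin r) (Fin r) (MvPowerSeries (Fin n) ℂ)) : SerX n r →ₗ[ℂ] SerX n r :=
  A.mulVecLin.restrictScalars ℂ

/-- The formal partial derivative on `ℰ_p[[x]]`. -/
def pdSer (j : Fin n) : SerX n r →ₗ[ℂ] SerX n r :=
  LinearMap.pi fun a => (MvPowerSeries.pderiv ℂ j).toLinearMap ∘ₗ LinearMap.proj a

/-- The conjugated derivative `e^{φ/ħ} ∘ ∂_j ∘ e^{-φ/ħ} = ∂_j - ħ⁻¹ ∂_jφ` on `𝔖`. -/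
def conjPd (j : Fin n) : Module.End Scal (FormalX n r) :=
  lift (pdSer j) - tpow (-2) • lift (mulSer (MvPowerSeries.pderiv ℂ j D.φSer))

/-- The Taylor series `τ_p(H_{φ,ħ})` of `H_{φ,ħ} = e^{φ/ħ} ∘ (ħ² L + ħ W + V) ∘ e^{-φ/ħ}`, acting
on `𝔖`: each derivative in `L = -∑ g^{ij} ∂_i ∂_j + ∑ b_j ∂_j + c` is replaced by its conjugate,
and the coefficients by their Taylor series (recall `t = ħ^{1/2}`). -/
def Hφ : Module.End Scal (FormalX n r) :=
  tpow 4 • (-(∑ i, ∑ j, lift (mulSer (taylor fun y => (((D.metric y)⁻¹ i j : ℝ) : ℂ))) *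
        (D.conjPd i * D.conjPd j))
      + (∑ j, lift (mulMat (taylorMat (D.b j))) * D.conjPd j)
      + lift (mulMat (taylorMat D.c)))
    + tpow 2 • lift (mulMat (taylorMat D.w))
    + lift (mulSer (taylor fun y => (D.V y : ℂ)))

/-- The rescaled operator `Q = ħ⁻¹ (R ∘ τ_p(H_{φ,ħ}) ∘ R⁻¹)` on `𝔖₀`. -/
def Q : Module.End Scal (S0 n r) :=
  tpow (-2) • (rescale n r).conj D.Hφ

/-- The leading term `Q_0` of `Q = ∑_{j ∈ ℕ₀/2} ħ^j Q_j`, as an operator on `ℰ_p[y]`. -/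
def Q₀ : Module.End ℂ (PolyY n r) where
  toFun q := tcoeff (D.Q (constS0 n r q) : FormalY n r) 0
  map_add' p q := by rw [map_add, map_add]; rfl
  map_smul' s q := by
    rw [map_smul, LinearMap.map_smul_of_tower]; rfl

/-! ### The hermitian form on `𝔖₀` -/

/-- The rescaling `∑_k t^k f_k(y)` of a power series `f(x)`, `f_k` being the homogeneous part of
degree `k` of `f`. -/
def rescaleSer (f : MvPowerSeries (Fin n) ℂ) : PowerSeries (MvPolynomial (Fin n) ℂ) :=
  PowerSeries.mk fun k => homPart k f

/-- The series `ħ⁻¹ φ(ħ^{1/2} y) - ½ ⟨y, Λ y⟩ = ∑_{k ≥ 1} t^k φ_k(y)`, where `φ_k` is the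
homogeneous part of degree `k + 2` of `τ_p(φ)`. -/
def phaseRest : PowerSeries (MvPolynomial (Fin n) ℂ) :=
  PowerSeries.mk fun k => if k = 0 then 0 else homPart (k + 2) D.φSer

/-- The exponential `∑_m f^m / m!` of a power series `f` in `t` without constant term (only the
terms with `m ≤ k` contribute to the coefficient of `t^k`). -/
def expSer (f : PowerSeries (MvPolynomial (Fin n) ℂ)) : PowerSeries (MvPolynomial (Fin n) ℂ) :=
  PowerSeries.mk fun k =>
    ∑ m ∈ Finset.range (k + 1), ((m.factorial : ℂ)⁻¹) • PowerSeries.coeff k (f ^ m)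

/-- The series `∑_k ħ^{k/2} ω_{k/2}(y)`, defined by
`e^{-2 φ(ħ^{1/2} y)/ħ} (det g_{ij})^{1/2}(ħ^{1/2} y) = e^{-⟨y, Λ y⟩} ∑_k ħ^{k/2} ω_{k/2}(y)`. -/
def omega : PowerSeries (MvPolynomial (Fin n) ℂ) :=
  expSer ((-2 : ℂ) • D.phaseRest) *
    rescaleSer (taylor fun y => ((Real.sqrt (D.metric y).det : ℝ) : ℂ))

/-- The Gaussian integral `∫ q(y) e^{-⟨y, Λ y⟩} dy` of a polynomial `q`. -/
def gaussInt : ZeroHom (MvPolynomial (Fin n) ℂ) ℂ where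
  toFun q := ∫ y : Fin n → ℝ,
    MvPolynomial.eval (fun i => (y i : ℂ)) q * (Real.exp (-∑ i, D.lam i * y i ^ 2) : ℂ)
  map_zero' := by simp

/-- The component in `ℂ[y]((ħ^{1/2}))` with index `a` of an element of `𝔖₀`. -/
def comp (u : S0 n r) (a : Fin r) : LaurentSeries (MvPolynomial (Fin n) ℂ) :=
  ((HahnModule.of ℂ).symm (u : FormalY n r)).map
    (LinearMap.proj a : PolyY n r →ₗ[ℂ] MvPolynomial (Fin n) ℂ)

/-- The hermitian form `( , )_{𝔖₀,φ}` with values in `ℂ((ħ^{1/2}))`: the asymptotic expansion of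
`ħ^{-n/2} ∫ γ[u, v] e^{-2φ/ħ} dvol`, obtained by substituting `x = ħ^{1/2} y` and integrating term
by term,
`(u, v) = ∑_k ħ^k ∑_{j + l + s + m = k} ∫ γ_s[u_j, v_l](y) ω_m(y) e^{-⟨y, Λ y⟩} dy`. -/
def form (u v : S0 n r) : Scal :=
  (∑ a, ∑ b, (comp u a).map (MvPolynomial.map (starRingEnd ℂ)) *
      HahnSeries.ofPowerSeries ℤ (MvPolynomial (Fin n) ℂ)
        (rescaleSer (taylorMat D.gram a b) * D.omega) *
      comp v b).map D.gaussInt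

/-! ### Christoffel symbols and the connection determined by `L` -/

/-- The Christoffel symbols `Γ^k_{ij}`. -/
def christoffel (k i j : Fin n) (y : Vec n) : ℝ :=
  (1 / 2) * ∑ l, (D.metric y)⁻¹ k l *
    (pd i (fun z => D.metric z j l) y + pd j (fun z => D.metric z i l) y
      - pd l (fun z => D.metric z i j) y)

/-- The connection form of the connection `∇_i = ∂_i + A_i` for which `L - ∇^* ∇` is of order zero.
Since `∇^* ∇ = -∑ g^{ij} (∇_i ∇_j - ∑_k Γ^k_{ij} ∇_k)`, comparison of the first order terms gives
`b_k = -2 ∑_i g^{ki} A_i + ∑_{ij} g^{ij} Γ^k_{ij}`. -/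
def connForm (i : Fin n) (y : Vec n) : Matrix (Fin r) (Fin r) ℂ :=
  (1 / 2 : ℂ) • ∑ k, (D.metric y i k : ℂ) •
    (((∑ j, ∑ l, (D.metric y)⁻¹ j l * D.christoffel k j l y : ℝ) : ℂ) • (1 : Matrix _ _ ℂ)
      - D.b k y)

/-- The eigenvalue `E_{α,k} = ∑_j (2 α_j + 1) λ_j + μ_k`. -/
def energy (μ : Fin r → ℝ) (α : Fin n →₀ ℕ) (k : Fin r) : ℝ :=
  ∑ j, (2 * (α j : ℝ) + 1) * D.lam j + μ k

/-- The index set `I_{E_0} = {(α, k) | E_{α,k} = E_0}`. -/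
def indexSet (μ : Fin r → ℝ) (E₀ : ℝ) : Set ((Fin n →₀ ℕ) × Fin r) :=
  {p | D.energy μ p.1 p.2 = E₀}

/-- The number `max_{(α,k) ∈ I_{E_0}} |α|`. -/
def maxDegree (μ : Fin r → ℝ) (E₀ : ℝ) : ℕ :=
  sSup ((fun p : (Fin n →₀ ℕ) × Fin r => p.1.degree) '' D.indexSet μ E₀)

end LocalData

/-! ## Geometric layer -/

section Geometry

variable {n r : ℕ} {M : Type*} [TopologicalSpace M] [ChartedSpace (Vec n) M]

/-- Smooth Riemannian metrics on `M`. -/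
abbrev SmoothMetric (n : ℕ) (M : Type*) [TopologicalSpace M] [ChartedSpace (Vec n) M]
    [IsManifold (𝓡 n) ∞ M] :=
  Bundle.ContMDiffRiemannianMetric (IB := 𝓡 n) (n := ∞) (F := Vec n)
    (E := fun q : M => TangentSpace (𝓡 n) q)

/-- The coordinate vector field `∂_i` of the chart `x`, at the point with coordinates `y`. -/
def coordVec (x : OpenPartialHomeomorph M (Vec n)) (y : Vec n) (i : Fin n) :
    TangentSpace (𝓡 n) (x.symm y) :=
  mfderiv 𝓘(ℝ, Vec n) (𝓡 n) x.symm y (EuclideanSpace.single i (1 : ℝ) : Vec n)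

/-- The matrix `g_ij` of the metric in the chart `x`, as a function of the coordinates. -/
def chartMetric [IsManifold (𝓡 n) ∞ M] (g : SmoothMetric n M)
    (x : OpenPartialHomeomorph M (Vec n)) (y : Vec n) : Matrix (Fin n) (Fin n) ℝ :=
  Matrix.of fun i j => g.inner (x.symm y) (coordVec x y i) (coordVec x y j)

/-- The Hessian matrix of a function in the chart `x`, at the point `p`. -/
def chartHess (x : OpenPartialHomeomorph M (Vec n)) (f : M → ℝ) (p : M) :
    Matrix (Fin n) (Fin n) ℝ :=
  Matrix.of fun i j => pd i (pd j (f ∘ x.symm)) (x p)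

/-- `f` has a non-degenerate (local) minimum at `p`. -/
structure HasNondegMin (f : M → ℝ) (p : M) : Prop where
  isLocalMin : IsLocalMin f p
  nondeg : ∀ x ∈ IsManifold.maximalAtlas (𝓡 n) ∞ M, p ∈ x.source → (chartHess x f p).det ≠ 0

/-- `φ` is a solution on `U`, with value `0` and a non-degenerate minimum at `p`, of the eikonal
equation `|dφ|² = V`; here `|dφ(q)|² = dφ(q)(grad φ(q))`, where the gradient is the tangent vector
`v` with `g(v, ·) = dφ(q)`. -/
structure IsEikonalSolution [IsManifold (𝓡 n) ∞ M] (g : SmoothMetric n M) (V : M → ℝ) (p : M)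
    (U : Set M) (φ : M → ℝ) : Prop where
  isOpen : IsOpen U
  mem : p ∈ U
  smooth : ContMDiffOn (𝓡 n) 𝓘(ℝ, ℝ) ∞ φ U
  map_zero : φ p = 0
  nondegMin : HasNondegMin (n := n) φ p
  eikonal : ∀ q ∈ U, ∃ v : TangentSpace (𝓡 n) q,
    (∀ z : TangentSpace (𝓡 n) q, g.inner q v z = mfderiv (𝓡 n) 𝓘(ℝ, ℝ) φ q z) ∧
      mfderiv (𝓡 n) 𝓘(ℝ, ℝ) φ q v = V q

/-- The model fibre `ℂ^r`. -/
abbrev Fib (r : ℕ) := EuclideanSpace ℂ (Fin r)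

variable {E : M → Type*} [TopologicalSpace (Bundle.TotalSpace (Fib r) E)]
  [∀ q, TopologicalSpace (E q)] [∀ q, AddCommGroup (E q)] [∀ q, Module ℂ (E q)]
  [FiberBundle (Fib r) E]

/-- The section `u` of the bundle is smooth on `s`. -/
def SmoothSecOn (n r : ℕ) {M : Type*} [TopologicalSpace M] [ChartedSpace (Vec n) M]
    {E : M → Type*} [TopologicalSpace (Bundle.TotalSpace (Fib r) E)]
    [∀ q, TopologicalSpace (E q)] [FiberBundle (Fib r) E] (s : Set M) (u : ∀ q, E q) : Prop :=
  ContMDiffOn (𝓡 n) ((𝓡 n).prod 𝓘(ℝ, Fib r)) ∞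
    (fun q => Bundle.TotalSpace.mk' (Fib r) q (u q)) s

/-- A smooth hermitian inner product on the complex vector bundle `E`, conjugate-linear in the
first argument. -/
structure HermitianMetric (n r : ℕ) {M : Type*} [TopologicalSpace M] [ChartedSpace (Vec n) M]
    (E : M → Type*) [TopologicalSpace (Bundle.TotalSpace (Fib r) E)]
    [∀ q, TopologicalSpace (E q)] [∀ q, AddCommGroup (E q)] [∀ q, Module ℂ (E q)]
    [FiberBundle (Fib r) E] where
  inner (q : M) : E q →ₗ⋆[ℂ] E q →ₗ[ℂ] ℂ
  conj_symm (q : M) (u v : E q) : starRingEnd ℂ (inner q u v) = inner q v u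
  pos (q : M) (u : E q) (hu : u ≠ 0) : 0 < (inner q u u).re
  smooth (s : Set M) (hs : IsOpen s) (u v : ∀ q, E q) (hu : SmoothSecOn n r s u)
    (hv : SmoothSecOn n r s v) :
    ContMDiffOn (𝓡 n) 𝓘(ℝ, ℂ) ∞ (fun q => inner q (u q) (v q)) s

/-- The sections `e_a` form a smooth frame of the complex vector bundle `E` over `s`. -/
structure IsFrameOn (n : ℕ) {r : ℕ} {M : Type*} [TopologicalSpace M] [ChartedSpace (Vec n) M]
    {E : M → Type*} [TopologicalSpace (Bundle.TotalSpace (Fib r) E)]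
    [∀ q, TopologicalSpace (E q)] [∀ q, AddCommGroup (E q)] [∀ q, Module ℂ (E q)]
    [FiberBundle (Fib r) E] (e : Fin r → ∀ q, E q) (s : Set M) : Prop where
  smooth (a : Fin r) : SmoothSecOn n r s (e a)
  linearIndependent : ∀ q ∈ s, LinearIndependent ℂ fun a => e a q
  span_eq_top : ∀ q ∈ s, Submodule.span ℂ (Set.range fun a => e a q) = ⊤

variable [VectorBundle ℝ (Fib r) E]

/-- The space `Γ^∞(M, E)` of smooth sections. -/
abbrev Sec (n r : ℕ) {M : Type*} [TopologicalSpace M] [ChartedSpace (Vec n) M] (E : M → Type*)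
    [TopologicalSpace (Bundle.TotalSpace (Fib r) E)] [∀ q, TopologicalSpace (E q)]
    [FiberBundle (Fib r) E] :=
  ContMDiffSection (𝓡 n) (Fib r) ∞ E

/-- In the chart `x` and the frame `e`, the operator `L` has the form
`-∑ g^{ij} ∂_i ∂_j + ∑ b_j ∂_j + c` with smooth matrix-valued functions `b_j` and `c`. -/
structure HasLaplaceForm [IsManifold (𝓡 n) ∞ M] (g : SmoothMetric n M)
    (L : Sec n r E →ₗ[ℝ] Sec n r E) (x : OpenPartialHomeomorph M (Vec n)) (e : Fin r → ∀ q, E q)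
    (b : Fin n → Vec n → Matrix (Fin r) (Fin r) ℂ) (c : Vec n → Matrix (Fin r) (Fin r) ℂ) :
    Prop where
  smooth_b (j : Fin n) (k l : Fin r) : ContDiffOn ℝ ∞ (fun y => b j y k l) x.target
  smooth_c (k l : Fin r) : ContDiffOn ℝ ∞ (fun y => c y k l) x.target
  apply_eq (u : Sec n r E) (f : Fin r → Vec n → ℂ)
    (hf : ∀ y ∈ x.target, u (x.symm y) = ∑ k, f k y • e k (x.symm y)) :
    ∀ y ∈ x.target, L u (x.symm y) = ∑ k,
      (-(∑ i, ∑ j, ((chartMetric g x y)⁻¹ i j : ℂ) * pd i (pd j (f k)) y)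
        + ∑ j, ∑ l, b j y k l * pd j (f l) y
        + ∑ l, c y k l * f l y) • e k (x.symm y)

/-- `L` is a differential operator of Laplace type. -/
def IsLaplaceType [IsManifold (𝓡 n) ∞ M] (g : SmoothMetric n M)
    (L : Sec n r E →ₗ[ℝ] Sec n r E) : Prop :=
  ∀ x ∈ IsManifold.maximalAtlas (𝓡 n) ∞ M, ∀ e : Fin r → ∀ q, E q,
    IsFrameOn n e x.source → ∃ b c, HasLaplaceForm g L x e b c

/-- Symmetry of `L` on compactly supported sections:
`∫_M γ[L u, v] dvol = ∫_M γ[u, L v] dvol`. It is only required for sections `u`, `v` with compact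
support in the domain of a chart `x`, where `dvol = (det g_ij)^{1/2} dy`; for an operator of Laplace
type this gives all compactly supported sections, by a partition of unity. -/
def IsSymmetricOp [IsManifold (𝓡 n) ∞ M] (g : SmoothMetric n M) (γ : HermitianMetric n r E)
    (L : Sec n r E →ₗ[ℝ] Sec n r E) : Prop :=
  ∀ x ∈ IsManifold.maximalAtlas (𝓡 n) ∞ M, ∀ (u v : Sec n r E) (K : Set M), IsCompact K →
    K ⊆ x.source → (∀ q ∉ K, u q = 0) → (∀ q ∉ K, v q = 0) →
    ∫ y in x.target, γ.inner (x.symm y) (L u (x.symm y)) (v (x.symm y)) *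
        (Real.sqrt (chartMetric g x y).det : ℂ) =
      ∫ y in x.target, γ.inner (x.symm y) (u (x.symm y)) (L v (x.symm y)) *
        (Real.sqrt (chartMetric g x y).det : ℂ)

/-- The assumptions on the Schrödinger operator `H_ħ = ħ² L + ħ W + V`: the operator `L` is a
symmetric operator of Laplace type, `W` is a smooth symmetric endomorphism field, and `V` is a
smooth real function with a non-degenerate minimum at `p`, `V(p) = 0`. -/
structure IsSchrodingerSetup [IsManifold (𝓡 n) ∞ M] (g : SmoothMetric n M)
    (γ : HermitianMetric n r E) (L : Sec n r E →ₗ[ℝ] Sec n r E) (W : ∀ q, E q →ₗ[ℂ] E q)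
    (V : M → ℝ) (p : M) : Prop where
  laplace : IsLaplaceType g L
  symm_L : IsSymmetricOp g γ L
  smooth_W (s : Set M) (hs : IsOpen s) (u : ∀ q, E q) (hu : SmoothSecOn n r s u) :
    SmoothSecOn n r s fun q => W q (u q)
  symm_W (q : M) (u v : E q) : γ.inner q (W q u) v = γ.inner q u (W q v)
  smooth_V : ContMDiff (𝓡 n) 𝓘(ℝ, ℝ) ∞ V
  V_zero : V p = 0
  nondegMin_V : HasNondegMin (n := n) V p

/-- The expressions of the geometric objects in the chart `x` and the frame `e`. -/
def localData [IsManifold (𝓡 n) ∞ M] (g : SmoothMetric n M) (γ : HermitianMetric n r E)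
    (V φ : M → ℝ) (x : OpenPartialHomeomorph M (Vec n)) (e : Fin r → ∀ q, E q)
    (b : Fin n → Vec n → Matrix (Fin r) (Fin r) ℂ) (c w : Vec n → Matrix (Fin r) (Fin r) ℂ) :
    LocalData n r where
  metric := chartMetric g x
  gram y := Matrix.of fun k l => γ.inner (x.symm y) (e k (x.symm y)) (e l (x.symm y))
  b := b
  c := c
  w := w
  V := V ∘ x.symm
  φ := φ ∘ x.symm

/-- The local data `D` are the expressions of `g, γ, L, W, V, φ` in coordinates and a frame of the
following kind.
* `x` is a normal chart at `p`: it is centred at `p`, with `g_ij = δ_ij` at `p`, and the rays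
  through the origin solve the geodesic equation. It is rotated so that the Hessian of `φ` at `p` is
  diagonal.
* `e` is a frame that is orthonormal at `p` and parallel along the geodesics emanating from `p`,
  with respect to the connection determined by `L`. It identifies the fibre of `E` at `p` with `ℂ^r`
  and trivializes `E` near `p`. -/
structure IsNormalData [IsManifold (𝓡 n) ∞ M] (g : SmoothMetric n M)
    (γ : HermitianMetric n r E) (L : Sec n r E →ₗ[ℝ] Sec n r E) (W : ∀ q, E q →ₗ[ℂ] E q)
    (V φ : M → ℝ) (p : M) (x : OpenPartialHomeomorph M (Vec n)) (e : Fin r → ∀ q, E q)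
    (D : LocalData n r) : Prop where
  chart_mem : x ∈ IsManifold.maximalAtlas (𝓡 n) ∞ M
  mem_source : p ∈ x.source
  centred : x p = 0
  frame : IsFrameOn n e x.source
  laplaceForm : HasLaplaceForm g L x e D.b D.c
  endForm : ∀ y ∈ x.target, ∀ l, W (x.symm y) (e l (x.symm y)) = ∑ k, D.w y k l • e k (x.symm y)
  data_eq : D = localData g γ V φ x e D.b D.c D.w
  metric_zero : D.metric 0 = 1
  geodesic : ∀ᶠ y in 𝓝 (0 : Vec n), ∀ k, ∑ i, ∑ j, D.christoffel k i j y * y i * y j = 0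
  diagonal : ∀ i j, i ≠ j → pd i (pd j D.φ) 0 = 0
  gram_zero : D.gram 0 = 1
  parallel : ∀ᶠ y in 𝓝 (0 : Vec n), ∑ i, (y i : ℂ) • D.connForm i y = 0

end Geometry

/-- The inclusion `ℝ[[ħ^{1/2}]] ⊆ ℂ((ħ^{1/2}))`. -/
def realSeries (f : PowerSeries ℝ) : Scal :=
  HahnSeries.ofPowerSeries ℤ ℂ (f.map Complex.ofRealHom)

end

/-! ## Partial derivatives and Taylor series -/

section PartialDerivatives

variable {n : ℕ} {F : Type*} [NormedAddCommGroup F] [NormedSpace ℝ F]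

/-! Write t = ħ^{1/2}. The theorem is degenerate perturbation theory in the formal variable t. The
operator Q is symmetric for the hermitian form, and the E₀-eigenspace of its leading term Q₀ has
finite dimension. This eigenspace extends to a Q-invariant family over ℂ[[t]], on which Q acts by a
matrix of power series, self-adjoint for the Gram matrix of the family. Rellich's theorem for formal
power series diagonalizes that matrix by an orthonormal basis with real eigenvalue series.

The geometry is condensed into `LocalData.IsRegular`. Symmetry of L, tested on sections ζ e_a and η
e_b with ζ, η real test functions, gives by integration by parts two identities between the
coefficients of L and the densities γ_ab (det g)^{1/2} (`formal_adjoint_identities`,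
`adjoint_identities_chart`). They hold near the origin, hence pass to Taylor series, because
`taylor` is compatible with sums, products, derivatives and conjugation. The eikonal equation
becomes V = ∑ g^{ij} ∂_iφ ∂_jφ.

The substitution x = t y is the ring homomorphism `rho` from ℂ[[x]] to ℂ[y]((t)), under which
∂_{x_j} becomes `dX`, that is t⁻¹ ∂_{y_j}. In these terms the eikonal equation cancels t⁻² V against
the square of dφ (`comp_Q_reduced`), and since dφ vanishes at p the remaining first order terms lose
no power of t. So Q preserves both the lowest power of t and the bound |α| ≤ k + d on the monomials
t^k y^α (`LocalData.IsRegular.Q_mem_lauFil`). On top degree coefficients Q₀ acts as ∑ (2α_j + 1) λ_j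
+ W(p), which bounds the degrees of its eigenvectors
(`LocalData.IsRegular.totalDegree_le_of_mem_eigenspace`).

For the symmetry of Q the weight e^{-2φ/ħ} is shared evenly by the two factors, so that each
derivative turns into the conjugated derivative `dConj`. `green_identity` then writes the difference
of the integrands as a twisted divergence, and Gaussian integration by parts kills it
(`gaussL_dX_sub`, `form_Q`). At order t^0 this says that Q₀ is symmetric for a positive definite
Gaussian inner product. As Q₀ preserves the polynomials of degree at most d, a space of finite
dimension, that space is the sum of the range of Q₀ - E₀ and the eigenspace
(`exists_Q₀_decomposition`).

This decomposition solves the recursion of `exists_invariant_family`: at each order the known terms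
split into a part removed by the next coefficient of the family and a part absorbed into the next
coefficient of the matrix. The same recursion, applied to a matrix instead of Q, separates the
spectral blocks in `hasOrthonormalEigenbasis`, where an induction on the size of the matrix finishes
each block. -/

theorem ContDiffAt.pd {f : Vec n → F} {y : Vec n} (hf : ContDiffAt ℝ ∞ f y) (i : Fin n) :
    ContDiffAt ℝ ∞ (_root_.pd i f) y := by
  have h : ContDiffAt ℝ ∞ (fderiv ℝ f) y := hf.fderiv_right (m := ∞) (by simp)
  exact h.clm_apply contDiffAt_const

theorem Filter.EventuallyEq.pd {f g : Vec n → F} {y : Vec n} (h : f =ᶠ[𝓝 y] g) (i : Fin n) :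
    _root_.pd i f =ᶠ[𝓝 y] _root_.pd i g := by
  filter_upwards [h.fderiv (𝕜 := ℝ)] with z hz
  simp only [_root_.pd, hz]

theorem pd_add {f g : Vec n → F} {y : Vec n} (hf : DifferentiableAt ℝ f y)
    (hg : DifferentiableAt ℝ g y) (i : Fin n) :
    pd i (fun z => f z + g z) y = pd i f y + pd i g y := by
  simp only [pd]
  rw [fderiv_fun_add hf hg]
  rfl

theorem pd_mul {f g : Vec n → ℂ} {y : Vec n} (hf : DifferentiableAt ℝ f y)
    (hg : DifferentiableAt ℝ g y) (i : Fin n) :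
    pd i (fun z => f z * g z) y = f y * pd i g y + g y * pd i f y := by
  simp only [pd]
  rw [fderiv_fun_mul hf hg]
  simp

theorem pd_const (c : F) (i : Fin n) (y : Vec n) : pd i (fun _ => c) y = 0 := by
  simp [pd]

theorem pd_clm_comp {G : Type*} [NormedAddCommGroup G] [NormedSpace ℝ G] (A : F →L[ℝ] G)
    {f : Vec n → F} {y : Vec n} (hf : DifferentiableAt ℝ f y) (i : Fin n) :
    pd i (fun z => A (f z)) y = A (pd i f y) := by
  simp only [pd]
  have := (A.hasFDerivAt.comp y hf.hasFDerivAt).fderiv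
  rw [show (fun z => A (f z)) = A ∘ f from rfl, this]
  rfl

theorem pd_ofReal {f : Vec n → ℝ} {y : Vec n} (hf : DifferentiableAt ℝ f y) (i : Fin n) :
    pd i (fun z => (f z : ℂ)) y = ((pd i f y : ℝ) : ℂ) :=
  pd_clm_comp Complex.ofRealCLM hf i

theorem pd_conj (f : Vec n → ℂ) (i : Fin n) (y : Vec n) :
    pd i (fun z => starRingEnd ℂ (f z)) y = starRingEnd ℂ (pd i f y) := by
  have := Complex.conjCLE.comp_fderiv (f := f) (x := y)
  simp only [pd]
  rw [show (fun z => starRingEnd ℂ (f z)) = Complex.conjCLE ∘ f from rfl, this]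
  rfl

theorem ContDiffAt.differentiableAt_infty {f : Vec n → F} {y : Vec n} (hf : ContDiffAt ℝ ∞ f y) :
    DifferentiableAt ℝ f y :=
  hf.differentiableAt (by simp)

theorem ContDiffAt.eventually_two {f : Vec n → F} {y : Vec n} (hf : ContDiffAt ℝ ∞ f y) :
    ∀ᶠ z in 𝓝 y, ContDiffAt ℝ 2 f z :=
  (hf.of_le (m := 2) (WithTop.coe_le_coe.2 le_top)).eventually (by simp)

theorem ContDiffAt.eventually_differentiableAt {f : Vec n → F} {y : Vec n}
    (hf : ContDiffAt ℝ ∞ f y) : ∀ᶠ z in 𝓝 y, DifferentiableAt ℝ f z := by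
  filter_upwards [hf.eventually_two] with z hz
  exact hz.differentiableAt (by simp)

theorem pd_pd_apply {f : Vec n → F} {y : Vec n} (hf : ContDiffAt ℝ 2 f y) (i j : Fin n) :
    pd i (pd j f) y = fderiv ℝ (fderiv ℝ f) y (EuclideanSpace.single i 1)
      (EuclideanSpace.single j 1) := by
  have h : DifferentiableAt ℝ (fderiv ℝ f) y :=
    (hf.fderiv_right (m := 1) (by norm_num)).differentiableAt (by simp)
  change fderiv ℝ (fun z => fderiv ℝ f z (EuclideanSpace.single j 1)) y _ = _
  rw [fderiv_clm_apply h (differentiableAt_const _)]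
  simp

theorem pd_comm {f : Vec n → F} {y : Vec n} (hf : ContDiffAt ℝ ∞ f y) (i j : Fin n) :
    pd i (pd j f) =ᶠ[𝓝 y] pd j (pd i f) := by
  filter_upwards [hf.eventually_two] with z hz
  rw [pd_pd_apply hz, pd_pd_apply hz]
  exact (hz.isSymmSndFDerivAt (by simp)).eq _ _

end PartialDerivatives

/-! ### Taylor expansion as a map to formal power series, compatible with algebra and derivatives -/

section Taylor

variable {n : ℕ} {F : Type*} [NormedAddCommGroup F] [NormedSpace ℝ F]

theorem ContDiffAt.pd_iterate {f : Vec n → F} {y : Vec n} (hf : ContDiffAt ℝ ∞ f y) (i : Fin n)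
    (k : ℕ) : ContDiffAt ℝ ∞ ((_root_.pd i)^[k] f) y := by
  induction k with
  | zero => exact hf
  | succ k ih => rw [Function.iterate_succ_apply']; exact ih.pd i

theorem Filter.EventuallyEq.pd_iterate {f g : Vec n → F} {y : Vec n} (h : f =ᶠ[𝓝 y] g) (i : Fin n)
    (k : ℕ) : (_root_.pd i)^[k] f =ᶠ[𝓝 y] (_root_.pd i)^[k] g := by
  induction k with
  | zero => exact h
  | succ k ih => rw [Function.iterate_succ_apply', Function.iterate_succ_apply']; exact ih.pd i

theorem pd_iterate_comm {f : Vec n → F} {y : Vec n} (hf : ContDiffAt ℝ ∞ f y) (i j : Fin n)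
    (k : ℕ) : (pd i)^[k] (pd j f) =ᶠ[𝓝 y] pd j ((pd i)^[k] f) := by
  induction k with
  | zero => rfl
  | succ k ih =>
    rw [Function.iterate_succ_apply', Function.iterate_succ_apply']
    exact (ih.pd i).trans (pd_comm (hf.pd_iterate i k) i j)

/-- Iterated partial derivatives along a list of directions. -/
noncomputable def pdList (α : Fin n →₀ ℕ) (l : List (Fin n)) (f : Vec n → F) : Vec n → F :=
  l.foldr (fun i h => (pd i)^[α i] h) f

theorem ContDiffAt.pdList {f : Vec n → F} {y : Vec n} (hf : ContDiffAt ℝ ∞ f y) (α : Fin n →₀ ℕ)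
    (l : List (Fin n)) : ContDiffAt ℝ ∞ (pdList α l f) y := by
  induction l with
  | nil => exact hf
  | cons i l ih => exact ih.pd_iterate i (α i)

theorem pdList_congr {f g : Vec n → F} {y : Vec n} (h : f =ᶠ[𝓝 y] g) (α : Fin n →₀ ℕ)
    (l : List (Fin n)) : pdList α l f =ᶠ[𝓝 y] pdList α l g := by
  induction l with
  | nil => exact h
  | cons i l ih => exact ih.pd_iterate i (α i)

theorem pdList_pd {f : Vec n → F} {y : Vec n} (hf : ContDiffAt ℝ ∞ f y) (α : Fin n →₀ ℕ)
    (j : Fin n) (l : List (Fin n)) : pdList α l (pd j f) =ᶠ[𝓝 y] pd j (pdList α l f) := by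
  induction l with
  | nil => rfl
  | cons i l ih =>
    exact (ih.pd_iterate i (α i)).trans (pd_iterate_comm (hf.pdList α l) i j (α i))

theorem pdList_congr_index (f : Vec n → F) {α β : Fin n →₀ ℕ} {l : List (Fin n)}
    (h : ∀ i ∈ l, α i = β i) : pdList α l f = pdList β l f := by
  induction l with
  | nil => rfl
  | cons i l ih =>
    change (pd i)^[α i] (pdList α l f) = (pd i)^[β i] (pdList β l f)
    rw [ih fun k hk => h k (List.mem_cons_of_mem _ hk), h i List.mem_cons_self]

/-- In a list without repetitions the direction j is met exactly once, so raising its exponent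
inserts a single extra derivative; this derivative commutes past the others to the front. -/
theorem pdList_add_single {f : Vec n → F} {y : Vec n} (hf : ContDiffAt ℝ ∞ f y) (α : Fin n →₀ ℕ)
    (j : Fin n) {l : List (Fin n)} (hl : l.Nodup) (hj : j ∈ l) :
    pdList (α + Finsupp.single j 1) l f =ᶠ[𝓝 y] pd j (pdList α l f) := by
  induction l with
  | nil => simp at hj
  | cons i l ih =>
    rw [List.nodup_cons] at hl
    rcases eq_or_ne i j with rfl | hij
    · have h1 : pdList (α + Finsupp.single i 1) l f = pdList α l f :=
        pdList_congr_index f fun k hk => by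
          have : i ≠ k := fun h => hl.1 (h ▸ hk)
          simp [this]
      change (pd i)^[(α + Finsupp.single i 1 : Fin n →₀ ℕ) i] (pdList (α + Finsupp.single i 1) l f) =ᶠ[𝓝 y]
        pd i ((pd i)^[α i] (pdList α l f))
      rw [h1, Finsupp.add_apply, Finsupp.single_eq_same, Function.iterate_succ_apply']
    · have hj' : j ∈ l := by
        rcases List.mem_cons.1 hj with h | h
        · exact absurd h.symm hij
        · exact h
      have h2 : (α + Finsupp.single j 1 : Fin n →₀ ℕ) i = α i := by
        simp [hij.symm]
      change (pd i)^[(α + Finsupp.single j 1 : Fin n →₀ ℕ) i] (pdList (α + Finsupp.single j 1) l f) =ᶠ[𝓝 y]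
        pd j ((pd i)^[α i] (pdList α l f))
      rw [h2]
      exact ((ih hl.2 hj').pd_iterate i (α i)).trans (pd_iterate_comm (hf.pdList α l) i j (α i))

theorem pdIter_pd {f : Vec n → F} {y : Vec n} (hf : ContDiffAt ℝ ∞ f y) (α : Fin n →₀ ℕ)
    (j : Fin n) : pdIter α (pd j f) y = pdIter (α + Finsupp.single j 1) f y :=
  ((pdList_pd hf α j _).trans
    (pdList_add_single hf α j (List.nodup_finRange n) (List.mem_finRange j)).symm).eq_of_nhds

theorem coeff_taylor (f : Vec n → ℂ) (α : Fin n →₀ ℕ) :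
    MvPowerSeries.coeff α (taylor f) = pdIter α f 0 / ((∏ i, (α i).factorial : ℕ) : ℂ) := rfl

theorem taylor_congr {f g : Vec n → ℂ} (h : f =ᶠ[𝓝 0] g) : taylor f = taylor g := by
  ext α
  rw [coeff_taylor, coeff_taylor]
  congr 1
  exact (pdList_congr h α _).eq_of_nhds

theorem constantCoeff_taylor (f : Vec n → ℂ) : MvPowerSeries.constantCoeff (taylor f) = f 0 := by
  rw [← MvPowerSeries.coeff_zero_eq_constantCoeff_apply, coeff_taylor]
  have : ∀ l : List (Fin n), pdList 0 l f = f := fun l => by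
    induction l with
    | nil => rfl
    | cons i l ih => exact ih
  have h : pdIter 0 f = f := this _
  simp [h]

/-- The factor α_j + 1 of the formal derivative cancels against (α_j + 1)! in the Taylor
coefficient. All further rules for `taylor` are reduced to this one and to the constant term. -/
theorem pderiv_taylor {f : Vec n → ℂ} (hf : ContDiffAt ℝ ∞ f 0) (j : Fin n) :
    MvPowerSeries.pderiv ℂ j (taylor f) = taylor (pd j f) := by
  ext α
  rw [MvPowerSeries.coeff_pderiv, coeff_taylor, coeff_taylor, pdIter_pd hf]
  have h : (∏ i, ((α + Finsupp.single j 1 : Fin n →₀ ℕ) i).factorial : ℕ) =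
      (α j + 1) * ∏ i, (α i).factorial := by
    rw [← Finset.mul_prod_erase _ _ (Finset.mem_univ j),
      ← Finset.mul_prod_erase (a := j) Finset.univ (fun i => (α i).factorial) (Finset.mem_univ j)]
    rw [Finsupp.add_apply, Finsupp.single_eq_same, Nat.factorial_succ, mul_assoc]
    congr 2
    refine Finset.prod_congr rfl fun i hi => ?_
    have : j ≠ i := (Finset.ne_of_mem_erase hi).symm
    simp [this]
  rw [h]
  have h1 : ((α j : ℂ) + 1) ≠ 0 := by exact_mod_cast Nat.succ_ne_zero (α j)
  have h2 : ((∏ i, (α i).factorial : ℕ) : ℂ) ≠ 0 := by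
    exact_mod_cast Finset.prod_ne_zero_iff.2 fun i _ => Nat.factorial_ne_zero _
  push_cast at h2 ⊢
  field_simp

/-- Power series over a field of characteristic zero coincide if their constant terms and partial
derivatives do, degree by degree. -/
theorem MvPowerSeries.coeff_eq_of_pderiv {f g : MvPowerSeries (Fin n) ℂ} {α : Fin n →₀ ℕ}
    {j : Fin n} (h : coeff α (pderiv ℂ j f) = coeff α (pderiv ℂ j g)) :
    coeff (α + Finsupp.single j 1) f = coeff (α + Finsupp.single j 1) g := by
  rw [coeff_pderiv, coeff_pderiv] at h
  have h1 : ((α j : ℂ) + 1) ≠ 0 := by exact_mod_cast Nat.succ_ne_zero (α j)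
  exact mul_right_cancel₀ h1 h

theorem Finsupp.exists_eq_add_single {α : Fin n →₀ ℕ} (h : α ≠ 0) :
    ∃ (β : Fin n →₀ ℕ) (j : Fin n), α = β + Finsupp.single j 1 := by
  obtain ⟨j, hj⟩ := Finsupp.ne_iff.1 h
  refine ⟨α - Finsupp.single j 1, j, ?_⟩
  rw [tsub_add_cancel_of_le]
  rw [Finsupp.single_le_iff]
  exact Nat.one_le_iff_ne_zero.2 hj

/-- A property of Taylor series is proved by comparing constant terms and derivatives. -/
theorem taylor_induction {P : Type*} (A B : P → MvPowerSeries (Fin n) ℂ)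
    (h0 : ∀ x, MvPowerSeries.constantCoeff (A x) = MvPowerSeries.constantCoeff (B x))
    (h1 : ∀ x (j : Fin n), ∃ s : Finset P, MvPowerSeries.pderiv ℂ j (A x) = ∑ y ∈ s, A y ∧
      MvPowerSeries.pderiv ℂ j (B x) = ∑ y ∈ s, B y) (x : P) : A x = B x := by
  -- The induction is on |α| and keeps x general, since differentiating leads to other members of
  -- the family.
  have key : ∀ (k : ℕ) (α : Fin n →₀ ℕ), α.degree = k → ∀ x,
      MvPowerSeries.coeff α (A x) = MvPowerSeries.coeff α (B x) := by
    intro k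
    induction k with
    | zero =>
      intro α hα x
      rw [Finsupp.degree_eq_zero_iff] at hα
      subst hα
      exact h0 x
    | succ k ih =>
      intro α hα x
      have hne : α ≠ 0 := fun h => by simp [h] at hα
      obtain ⟨β, j, rfl⟩ := Finsupp.exists_eq_add_single hne
      refine MvPowerSeries.coeff_eq_of_pderiv ?_
      obtain ⟨s, hA, hB⟩ := h1 x j
      rw [hA, hB, map_sum, map_sum]
      refine Finset.sum_congr rfl fun y _ => ih β ?_ y
      simpa using hα
  ext α
  exact key _ α rfl x

theorem taylor_add {f g : Vec n → ℂ} (hf : ContDiffAt ℝ ∞ f 0) (hg : ContDiffAt ℝ ∞ g 0) :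
    taylor (fun y => f y + g y) = taylor f + taylor g := by
  let P := {p : (Vec n → ℂ) × (Vec n → ℂ) // ContDiffAt ℝ ∞ p.1 0 ∧ ContDiffAt ℝ ∞ p.2 0}
  refine taylor_induction (P := P) (fun p => taylor fun y => p.1.1 y + p.1.2 y)
    (fun p => taylor p.1.1 + taylor p.1.2) (fun p => ?_) (fun p j => ?_) ⟨(f, g), hf, hg⟩
  · simp [constantCoeff_taylor]
  · obtain ⟨⟨f, g⟩, hf, hg⟩ := p
    refine ⟨{⟨(pd j f, pd j g), hf.pd j, hg.pd j⟩}, ?_, ?_⟩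
    · rw [Finset.sum_singleton, pderiv_taylor (hf.add hg)]
      refine taylor_congr ?_
      filter_upwards [hf.eventually_differentiableAt, hg.eventually_differentiableAt] with y h1 h2
      exact pd_add h1 h2 j
    · rw [Finset.sum_singleton, map_add, pderiv_taylor hf, pderiv_taylor hg]

/-- Leibniz' rule holds on both sides and lowers the degree of the coefficient to be compared. The
degree induction is run directly because the two Leibniz terms may coincide (for f = g), in which
case a `Finset` of pairs, as in `taylor_induction`, would count them once. -/
theorem taylor_mul {f g : Vec n → ℂ} (hf : ContDiffAt ℝ ∞ f 0) (hg : ContDiffAt ℝ ∞ g 0) :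
    taylor (fun y => f y * g y) = taylor f * taylor g := by
  have key : ∀ (k : ℕ) (α : Fin n →₀ ℕ), α.degree = k → ∀ f g : Vec n → ℂ,
      ContDiffAt ℝ ∞ f 0 → ContDiffAt ℝ ∞ g 0 →
      MvPowerSeries.coeff α (taylor fun y => f y * g y) =
        MvPowerSeries.coeff α (taylor f * taylor g) := by
    intro k
    induction k with
    | zero =>
      intro α hα f g _ _
      rw [Finsupp.degree_eq_zero_iff] at hα
      subst hα
      rw [MvPowerSeries.coeff_zero_eq_constantCoeff_apply,
        MvPowerSeries.coeff_zero_eq_constantCoeff_apply, map_mul]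
      simp only [constantCoeff_taylor]
    | succ k ih =>
      intro α hα f g hf hg
      have hne : α ≠ 0 := fun h => by simp [h] at hα
      obtain ⟨β, j, rfl⟩ := Finsupp.exists_eq_add_single hne
      have hβ : β.degree = k := by simpa using hα
      refine MvPowerSeries.coeff_eq_of_pderiv ?_
      have e : taylor (pd j fun y => f y * g y) =
          taylor (fun y => f y * pd j g y) + taylor (fun y => g y * pd j f y) := by
        rw [← taylor_add (hf.mul (hg.pd j)) (hg.mul (hf.pd j))]
        refine taylor_congr ?_
        filter_upwards [hf.eventually_differentiableAt, hg.eventually_differentiableAt] with y h1 h2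
        exact pd_mul h1 h2 j
      rw [pderiv_taylor (hf.mul hg), e, Derivation.leibniz, map_add, map_add, smul_eq_mul,
        smul_eq_mul, ih β hβ f _ hf (hg.pd j), ih β hβ g _ hg (hf.pd j), pderiv_taylor hf,
        pderiv_taylor hg]
  ext α
  exact key _ α rfl f g hf hg

theorem taylor_zero : taylor (fun _ : Vec n => (0 : ℂ)) = 0 := by
  have h := taylor_add (n := n) (f := fun _ => 0) (g := fun _ => 0) contDiffAt_const
    contDiffAt_const
  simp only [add_zero] at h
  exact left_eq_add.1 h

theorem taylor_const (c : ℂ) : taylor (fun _ : Vec n => c) = MvPowerSeries.C c := by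
  refine MvPowerSeries.pderiv.ext ?_ ?_
  · intro j
    rw [pderiv_taylor contDiffAt_const, MvPowerSeries.pderiv_C, ← taylor_zero (n := n)]
    exact taylor_congr (Filter.Eventually.of_forall fun y => pd_const c j y)
  · rw [constantCoeff_taylor, MvPowerSeries.constantCoeff_C]

theorem taylor_sum {ι : Type*} (s : Finset ι) {f : ι → Vec n → ℂ}
    (hf : ∀ k ∈ s, ContDiffAt ℝ ∞ (f k) 0) :
    taylor (fun y => ∑ k ∈ s, f k y) = ∑ k ∈ s, taylor (f k) := by
  classical
  induction s using Finset.induction_on with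
  | empty =>
    simp only [Finset.sum_empty]
    rw [taylor_const, map_zero]
  | insert a s ha ih =>
    simp only [Finset.sum_insert ha]
    rw [taylor_add (hf a (Finset.mem_insert_self a s))
      (ContDiffAt.sum fun k hk => hf k (Finset.mem_insert_of_mem hk)),
      ih fun k hk => hf k (Finset.mem_insert_of_mem hk)]

theorem taylor_conj {f : Vec n → ℂ} (hf : ContDiffAt ℝ ∞ f 0) :
    taylor (fun y => starRingEnd ℂ (f y)) = MvPowerSeries.map (starRingEnd ℂ) (taylor f) := by
  let P := {p : Vec n → ℂ // ContDiffAt ℝ ∞ p 0}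
  refine taylor_induction (P := P) (fun p => taylor fun y => starRingEnd ℂ (p.1 y))
    (fun p => MvPowerSeries.map (starRingEnd ℂ) (taylor p.1)) (fun p => ?_) (fun p j => ?_) ⟨f, hf⟩
  · simp [constantCoeff_taylor]
  · obtain ⟨f, hf⟩ := p
    refine ⟨{⟨pd j f, hf.pd j⟩}, ?_, ?_⟩
    · rw [Finset.sum_singleton, pderiv_taylor
        (show ContDiffAt ℝ ∞ (fun y => starRingEnd ℂ (f y)) 0 from
          Complex.conjCLE.contDiff.contDiffAt.comp 0 hf)]
      refine taylor_congr (Filter.Eventually.of_forall fun y => pd_conj f j y)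
    · rw [Finset.sum_singleton]
      simp only
      rw [← pderiv_taylor hf]
      ext α
      simp [MvPowerSeries.coeff_pderiv]

end Taylor

open MeasureTheory

/-! ## Integration by parts and the identities expressing formal self-adjointness -/

section Variations

variable {n : ℕ} {Ω : Set (Vec n)}

/-- Real-valued smooth test functions with compact support in `Ω`, as complex functions. -/
structure IsTestFun (Ω : Set (Vec n)) (ζ : Vec n → ℂ) : Prop where
  smooth : ContDiff ℝ ∞ ζ
  compact : HasCompactSupport ζ
  subset : tsupport ζ ⊆ Ω
  real : ∀ y, starRingEnd ℂ (ζ y) = ζ y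

theorem tsupport_pd_subset (f : Vec n → ℂ) (i : Fin n) : tsupport (pd i f) ⊆ tsupport f :=
  (tsupport_fderiv_apply_subset ℝ _)

theorem IsTestFun.pd {ζ : Vec n → ℂ} (h : IsTestFun Ω ζ) (i : Fin n) :
    IsTestFun Ω (_root_.pd i ζ) where
  smooth := contDiff_iff_contDiffAt.2 fun y => h.smooth.contDiffAt.pd i
  compact := h.compact.mono' ((subset_tsupport _).trans (tsupport_pd_subset ζ i))
  subset := (tsupport_pd_subset ζ i).trans h.subset
  real y := by
    rw [← pd_conj]
    simp only [h.real]

/-- Off the support of ζ the product vanishes near the point, so the coefficient may be arbitrary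
outside Ω. This allows chart expressions to be integrated over all of ℝⁿ. -/
theorem contDiffAt_mul_of_tsupport {a ζ : Vec n → ℂ} (ha : ∀ y ∈ Ω, ContDiffAt ℝ ∞ a y)
    (hs : ContDiff ℝ ∞ ζ) (hζ : tsupport ζ ⊆ Ω) : ContDiff ℝ ∞ fun y => a y * ζ y := by
  refine contDiff_iff_contDiffAt.2 fun y => ?_
  by_cases hy : y ∈ tsupport ζ
  · exact (ha y (hζ hy)).mul hs.contDiffAt
  · refine (contDiffAt_const (c := (0 : ℂ))).congr_of_eventuallyEq ?_
    filter_upwards [notMem_tsupport_iff_eventuallyEq.1 hy] with z hz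
    simp [hz]

theorem integrable_mul_test {a ζ : Vec n → ℂ} (ha : ∀ y ∈ Ω, ContDiffAt ℝ ∞ a y)
    (hζ : IsTestFun Ω ζ) : Integrable fun y => a y * ζ y :=
  (contDiffAt_mul_of_tsupport ha hζ.smooth hζ.subset).continuous.integrable_of_hasCompactSupport
    (hζ.compact.mul_left)

theorem integral_mul_pd_test {a ζ : Vec n → ℂ} (ha : ∀ y ∈ Ω, ContDiffAt ℝ ∞ a y)
    (hζ : IsTestFun Ω ζ) (i : Fin n) :
    ∫ y, a y * pd i ζ y = -∫ y, pd i a y * ζ y := by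
  refine integral_mul_fderiv_eq_neg_fderiv_mul_of_integrable ?_ ?_ ?_ ?_ ?_
  · exact integrable_mul_test (fun y hy => (ha y hy).pd i) hζ
  · exact integrable_mul_test ha (hζ.pd i)
  · exact integrable_mul_test ha hζ
  · exact fun y hy => (ha y (hζ.subset hy)).differentiableAt_infty
  · exact fun y _ => hζ.smooth.contDiffAt.differentiableAt_infty

/-- Fundamental lemma of the calculus of variations: vanishing almost everywhere improves to
vanishing everywhere by continuity on the open set. -/
theorem eq_zero_of_integral_test {f : Vec n → ℂ} (hΩ : IsOpen Ω)
    (hf : ∀ y ∈ Ω, ContDiffAt ℝ ∞ f y)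
    (h : ∀ ζ, IsTestFun Ω ζ → ∫ y, f y * ζ y = 0) : ∀ y ∈ Ω, f y = 0 := by
  have hc : ContinuousOn f Ω := fun y hy => (hf y hy).continuousAt.continuousWithinAt
  have hae : ∀ᵐ y, y ∈ Ω → f y = 0 := by
    refine hΩ.ae_eq_zero_of_integral_contDiff_smul_eq_zero
      (hc.locallyIntegrableOn hΩ.measurableSet) fun g hg hgc hgs => ?_
    have hsub : tsupport (fun y => (g y : ℂ)) ⊆ tsupport g :=
      closure_mono fun y hy => by
        simpa using hy
    rw [← h (fun y => (g y : ℂ)) ⟨Complex.ofRealCLM.contDiff.comp hg,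
      hgc.mono' ((subset_tsupport _).trans hsub), hsub.trans hgs, fun y => Complex.conj_ofReal _⟩]
    refine integral_congr_ae (Filter.Eventually.of_forall fun y => ?_)
    simp [mul_comm]
  have hae' : f =ᵐ[volume.restrict Ω] 0 := (ae_restrict_iff' hΩ.measurableSet).2 hae
  exact Measure.eqOn_open_of_ae_eq hae' hΩ hc continuousOn_const

/-- Near every point of an open set there is a test function with prescribed germ. -/
theorem exists_test_germ (hΩ : IsOpen Ω) {y₀ : Vec n} (hy₀ : y₀ ∈ Ω) {g : Vec n → ℝ}
    (hg : ContDiff ℝ ∞ g) : ∃ η, IsTestFun Ω η ∧ η =ᶠ[𝓝 y₀] fun y => (g y : ℂ) := by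
  obtain ⟨ε, hε, hball⟩ := Metric.isOpen_iff.1 hΩ y₀ hy₀
  let f : ContDiffBump y₀ := ⟨ε / 4, ε / 2, by positivity, by linarith⟩
  have hsub : tsupport (fun y => ((f y * g y : ℝ) : ℂ)) ⊆ tsupport f :=
    closure_mono fun y hy => by
      simp only [Function.mem_support, ne_eq, Complex.ofReal_eq_zero, mul_eq_zero, not_or] at hy
      exact hy.1
  refine ⟨fun y => ((f y * g y : ℝ) : ℂ), ⟨?_, ?_, ?_, fun y => Complex.conj_ofReal _⟩, ?_⟩
  · exact Complex.ofRealCLM.contDiff.comp (f.contDiff.mul hg)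
  · exact f.hasCompactSupport.mono' ((subset_tsupport _).trans hsub)
  · refine hsub.trans ?_
    rw [f.tsupport_eq]
    exact (Metric.closedBall_subset_ball (by change ε / 2 < ε; linarith)).trans hball
  · filter_upwards [f.eventuallyEq_one] with y hy
    simp [hy]

theorem pd_pd_mul {f g : Vec n → ℂ} {y : Vec n} (hf : ContDiffAt ℝ ∞ f y)
    (hg : ContDiffAt ℝ ∞ g y) (i j : Fin n) :
    pd i (pd j fun z => f z * g z) y = f y * pd i (pd j g) y + pd j g y * pd i f y +
      (g y * pd i (pd j f) y + pd j f y * pd i g y) := by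
  have e : pd j (fun z => f z * g z) =ᶠ[𝓝 y] fun z => f z * pd j g z + g z * pd j f z := by
    filter_upwards [hf.eventually_differentiableAt, hg.eventually_differentiableAt] with z h1 h2
    exact pd_mul h1 h2 j
  rw [(e.pd i).eq_of_nhds, pd_add (hf.mul (hg.pd j)).differentiableAt_infty
    (hg.mul (hf.pd j)).differentiableAt_infty,
    pd_mul hf.differentiableAt_infty (hg.pd j).differentiableAt_infty,
    pd_mul hg.differentiableAt_infty (hf.pd j).differentiableAt_infty]

/-- Moving all derivatives from ζ to η and using that ζ is arbitrary turns the integral identity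
into a differential equation satisfied by every test function η. Its second order terms cancel since
p is symmetric, and the freedom in the value and gradient of η at a point separates the orders one
and zero. -/
theorem formal_adjoint_identities (hΩ : IsOpen Ω) {p : Fin n → Fin n → Vec n → ℂ}
    {β β' : Fin n → Vec n → ℂ} {κ κ' : Vec n → ℂ}
    (hp : ∀ i j, ∀ y ∈ Ω, ContDiffAt ℝ ∞ (p i j) y) (hsymm : ∀ i j, p i j = p j i)
    (hβ : ∀ j, ∀ y ∈ Ω, ContDiffAt ℝ ∞ (β j) y) (hβ' : ∀ j, ∀ y ∈ Ω, ContDiffAt ℝ ∞ (β' j) y)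
    (hκ : ∀ y ∈ Ω, ContDiffAt ℝ ∞ κ y) (hκ' : ∀ y ∈ Ω, ContDiffAt ℝ ∞ κ' y)
    (h : ∀ ζ η, IsTestFun Ω ζ → IsTestFun Ω η →
      ∫ y in Ω, (-(∑ i, ∑ j, p i j y * pd i (pd j ζ) y) + ∑ j, β j y * pd j ζ y + κ y * ζ y) * η y =
      ∫ y in Ω, ζ y *
        (-(∑ i, ∑ j, p i j y * pd i (pd j η) y) + ∑ j, β' j y * pd j η y + κ' y * η y)) :
    ∀ y ∈ Ω, (∀ j, 2 * ∑ i, pd i (p i j) y + β j y + β' j y = 0) ∧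
      ∑ i, ∑ j, pd i (pd j (p i j)) y + ∑ j, pd j (β j) y = κ y - κ' y := by
  have key : ∀ η, IsTestFun Ω η → ∀ y ∈ Ω,
      (∑ i, ∑ j, pd i (pd j (p i j)) y + ∑ j, pd j (β j) y - (κ y - κ' y)) * η y +
        ∑ j, (2 * ∑ i, pd i (p i j) y + β j y + β' j y) * pd j η y = 0 := by
    intro η hη
    have hη' : ∀ y ∈ Ω, ContDiffAt ℝ ∞ η y := fun y _ => hη.smooth.contDiffAt
    have hpη : ∀ i j, ∀ y ∈ Ω, ContDiffAt ℝ ∞ (fun z => p i j z * η z) y :=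
      fun i j y hy => (hp i j y hy).mul (hη' y hy)
    have hβη : ∀ j, ∀ y ∈ Ω, ContDiffAt ℝ ∞ (fun z => β j z * η z) y :=
      fun j y hy => (hβ j y hy).mul (hη' y hy)
    have hG : ∀ y ∈ Ω, ContDiffAt ℝ ∞ (fun y =>
        -(∑ i, ∑ j, pd j (pd i fun z => p i j z * η z) y) - ∑ j, pd j (fun z => β j z * η z) y
          + κ y * η y) y := fun y hy =>
      (((ContDiffAt.sum fun i _ => ContDiffAt.sum fun j _ => ((hpη i j y hy).pd i).pd j).neg).sub
        (ContDiffAt.sum fun j _ => (hβη j y hy).pd j)).add ((hκ y hy).mul (hη' y hy))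
    have hH : ∀ y ∈ Ω, ContDiffAt ℝ ∞ (fun y =>
        -(∑ i, ∑ j, p i j y * pd i (pd j η) y) + ∑ j, β' j y * pd j η y + κ' y * η y) y :=
      fun y hy =>
      (((ContDiffAt.sum fun i _ => ContDiffAt.sum fun j _ =>
        (hp i j y hy).mul (((hη' y hy).pd j).pd i)).neg).add
        (ContDiffAt.sum fun j _ => (hβ' j y hy).mul ((hη' y hy).pd j))).add
        ((hκ' y hy).mul (hη' y hy))
    have h0 := eq_zero_of_integral_test hΩ (fun y hy => (hG y hy).sub (hH y hy)) ?_
    · intro y hy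
      have e := h0 y hy
      have e1 : ∀ i j, pd j (pd i fun z => p i j z * η z) y =
          p i j y * pd i (pd j η) y + pd i η y * pd j (p j i) y +
            -- Derivatives are put in the common order i, j by Schwarz' theorem and the symmetry of
            -- p, so that the second derivatives of η cancel literally.
            (η y * pd i (pd j (p i j)) y + pd i (p i j) y * pd j η y) := fun i j => by
        rw [pd_pd_mul (hp i j y hy) (hη' y hy), (pd_comm (hη' y hy) j i).eq_of_nhds,
          (pd_comm (hp i j y hy) j i).eq_of_nhds, hsymm j i]
      have e2 : ∀ j, pd j (fun z => β j z * η z) y = β j y * pd j η y + η y * pd j (β j) y :=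
        fun j => pd_mul (hβ j y hy).differentiableAt_infty (hη' y hy).differentiableAt_infty j
      simp only [e1, e2, Finset.sum_add_distrib] at e
      have e3 : ∑ i, ∑ j, pd i η y * pd j (p j i) y = ∑ j, ∑ i, pd i (p i j) y * pd j η y :=
        Finset.sum_congr rfl fun i _ => Finset.sum_congr rfl fun j _ => mul_comm _ _
      have e4 : ∑ i, ∑ j, pd i (p i j) y * pd j η y = ∑ j, ∑ i, pd i (p i j) y * pd j η y :=
        Finset.sum_comm
      rw [e3, e4] at e
      simp only [← Finset.mul_sum] at e
      simp only [add_mul, Finset.sum_add_distrib, mul_assoc, Finset.sum_mul]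
      simp only [Finset.mul_sum] at e ⊢
      simp only [← Finset.mul_sum] at e ⊢
      linear_combination -e
    · intro ζ hζ
      have hz : ∀ y ∉ Ω, ζ y = 0 := fun y hy => image_eq_zero_of_notMem_tsupport
        fun hc => hy (hζ.subset hc)
      have hz1 : ∀ j, ∀ y ∉ Ω, pd j ζ y = 0 := fun j y hy => image_eq_zero_of_notMem_tsupport
        fun hc => hy ((hζ.pd j).subset hc)
      have hz2 : ∀ i j, ∀ y ∉ Ω, pd i (pd j ζ) y = 0 := fun i j y hy =>
        image_eq_zero_of_notMem_tsupport fun hc => hy (((hζ.pd j).pd i).subset hc)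
      have e := h ζ η hζ hη
      rw [setIntegral_eq_integral_of_forall_compl_eq_zero (fun y hy => by
          simp [hz y hy, hz1 _ y hy, hz2 _ _ y hy]),
        setIntegral_eq_integral_of_forall_compl_eq_zero (fun y hy => by simp [hz y hy])] at e
      have i1 : ∀ i j, Integrable fun y => (p i j y * η y) * pd i (pd j ζ) y :=
        fun i j => integrable_mul_test (hpη i j) ((hζ.pd j).pd i)
      have i2 : ∀ j, Integrable fun y => (β j y * η y) * pd j ζ y :=
        fun j => integrable_mul_test (hβη j) (hζ.pd j)
      have i3 : Integrable fun y => (κ y * η y) * ζ y :=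
        integrable_mul_test (fun y hy => (hκ y hy).mul (hη' y hy)) hζ
      have j1 : ∀ i j, Integrable fun y => pd j (pd i fun z => p i j z * η z) y * ζ y :=
        fun i j => integrable_mul_test (fun y hy => ((hpη i j y hy).pd i).pd j) hζ
      have j2 : ∀ j, Integrable fun y => pd j (fun z => β j z * η z) y * ζ y :=
        fun j => integrable_mul_test (fun y hy => (hβη j y hy).pd j) hζ
      have eL : ∫ y, (-(∑ i, ∑ j, p i j y * pd i (pd j ζ) y) + ∑ j, β j y * pd j ζ y +
          κ y * ζ y) * η y = -(∑ i, ∑ j, ∫ y, (p i j y * η y) * pd i (pd j ζ) y) +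
            ∑ j, (∫ y, (β j y * η y) * pd j ζ y) + ∫ y, (κ y * η y) * ζ y := by
        have s1 : Integrable fun y => ∑ i, ∑ j, (p i j y * η y) * pd i (pd j ζ) y :=
          integrable_finsetSum _ fun i _ => integrable_finsetSum _ fun j _ => i1 i j
        have s1' : Integrable fun y => -∑ i, ∑ j, (p i j y * η y) * pd i (pd j ζ) y := s1.neg
        have s2 : Integrable fun y => ∑ j, (β j y * η y) * pd j ζ y :=
          integrable_finsetSum _ fun j _ => i2 j
        have s3 : Integrable fun y => -(∑ i, ∑ j, (p i j y * η y) * pd i (pd j ζ) y) +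
            ∑ j, (β j y * η y) * pd j ζ y := s1'.add s2
        rw [← integral_finsetSum _ fun j _ => i2 j]
        simp only [← integral_finsetSum _ fun j _ => i1 _ j]
        rw [← integral_finsetSum _ fun i _ => integrable_finsetSum _ fun j _ => i1 i j,
          ← integral_neg, ← integral_add s1' s2, ← integral_add s3 i3]
        refine integral_congr_ae (Filter.Eventually.of_forall fun y => ?_)
        simp only [add_mul, neg_mul, Finset.sum_mul]
        congr 1
        · congr 1
          · refine congrArg _ (Finset.sum_congr rfl fun i _ => Finset.sum_congr rfl fun j _ => ?_)
            ring
          · exact Finset.sum_congr rfl fun j _ => by ring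
        · ring
      have eR : ∫ y, (-(∑ i, ∑ j, pd j (pd i fun z => p i j z * η z) y) -
          ∑ j, pd j (fun z => β j z * η z) y + κ y * η y) * ζ y =
          -(∑ i, ∑ j, ∫ y, pd j (pd i fun z => p i j z * η z) y * ζ y) -
            ∑ j, (∫ y, pd j (fun z => β j z * η z) y * ζ y) + ∫ y, (κ y * η y) * ζ y := by
        have s1 : Integrable fun y => ∑ i, ∑ j, pd j (pd i fun z => p i j z * η z) y * ζ y :=
          integrable_finsetSum _ fun i _ => integrable_finsetSum _ fun j _ => j1 i j
        have s1' : Integrable fun y =>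
            -∑ i, ∑ j, pd j (pd i fun z => p i j z * η z) y * ζ y := s1.neg
        have s2 : Integrable fun y => ∑ j, pd j (fun z => β j z * η z) y * ζ y :=
          integrable_finsetSum _ fun j _ => j2 j
        have s3 : Integrable fun y =>
            -(∑ i, ∑ j, pd j (pd i fun z => p i j z * η z) y * ζ y) -
              ∑ j, pd j (fun z => β j z * η z) y * ζ y := s1'.sub s2
        rw [← integral_finsetSum _ fun j _ => j2 j]
        simp only [← integral_finsetSum _ fun j _ => j1 _ j]
        rw [← integral_finsetSum _ fun i _ => integrable_finsetSum _ fun j _ => j1 i j,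
          ← integral_neg, ← integral_sub s1' s2, ← integral_add s3 i3]
        refine integral_congr_ae (Filter.Eventually.of_forall fun y => ?_)
        simp only [add_mul, sub_mul, neg_mul, Finset.sum_mul]
      have e1 : ∀ i j, ∫ y, (p i j y * η y) * pd i (pd j ζ) y =
          ∫ y, pd j (pd i fun z => p i j z * η z) y * ζ y := fun i j => by
        rw [integral_mul_pd_test (hpη i j) (hζ.pd j),
          integral_mul_pd_test (fun y hy => (hpη i j y hy).pd i) hζ, neg_neg]
      have e2 : ∀ j, ∫ y, (β j y * η y) * pd j ζ y =
          -∫ y, pd j (fun z => β j z * η z) y * ζ y :=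
        fun j => integral_mul_pd_test (hβη j) hζ j
      rw [eL] at e
      simp only [e1, e2, Finset.sum_neg_distrib] at e
      rw [← sub_eq_add_neg, ← eR] at e
      simp only [sub_mul (_ + _) _ (ζ _)]
      rw [integral_sub (integrable_mul_test hG hζ) (integrable_mul_test hH hζ), e, sub_eq_zero]
      exact integral_congr_ae (Filter.Eventually.of_forall fun y => mul_comm _ _)
  intro y hy
  -- A test function equal to 1 near y has vanishing gradient there and isolates the zeroth order
  -- term.
  have hS : ∑ i, ∑ j, pd i (pd j (p i j)) y + ∑ j, pd j (β j) y - (κ y - κ' y) = 0 := by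
    obtain ⟨η, hη, hη1⟩ := exists_test_germ hΩ hy (g := fun _ => 1) contDiff_const
    have := key η hη y hy
    have hpd : ∀ j, pd j η y = 0 := fun j => by
      rw [(hη1.pd j).eq_of_nhds, pd_const]
    simpa [hpd, hη1.eq_of_nhds] using this
  refine ⟨fun k => ?_, sub_eq_zero.1 hS⟩
  -- A test function equal to the k-th coordinate near y isolates the k-th first order coefficient;
  -- its value at y does not matter because the zeroth order coefficient has already been shown to
  -- vanish.
  obtain ⟨η, hη, hη1⟩ := exists_test_germ hΩ hy (g := fun z => EuclideanSpace.proj (𝕜 := ℝ) k z)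
    (EuclideanSpace.proj (𝕜 := ℝ) k).contDiff
  have := key η hη y hy
  have hpd : ∀ j, pd j η y = if j = k then 1 else 0 := fun j => by
    rw [(hη1.pd j).eq_of_nhds,
      pd_ofReal (EuclideanSpace.proj (𝕜 := ℝ) k).differentiableAt, pd,
      ContinuousLinearMap.fderiv]
    by_cases hjk : j = k
    · simp [hjk]
    · simp [hjk, Ne.symm hjk]
  rw [hS, zero_mul, zero_add] at this
  simpa [hpd] using this

end Variations

/-! ## The geometric objects in a chart -/

section Chart

variable {n r : ℕ} {M : Type*} [TopologicalSpace M] [ChartedSpace (Vec n) M]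
  {x : OpenPartialHomeomorph M (Vec n)}

theorem contMDiffAt_symm_chart [IsManifold (𝓡 n) ∞ M]
    (hx : x ∈ IsManifold.maximalAtlas (𝓡 n) ∞ M) {y : Vec n}
    (hy : y ∈ x.target) : ContMDiffAt 𝓘(ℝ, Vec n) (𝓡 n) ∞ x.symm y :=
  contMDiffAt_symm_of_mem_maximalAtlas hx hy

theorem contDiffAt_comp_symm_chart [IsManifold (𝓡 n) ∞ M]
    (hx : x ∈ IsManifold.maximalAtlas (𝓡 n) ∞ M) {F : Type*} [NormedAddCommGroup F]
    [NormedSpace ℝ F] {f : M → F} {y : Vec n} (hy : y ∈ x.target)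
    (hf : ContMDiffAt (𝓡 n) 𝓘(ℝ, F) ∞ f (x.symm y)) : ContDiffAt ℝ ∞ (f ∘ x.symm) y :=
  contMDiffAt_iff_contDiffAt.1 (hf.comp y (contMDiffAt_symm_chart hx hy))

/-- The coordinate field is the image of a constant field under the tangent map of the inverse
chart, which is smooth. -/
theorem contMDiffAt_coordVec [IsManifold (𝓡 n) ∞ M]
    (hx : x ∈ IsManifold.maximalAtlas (𝓡 n) ∞ M) {y : Vec n} (hy : y ∈ x.target) (i : Fin n) :
    ContMDiffAt 𝓘(ℝ, Vec n) ((𝓡 n).prod 𝓘(ℝ, Vec n)) ∞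
      (fun y => Bundle.TotalSpace.mk' (Vec n) (E := fun q : M => TangentSpace (𝓡 n) q)
        (x.symm y) (coordVec x y i)) y := by
  have h1 : ContMDiffOn 𝓘(ℝ, Vec n) (𝓡 n) ∞ x.symm x.target :=
    contMDiffOn_symm_of_mem_maximalAtlas hx
  have h2 := h1.contMDiffOn_tangentMapWithin (m := ∞) (by simp)
    x.open_target.uniqueMDiffOn
  have h3 : ContMDiff 𝓘(ℝ, Vec n) (𝓘(ℝ, Vec n).prod 𝓘(ℝ, Vec n)) ∞
      (fun y : Vec n => Bundle.TotalSpace.mk' (Vec n)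
        (E := fun q : Vec n => TangentSpace 𝓘(ℝ, Vec n) q) y
        (EuclideanSpace.single i (1 : ℝ) : Vec n)) := by
    exact fun z => contMDiffAt_vectorSpace_iff_contDiffAt.2 contDiffAt_const
  have h4 := (h2.comp h3.contMDiffOn (s := x.target) (fun z hz => hz)).contMDiffAt
    (x.open_target.mem_nhds hy)
  refine h4.congr_of_eventuallyEq ?_
  filter_upwards [x.open_target.mem_nhds hy] with z hz
  simp only [Function.comp, tangentMapWithin, coordVec]
  rw [mfderivWithin_of_isOpen x.open_target hz]

theorem contDiffAt_chartMetric [IsManifold (𝓡 n) ∞ M] (g : SmoothMetric n M)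
    (hx : x ∈ IsManifold.maximalAtlas (𝓡 n) ∞ M) {y : Vec n} (hy : y ∈ x.target) (i j : Fin n) :
    ContDiffAt ℝ ∞ (fun y => chartMetric g x y i j) y := by
  rw [← contMDiffAt_iff_contDiffAt]
  have h1 := (g.contMDiff (x.symm y)).comp y (contMDiffAt_symm_chart hx hy)
  have h2 := ContMDiffAt.clm_bundle_apply₂ (F₁ := Vec n) (F₂ := Vec n) (F₃ := ℝ)
    (E₁ := fun q : M => TangentSpace (𝓡 n) q) (E₂ := fun q : M => TangentSpace (𝓡 n) q)
    (E₃ := Bundle.Trivial M ℝ)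
    h1 (contMDiffAt_coordVec hx hy i) (contMDiffAt_coordVec hx hy j)
  exact (Bundle.contMDiffAt_totalSpace.1 h2).2

/-- The differential of the inverse of a chart. -/
noncomputable abbrev chartDeriv (x : OpenPartialHomeomorph M (Vec n)) (y : Vec n) :
    Vec n →L[ℝ] TangentSpace (𝓡 n) (x.symm y) :=
  mfderiv 𝓘(ℝ, Vec n) (𝓡 n) x.symm y

theorem chartDeriv_injective [IsManifold (𝓡 n) ∞ M]
    (hx : x ∈ IsManifold.maximalAtlas (𝓡 n) ∞ M) {y : Vec n} (hy : y ∈ x.target) :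
    Function.Injective (chartDeriv x y) := by
  have h1 : MDifferentiableAt 𝓘(ℝ, Vec n) (𝓡 n) x.symm y :=
    (contMDiffAt_symm_chart hx hy).mdifferentiableAt (by simp)
  have h2 : MDifferentiableAt (𝓡 n) 𝓘(ℝ, Vec n) x (x.symm y) :=
    (contMDiffAt_of_mem_maximalAtlas hx (x.map_target hy)).mdifferentiableAt (by simp)
  have h3 := mfderiv_comp y h2 h1
  have h4 : mfderiv 𝓘(ℝ, Vec n) 𝓘(ℝ, Vec n) (x ∘ x.symm) y =
      ContinuousLinearMap.id ℝ (TangentSpace 𝓘(ℝ, Vec n) y) := by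
    rw [← mfderiv_id]
    apply Filter.EventuallyEq.mfderiv_eq
    filter_upwards [x.open_target.mem_nhds hy] with z hz
    exact x.right_inv hz
  rw [h4] at h3
  intro a b hab
  have h5 := congrArg (mfderiv (𝓡 n) 𝓘(ℝ, Vec n) x (x.symm y)) hab
  have h6 := fun v : Vec n => (congrArg (fun A => A v) h3).symm
  exact (h6 a).symm.trans (h5.trans (h6 b))

theorem chartDeriv_surjective [IsManifold (𝓡 n) ∞ M]
    (hx : x ∈ IsManifold.maximalAtlas (𝓡 n) ∞ M) {y : Vec n} (hy : y ∈ x.target) :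
    Function.Surjective (chartDeriv x y) := by
  let A : Vec n →L[ℝ] Vec n := chartDeriv x y
  exact (LinearMap.injective_iff_surjective (f := (A : Vec n →ₗ[ℝ] Vec n))).1
    (chartDeriv_injective hx hy)

theorem vec_eq_sum (a : Vec n) : a = ∑ i, a i • EuclideanSpace.single i (1 : ℝ) := by
  ext k
  simp [Pi.single_apply]

theorem chartDeriv_apply (x : OpenPartialHomeomorph M (Vec n)) (y a : Vec n) :
    chartDeriv x y a = ∑ i, a i • coordVec x y i := by
  conv_lhs => rw [vec_eq_sum a, map_sum]
  refine Finset.sum_congr rfl fun i _ => ?_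
  rw [map_smul]
  rfl

theorem posDef_chartMetric [IsManifold (𝓡 n) ∞ M] (g : SmoothMetric n M)
    (hx : x ∈ IsManifold.maximalAtlas (𝓡 n) ∞ M) {y : Vec n} (hy : y ∈ x.target) :
    (chartMetric g x y).PosDef := by
  refine Matrix.PosDef.of_dotProduct_mulVec_pos ?_ fun a ha => ?_
  · ext i j
    simp only [Matrix.conjTranspose_apply, chartMetric, Matrix.of_apply, star_trivial]
    exact g.symm _ _ _
  · have h0 : chartDeriv x y (WithLp.toLp 2 a) ≠ 0 := fun h => by
      have := chartDeriv_injective hx hy (h.trans (map_zero _).symm)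
      exact ha (by simpa using this)
    have h1 := g.pos _ _ h0
    rw [chartDeriv_apply] at h1
    simp only [map_sum, map_smul, sum_apply, smul_apply] at h1
    have h2 : star a ⬝ᵥ (chartMetric g x y).mulVec a =
        ∑ i, a i * ∑ j, a j * chartMetric g x y j i := by
      simp only [dotProduct, Matrix.mulVec, Pi.star_apply, star_trivial, Finset.mul_sum]
      rw [Finset.sum_comm]
      exact Finset.sum_congr rfl fun i _ => Finset.sum_congr rfl fun j _ => by ring
    rw [h2]
    exact h1

theorem mfderiv_coordVec [IsManifold (𝓡 n) ∞ M]
    (hx : x ∈ IsManifold.maximalAtlas (𝓡 n) ∞ M) {y : Vec n} (hy : y ∈ x.target) {f : M → ℝ}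
    (hf : MDifferentiableAt (𝓡 n) 𝓘(ℝ, ℝ) f (x.symm y)) (i : Fin n) :
    mfderiv (𝓡 n) 𝓘(ℝ, ℝ) f (x.symm y) (coordVec x y i) = pd i (f ∘ x.symm) y := by
  have h1 : MDifferentiableAt 𝓘(ℝ, Vec n) (𝓡 n) x.symm y :=
    (contMDiffAt_symm_chart hx hy).mdifferentiableAt (by simp)
  rw [pd, ← mfderiv_eq_fderiv, mfderiv_comp y hf h1]
  rfl

/-- If the gradient is ∑ a_i ∂_i, pairing it with the coordinate fields gives g a = dφ, hence a =
g⁻¹ dφ; evaluating dφ on the gradient gives the formula. -/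
theorem eikonal_chart [IsManifold (𝓡 n) ∞ M] {g : SmoothMetric n M} {V : M → ℝ} {p : M}
    {U : Set M} {φ : M → ℝ} (h : IsEikonalSolution g V p U φ)
    (hx : x ∈ IsManifold.maximalAtlas (𝓡 n) ∞ M) {y : Vec n} (hy : y ∈ x.target)
    (hyU : x.symm y ∈ U) :
    V (x.symm y) = ∑ i, ∑ j, (chartMetric g x y)⁻¹ i j * pd i (φ ∘ x.symm) y *
      pd j (φ ∘ x.symm) y := by
  have hφ : MDifferentiableAt (𝓡 n) 𝓘(ℝ, ℝ) φ (x.symm y) :=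
    ((h.smooth _ hyU).contMDiffAt (h.isOpen.mem_nhds hyU)).mdifferentiableAt (by simp)
  obtain ⟨v, hv1, hv2⟩ := h.eikonal _ hyU
  obtain ⟨a, rfl⟩ := chartDeriv_surjective hx hy v
  have e1 : ∀ j, ∑ i, chartMetric g x y j i * a i = pd j (φ ∘ x.symm) y := fun j => by
    rw [← mfderiv_coordVec hx hy hφ, ← hv1, chartDeriv_apply]
    simp only [map_sum, map_smul, sum_apply, smul_apply]
    refine Finset.sum_congr rfl fun i _ => ?_
    rw [smul_eq_mul, mul_comm, chartMetric, Matrix.of_apply, g.symm]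
  have e2 : ∑ i, a i * pd i (φ ∘ x.symm) y = V (x.symm y) := by
    rw [← hv2, chartDeriv_apply, map_sum]
    refine Finset.sum_congr rfl fun i _ => ?_
    rw [map_smul, mfderiv_coordVec hx hy hφ]
    rfl
  have e3 : (chartMetric g x y).mulVec (WithLp.ofLp a) = fun j => pd j (φ ∘ x.symm) y := funext e1
  have hdet : IsUnit (chartMetric g x y).det := (posDef_chartMetric g hx hy).det_pos.ne'.isUnit
  have e4 : (WithLp.ofLp a) = (chartMetric g x y)⁻¹.mulVec fun j => pd j (φ ∘ x.symm) y := by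
    rw [← e3, Matrix.mulVec_mulVec, Matrix.nonsing_inv_mul _ hdet, Matrix.one_mulVec]
  rw [← e2, e4]
  simp only [Matrix.mulVec, dotProduct, Finset.sum_mul]
  exact Finset.sum_congr rfl fun i _ => Finset.sum_congr rfl fun j _ => by ring

end Chart

/-! ### Smoothness of determinants and inverses of matrix-valued functions -/

section MatrixSmooth

variable {n m : ℕ} {𝕂 : Type*} [RCLike 𝕂] {A : Vec n → Matrix (Fin m) (Fin m) 𝕂} {y : Vec n}

theorem ContDiffAt.matrix_det (hA : ∀ i j, ContDiffAt ℝ ∞ (fun z => A z i j) y) :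
    ContDiffAt ℝ ∞ (fun z => (A z).det) y := by
  simp only [Matrix.det_apply]
  refine ContDiffAt.sum fun σ _ => ContDiffAt.const_smul _ ?_
  exact contDiffAt_prod fun i _ => hA _ _

/-- Cramer's rule: the entries of the adjugate are determinants of matrices with one row replaced by
a constant one. -/
theorem ContDiffAt.matrix_inv (hA : ∀ i j, ContDiffAt ℝ ∞ (fun z => A z i j) y)
    (hdet : (A y).det ≠ 0) (i j : Fin m) : ContDiffAt ℝ ∞ (fun z => (A z)⁻¹ i j) y := by
  simp only [Matrix.inv_def, Ring.inverse_eq_inv', Matrix.smul_apply, smul_eq_mul,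
    Matrix.adjugate_apply]
  refine ((ContDiffAt.matrix_det hA).inv hdet).mul (ContDiffAt.matrix_det fun k l => ?_)
  simp only [Matrix.updateRow_apply]
  split_ifs
  · exact contDiffAt_const
  · exact hA k l

end MatrixSmooth

/-- The properties of the local data which are used: smoothness at the origin, the symmetries of the
coefficients, the eikonal equation, and the identities between the coefficients expressing the
formal self-adjointness of the operator `L`. -/
structure LocalData.IsRegular {n r : ℕ} (D : LocalData n r) : Prop where
  metric_smooth : ∀ i j, ContDiffAt ℝ ∞ (fun y => D.metric y i j) 0
  metric_posDef : ∀ᶠ y in 𝓝 0, (D.metric y).PosDef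
  metric_zero : D.metric 0 = 1
  gram_smooth : ∀ a b, ContDiffAt ℝ ∞ (fun y => D.gram y a b) 0
  gram_herm : ∀ᶠ y in 𝓝 0, ∀ a b, starRingEnd ℂ (D.gram y a b) = D.gram y b a
  gram_zero : D.gram 0 = 1
  b_smooth : ∀ j a b, ContDiffAt ℝ ∞ (fun y => D.b j y a b) 0
  c_smooth : ∀ a b, ContDiffAt ℝ ∞ (fun y => D.c y a b) 0
  w_smooth : ∀ a b, ContDiffAt ℝ ∞ (fun y => D.w y a b) 0
  w_symm : ∀ᶠ y in 𝓝 0, ∀ a b, ∑ k, starRingEnd ℂ (D.w y k a) * D.gram y k b =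
    ∑ k, D.gram y a k * D.w y k b
  V_smooth : ContDiffAt ℝ ∞ D.V 0
  φ_smooth : ContDiffAt ℝ ∞ D.φ 0
  pd_φ_zero : ∀ i, pd i D.φ 0 = 0
  diagonal : ∀ i j, i ≠ j → pd i (pd j D.φ) 0 = 0
  lam_pos : ∀ i, 0 < D.lam i
  eikonal : ∀ᶠ y in 𝓝 0, D.V y = ∑ i, ∑ j, (D.metric y)⁻¹ i j * pd i D.φ y * pd j D.φ y
  adjoint : ∀ᶠ y in 𝓝 0, ∀ a b,
    (∀ j, 2 * ∑ i, pd i (fun z => (((D.metric z)⁻¹ i j : ℝ) : ℂ) * (D.gram z a b *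
          (Real.sqrt (D.metric z).det : ℂ))) y +
        ∑ k, starRingEnd ℂ (D.b j y k a) * (D.gram y k b * (Real.sqrt (D.metric y).det : ℂ)) +
        ∑ k, (D.gram y a k * (Real.sqrt (D.metric y).det : ℂ)) * D.b j y k b = 0) ∧
      ∑ i, ∑ j, pd i (pd j fun z => (((D.metric z)⁻¹ i j : ℝ) : ℂ) * (D.gram z a b *
          (Real.sqrt (D.metric z).det : ℂ))) y +
        ∑ j, pd j (fun z => ∑ k, starRingEnd ℂ (D.b j z k a) *
          (D.gram z k b * (Real.sqrt (D.metric z).det : ℂ))) y =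
      ∑ k, starRingEnd ℂ (D.c y k a) * (D.gram y k b * (Real.sqrt (D.metric y).det : ℂ)) -
        ∑ k, (D.gram y a k * (Real.sqrt (D.metric y).det : ℂ)) * D.c y k b

/-! ### Frames of the bundle and sections supported in a chart -/

section Frame

variable {n r : ℕ} {M : Type*} [TopologicalSpace M] [T2Space M]
  [ChartedSpace (Vec n) M] [IsManifold (𝓡 n) ∞ M]
  {E : M → Type*} [TopologicalSpace (Bundle.TotalSpace (Fib r) E)]
  [∀ q, TopologicalSpace (E q)] [∀ q, AddCommGroup (E q)] [∀ q, Module ℂ (E q)]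
  [FiberBundle (Fib r) E]
  {x : OpenPartialHomeomorph M (Vec n)} {e : Fin r → ∀ q, E q} {γ : HermitianMetric n r E}

theorem contDiffAt_inner_frame (hx : x ∈ IsManifold.maximalAtlas (𝓡 n) ∞ M) {u v : ∀ q, E q}
    (hu : SmoothSecOn n r x.source u) (hv : SmoothSecOn n r x.source v) {y : Vec n}
    (hy : y ∈ x.target) :
    ContDiffAt ℝ ∞ (fun y => γ.inner (x.symm y) (u (x.symm y)) (v (x.symm y))) y :=
  contDiffAt_comp_symm_chart hx hy (f := fun q => γ.inner q (u q) (v q))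
    ((γ.smooth x.source x.open_source u v hu hv).contMDiffAt
      (x.open_source.mem_nhds (x.map_target hy)))

theorem inner_sum_left {ι : Type*} (s : Finset ι) (q : M) (c : ι → ℂ) (u : ι → E q) (v : E q) :
    γ.inner q (∑ k ∈ s, c k • u k) v = ∑ k ∈ s, starRingEnd ℂ (c k) * γ.inner q (u k) v := by
  simp [map_sum, LinearMap.sum_apply]

theorem inner_sum_right {ι : Type*} (s : Finset ι) (q : M) (c : ι → ℂ) (u : E q) (v : ι → E q) :
    γ.inner q u (∑ k ∈ s, c k • v k) = ∑ k ∈ s, c k * γ.inner q u (v k) := by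
  simp [map_sum]

/-- A kernel vector of the Gram matrix would give a nonzero combination of the frame that has norm
zero. -/
theorem det_gram_ne_zero (he : IsFrameOn n e x.source) {y : Vec n} (hy : y ∈ x.target) :
    (Matrix.of fun k l => γ.inner (x.symm y) (e k (x.symm y)) (e l (x.symm y))).det ≠ 0 := by
  intro h
  obtain ⟨v, hv, hv0⟩ := Matrix.exists_mulVec_eq_zero_iff.2 h
  have h1 : ∑ k, v k • e k (x.symm y) ≠ 0 := fun h0 =>
    hv (funext (Fintype.linearIndependent_iff.1
      (he.linearIndependent _ (x.map_target hy)) v h0))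
  have h2 := γ.pos _ _ h1
  rw [inner_sum_left] at h2
  have h3 : ∀ k, γ.inner (x.symm y) (e k (x.symm y)) (∑ l, v l • e l (x.symm y)) = 0 := fun k => by
    rw [inner_sum_right]
    have := congrFun hv0 k
    simpa [Matrix.mulVec, dotProduct, mul_comm] using this
  simp [h3] at h2

/-- Extension by zero of the section `ζ • e_a` given in a chart. -/
noncomputable def bumpSection [VectorBundle ℂ (Fib r) E] [VectorBundle ℝ (Fib r) E]
    (hx : x ∈ IsManifold.maximalAtlas (𝓡 n) ∞ M) (he : IsFrameOn n e x.source)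
    {ζ : Vec n → ℂ} (hζ : IsTestFun x.target ζ) (a : Fin r) : Sec n r E where
  toFun := by
    classical exact fun q => if q ∈ x.source then ζ (x q) • e a q else 0
  contMDiff_toFun := by
    intro q₀
    by_cases hq : q₀ ∈ x.source
    · have h1 : ContMDiffAt (𝓡 n) ((𝓡 n).prod 𝓘(ℝ, Fib r)) ∞
          (fun q => Bundle.TotalSpace.mk' (Fib r) q (ζ (x q) • e a q)) q₀ := by
        rw [Bundle.contMDiffAt_section]
        have h2 := (Bundle.contMDiffAt_section q₀).1
          ((he.smooth a).contMDiffAt (x.open_source.mem_nhds hq))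
        have h3 : ContMDiffAt (𝓡 n) 𝓘(ℝ, ℂ) ∞ (fun q => ζ (x q)) q₀ :=
          (contMDiffAt_iff_contDiffAt.2 hζ.smooth.contDiffAt).comp q₀
            (contMDiffAt_of_mem_maximalAtlas hx hq)
        have h4 : ContDiff ℝ ∞ fun p : ℂ × Fib r => p.1 • p.2 := contDiff_fst.smul contDiff_snd
        have h5 := h4.contDiffAt.contMDiffAt.comp q₀ (h3.prodMk_space h2)
        refine h5.congr_of_eventuallyEq ?_
        filter_upwards [(trivializationAt (Fib r) E q₀).open_baseSet.mem_nhds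
          (FiberBundle.mem_baseSet_trivializationAt' q₀)] with q hq'
        exact ((trivializationAt (Fib r) E q₀).linear ℂ hq').map_smul _ _
      refine h1.congr_of_eventuallyEq ?_
      filter_upwards [x.open_source.mem_nhds hq] with q hq'
      simp [hq']
    -- The image of the support is compact, hence closed in the Hausdorff space M, so a point
    -- outside the chart domain has a neighbourhood on which the section is zero.
    · have hK : IsCompact (x.symm '' tsupport ζ) :=
        hζ.compact.image_of_continuousOn (x.continuousOn_symm.mono hζ.subset)
      have hmem : q₀ ∉ x.symm '' tsupport ζ := by
        rintro ⟨z, hz, rfl⟩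
        exact hq (x.map_target (hζ.subset hz))
      refine ((Bundle.contMDiff_zeroSection ℝ E).contMDiffAt (x := q₀)).congr_of_eventuallyEq ?_
      filter_upwards [hK.isClosed.isOpen_compl.mem_nhds hmem] with q hq'
      simp only [Bundle.zeroSection]
      split_ifs with h
      · have : ζ (x q) = 0 := image_eq_zero_of_notMem_tsupport fun hc =>
          hq' ⟨x q, hc, x.left_inv h⟩
        rw [this, zero_smul]
      · rfl

end Frame

/-! ### The symmetry of L expressed by its coefficients in a chart -/

section Symmetry

variable {n r : ℕ} {M : Type*} [TopologicalSpace M] [T2Space M]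
  [ChartedSpace (Vec n) M] [IsManifold (𝓡 n) ∞ M]
  {E : M → Type*} [TopologicalSpace (Bundle.TotalSpace (Fib r) E)]
  [∀ q, TopologicalSpace (E q)] [∀ q, AddCommGroup (E q)] [∀ q, Module ℂ (E q)]
  [FiberBundle (Fib r) E] [VectorBundle ℂ (Fib r) E] [VectorBundle ℝ (Fib r) E]
  {x : OpenPartialHomeomorph M (Vec n)} {e : Fin r → ∀ q, E q} {γ : HermitianMetric n r E}
  {g : SmoothMetric n M} {L : Sec n r E →ₗ[ℝ] Sec n r E}
  {b : Fin n → Vec n → Matrix (Fin r) (Fin r) ℂ} {c : Vec n → Matrix (Fin r) (Fin r) ℂ}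

theorem bumpSection_apply (hx : x ∈ IsManifold.maximalAtlas (𝓡 n) ∞ M)
    (he : IsFrameOn n e x.source) {ζ : Vec n → ℂ} (hζ : IsTestFun x.target ζ) (a : Fin r)
    {y : Vec n} (hy : y ∈ x.target) :
    bumpSection hx he hζ a (x.symm y) = ζ y • e a (x.symm y) := by
  classical
  change (if x.symm y ∈ x.source then ζ (x (x.symm y)) • e a (x.symm y) else 0) = _
  rw [if_pos (x.map_target hy), x.right_inv hy]

theorem bumpSection_eq_zero (hx : x ∈ IsManifold.maximalAtlas (𝓡 n) ∞ M)
    (he : IsFrameOn n e x.source) {ζ : Vec n → ℂ} (hζ : IsTestFun x.target ζ) (a : Fin r)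
    {q : M} (hq : q ∉ x.symm '' tsupport ζ) : bumpSection hx he hζ a q = 0 := by
  classical
  change (if q ∈ x.source then ζ (x q) • e a q else 0) = _
  split_ifs with h
  · have : ζ (x q) = 0 := image_eq_zero_of_notMem_tsupport fun hc => hq ⟨x q, hc, x.left_inv h⟩
    rw [this, zero_smul]
  · rfl

theorem laplace_bumpSection (hx : x ∈ IsManifold.maximalAtlas (𝓡 n) ∞ M)
    (he : IsFrameOn n e x.source) (hL : HasLaplaceForm g L x e b c) {ζ : Vec n → ℂ}
    (hζ : IsTestFun x.target ζ) (a : Fin r) {y : Vec n} (hy : y ∈ x.target) :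
    L (bumpSection hx he hζ a) (x.symm y) = ∑ k,
      ((if k = a then -(∑ i, ∑ j, ((chartMetric g x y)⁻¹ i j : ℂ) * pd i (pd j ζ) y) else 0)
        + ∑ j, b j y k a * pd j ζ y + c y k a * ζ y) • e k (x.symm y) := by
  have hz : ∀ (i : Fin n) (z : Vec n), pd i (fun _ : Vec n => (0 : ℂ)) z = 0 := fun i z =>
    pd_const 0 i z
  have hz' : ∀ i : Fin n, pd i (fun _ : Vec n => (0 : ℂ)) = fun _ => 0 := fun i => funext (hz i)
  rw [hL.apply_eq (bumpSection hx he hζ a) (fun k => if k = a then ζ else fun _ => 0)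
    (fun y hy => ?_) y hy]
  · refine Finset.sum_congr rfl fun k _ => ?_
    congr 1
    have h1 : ∀ l j, pd j (if l = a then ζ else fun _ => 0) = if l = a then pd j ζ else fun _ => 0 :=
      fun l j => by split_ifs <;> simp [hz']
    simp only [h1]
    congr 1
    · congr 1
      · by_cases hk : k = a
        · simp [hk]
        · simp [hk, hz]
      · refine Finset.sum_congr rfl fun j _ => ?_
        rw [Finset.sum_eq_single a (fun l _ hl => by simp [hl]) (by simp)]
        simp
    · rw [Finset.sum_eq_single a (fun l _ hl => by simp [hl]) (by simp)]
      simp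
  · rw [bumpSection_apply hx he hζ a hy,
      Finset.sum_eq_single a (fun l _ hl => by simp [hl]) (by simp)]
    simp

theorem contDiffAt_sqrt_det (hx : x ∈ IsManifold.maximalAtlas (𝓡 n) ∞ M) {y : Vec n}
    (hy : y ∈ x.target) :
    ContDiffAt ℝ ∞ (fun y => (Real.sqrt (chartMetric g x y).det : ℂ)) y :=
  Complex.ofRealCLM.contDiff.contDiffAt.comp y
    ((ContDiffAt.matrix_det fun i j => contDiffAt_chartMetric g hx hy i j).sqrt
      (posDef_chartMetric g hx hy).det_pos.ne')

/-- For the sections ζ e_{a'} and η e_{b'} the symmetry of L is a scalar integral identity with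
coefficients weighted by γ_{kl} (det g)^{1/2}. Conjugate-linearity in the first slot conjugates the
coefficients of L there, while ζ, being real, and its derivatives are not affected; thus
`formal_adjoint_identities` applies for each pair of frame indices. -/
theorem adjoint_identities_chart (hx : x ∈ IsManifold.maximalAtlas (𝓡 n) ∞ M)
    (he : IsFrameOn n e x.source) (hL : HasLaplaceForm g L x e b c) (hsymm : IsSymmetricOp g γ L)
    (G : Vec n → Matrix (Fin r) (Fin r) ℂ)
    (hG : G = fun y => Matrix.of fun k l => γ.inner (x.symm y) (e k (x.symm y)) (e l (x.symm y)))
    (s : Vec n → ℂ) (hs : s = fun y => (Real.sqrt (chartMetric g x y).det : ℂ)) (a' b' : Fin r) :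
    ∀ y ∈ x.target,
    (∀ j, 2 * ∑ i, pd i (fun z => (((chartMetric g x z)⁻¹ i j : ℝ) : ℂ) * (G z a' b' * s z)) y +
        ∑ k, starRingEnd ℂ (b j y k a') * (G y k b' * s y) +
        ∑ k, (G y a' k * s y) * b j y k b' = 0) ∧
      ∑ i, ∑ j, pd i (pd j fun z =>
          (((chartMetric g x z)⁻¹ i j : ℝ) : ℂ) * (G z a' b' * s z)) y +
        ∑ j, pd j (fun z => ∑ k, starRingEnd ℂ (b j z k a') * (G z k b' * s z)) y =
      ∑ k, starRingEnd ℂ (c y k a') * (G y k b' * s y) -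
        ∑ k, (G y a' k * s y) * c y k b' := by
  have hGs : ∀ k l, ∀ y ∈ x.target, ContDiffAt ℝ ∞ (fun z => G z k l * s z) y := fun k l y hy => by
    subst hG hs
    exact (contDiffAt_inner_frame hx (he.smooth k) (he.smooth l) hy).mul
      (contDiffAt_sqrt_det hx hy)
  have hinv : ∀ i j, ∀ y ∈ x.target,
      ContDiffAt ℝ ∞ (fun z => (((chartMetric g x z)⁻¹ i j : ℝ) : ℂ)) y := fun i j y hy =>
    Complex.ofRealCLM.contDiff.contDiffAt.comp y
      (ContDiffAt.matrix_inv (fun k l => contDiffAt_chartMetric g hx hy k l)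
        (posDef_chartMetric g hx hy).det_pos.ne' i j)
  have hb : ∀ j k l, ∀ y ∈ x.target, ContDiffAt ℝ ∞ (fun z => b j z k l) y := fun j k l y hy =>
    (hL.smooth_b j k l).contDiffAt (x.open_target.mem_nhds hy)
  have hc : ∀ k l, ∀ y ∈ x.target, ContDiffAt ℝ ∞ (fun z => c z k l) y := fun k l y hy =>
    (hL.smooth_c k l).contDiffAt (x.open_target.mem_nhds hy)
  have hconj : ∀ {f : Vec n → ℂ} {y}, ContDiffAt ℝ ∞ f y →
      ContDiffAt ℝ ∞ (fun z => starRingEnd ℂ (f z)) y := fun hf =>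
    Complex.conjCLE.contDiff.contDiffAt.comp _ hf
  refine formal_adjoint_identities x.open_target
    (p := fun i j z => (((chartMetric g x z)⁻¹ i j : ℝ) : ℂ) * (G z a' b' * s z))
    (β := fun j z => ∑ k, starRingEnd ℂ (b j z k a') * (G z k b' * s z))
    (β' := fun j z => ∑ k, (G z a' k * s z) * b j z k b')
    (κ := fun z => ∑ k, starRingEnd ℂ (c z k a') * (G z k b' * s z))
    (κ' := fun z => ∑ k, (G z a' k * s z) * c z k b')
    (fun i j y hy => (hinv i j y hy).mul (hGs _ _ y hy)) ?_
    (fun j y hy => ContDiffAt.sum fun k _ => (hconj (hb j k a' y hy)).mul (hGs _ _ y hy))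
    (fun j y hy => ContDiffAt.sum fun k _ => (hGs _ _ y hy).mul (hb j k b' y hy))
    (fun y hy => ContDiffAt.sum fun k _ => (hconj (hc k a' y hy)).mul (hGs _ _ y hy))
    (fun y hy => ContDiffAt.sum fun k _ => (hGs _ _ y hy).mul (hc k b' y hy)) ?_
  · intro i j
    funext z
    have : (chartMetric g x z)⁻¹ i j = (chartMetric g x z)⁻¹ j i := by
      have ht : (chartMetric g x z).transpose = chartMetric g x z := by
        ext k l
        exact g.symm _ _ _
      conv_lhs => rw [← ht, ← Matrix.transpose_nonsing_inv]
      rfl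
    simp only [this]
  · intro ζ η hζ hη
    have e1 := hsymm x hx (bumpSection hx he hζ a') (bumpSection hx he hη b')
      (x.symm '' tsupport ζ ∪ x.symm '' tsupport η)
      ((hζ.compact.image_of_continuousOn (x.continuousOn_symm.mono hζ.subset)).union
        (hη.compact.image_of_continuousOn (x.continuousOn_symm.mono hη.subset)))
      (by
        rintro q (⟨z, hz, rfl⟩ | ⟨z, hz, rfl⟩)
        · exact x.map_target (hζ.subset hz)
        · exact x.map_target (hη.subset hz))
      (fun q hq => bumpSection_eq_zero hx he hζ a' fun h => hq (Or.inl h))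
      (fun q hq => bumpSection_eq_zero hx he hη b' fun h => hq (Or.inr h))
    have hm := x.open_target.measurableSet
    refine Eq.trans (setIntegral_congr_fun hm fun y hy => ?_)
      (e1.trans (setIntegral_congr_fun hm fun y hy => ?_))
    · have hpdζ : ∀ j, starRingEnd ℂ (pd j ζ y) = pd j ζ y := fun j => (hζ.pd j).real y
      have hpdζ' : ∀ i j, starRingEnd ℂ (pd i (pd j ζ) y) = pd i (pd j ζ) y := fun i j =>
        ((hζ.pd j).pd i).real y
      rw [laplace_bumpSection hx he hL hζ a' hy, bumpSection_apply hx he hη b' hy,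
        inner_sum_left]
      simp only [map_smul, smul_eq_mul, map_add, map_neg, map_sum, map_mul, hpdζ, hpdζ', hζ.real,
        apply_ite (starRingEnd ℂ), map_zero, Complex.conj_ofReal]
      have hGy : ∀ k l, γ.inner (x.symm y) (e k (x.symm y)) (e l (x.symm y)) = G y k l :=
        fun k l => by rw [hG]; rfl
      have hsy : (Real.sqrt (chartMetric g x y).det : ℂ) = s y := by rw [hs]
      simp only [hGy, hsy, add_mul, Finset.sum_add_distrib, ite_mul, zero_mul,
        Finset.sum_ite_eq', Finset.mem_univ, if_true]
      congr 1
      · congr 1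
        · simp only [Finset.sum_mul, neg_mul]
          refine congrArg _ (Finset.sum_congr rfl fun i _ => Finset.sum_congr rfl fun j _ => ?_)
          ring
        · simp only [Finset.sum_mul]
          rw [Finset.sum_comm]
          exact Finset.sum_congr rfl fun i _ => Finset.sum_congr rfl fun j _ => by ring
      · simp only [Finset.sum_mul]
        exact Finset.sum_congr rfl fun j _ => by ring
    · rw [laplace_bumpSection hx he hL hη b' hy, bumpSection_apply hx he hζ a' hy,
        inner_sum_right]
      have hGy : ∀ k, γ.inner (x.symm y) (ζ y • e a' (x.symm y)) (e k (x.symm y)) =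
          ζ y * G y a' k := fun k => by
        rw [LinearMap.map_smulₛₗ, LinearMap.smul_apply, hζ.real, hG]; rfl
      have hsy : (Real.sqrt (chartMetric g x y).det : ℂ) = s y := by rw [hs]
      simp only [hGy, hsy, add_mul, Finset.sum_add_distrib, ite_mul, zero_mul,
        Finset.sum_ite_eq', Finset.mem_univ, if_true, mul_add]
      congr 1
      · congr 1
        · simp only [Finset.sum_mul, Finset.mul_sum, neg_mul, mul_neg]
          refine congrArg _ (Finset.sum_congr rfl fun i _ => Finset.sum_congr rfl fun j _ => ?_)
          ring
        · simp only [Finset.sum_mul, Finset.mul_sum]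
          rw [Finset.sum_comm]
          exact Finset.sum_congr rfl fun i _ => Finset.sum_congr rfl fun j _ => by ring
      · simp only [Finset.sum_mul, Finset.mul_sum]
        exact Finset.sum_congr rfl fun j _ => by ring

end Symmetry

/-! ### First and second derivatives at a local minimum -/

section Minimum

variable {n : ℕ} {f : Vec n → ℝ}

theorem pd_eq_zero_of_isLocalMin (h : IsLocalMin f 0) (i : Fin n) : pd i f 0 = 0 := by
  rw [pd, h.fderiv_eq_zero]
  rfl

/-- If the second derivative along an axis were negative, the origin would also be a local maximum
on that axis. The function would then be constant near the origin on the axis, and the second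
derivative would be zero. -/
theorem pd_pd_nonneg_of_isLocalMin (hf : ContDiffAt ℝ ∞ f 0) (h : IsLocalMin f 0) (i : Fin n) :
    0 ≤ pd i (pd i f) 0 := by
  by_contra! hneg
  let l : ℝ → Vec n := fun t => t • EuclideanSpace.single i (1 : ℝ)
  have hl0 : l 0 = 0 := zero_smul _ _
  have hlt : Filter.Tendsto l (𝓝 0) (𝓝 0) := by
    have : Continuous l := by fun_prop
    simpa [hl0] using this.tendsto 0
  have hl : ∀ t, HasDerivAt l (EuclideanSpace.single i (1 : ℝ)) t := fun t => by
    simpa using (hasDerivAt_id t).smul_const (EuclideanSpace.single i (1 : ℝ))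
  have hd : ∀ {k : Vec n → ℝ} {t : ℝ}, DifferentiableAt ℝ k (l t) →
      HasDerivAt (k ∘ l) (pd i k (l t)) t := fun {k t} hk =>
    hk.hasFDerivAt.comp_hasDerivAt t (hl t)
  have h1 : deriv (f ∘ l) =ᶠ[𝓝 0] pd i f ∘ l := by
    filter_upwards [hlt.eventually hf.eventually_differentiableAt] with t ht
    exact (hd ht).deriv
  have h2 : deriv (deriv (f ∘ l)) 0 = pd i (pd i f) 0 := by
    rw [h1.deriv_eq]
    have := (hd (k := pd i f) (t := 0) (by
      rw [hl0]; exact (hf.pd i).differentiableAt_infty)).deriv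
    rw [this, hl0]
  have hmin : IsLocalMin (f ∘ l) 0 := by
    have : ∀ᶠ t in 𝓝 (0 : ℝ), f 0 ≤ f (l t) := hlt.eventually h
    filter_upwards [this] with t ht
    simpa [hl0] using ht
  have hmax : IsLocalMax (f ∘ l) 0 := by
    refine isLocalMax_of_deriv_deriv_neg (by rw [h2]; exact hneg) hmin.deriv_eq_zero ?_
    exact (hd (t := 0) (by rw [hl0]; exact hf.differentiableAt_infty)).continuousAt
  have hconst : f ∘ l =ᶠ[𝓝 0] fun _ => (f ∘ l) 0 := by
    filter_upwards [hmin, hmax] with t h3 h4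
    exact le_antisymm h4 h3
  have : deriv (deriv (f ∘ l)) 0 = 0 := by
    rw [hconst.deriv.deriv_eq]
    simp
  rw [h2] at this
  exact hneg.ne this

end Minimum

/-! ### Passage from the geometric hypotheses to the local data -/

section Regular

variable {n r : ℕ} {M : Type*} [TopologicalSpace M] [T2Space M]
  [ChartedSpace (Vec n) M] [IsManifold (𝓡 n) ∞ M] {g : SmoothMetric n M}
  {E : M → Type*} [TopologicalSpace (Bundle.TotalSpace (Fib r) E)]
  [∀ q, TopologicalSpace (E q)] [∀ q, AddCommGroup (E q)] [∀ q, Module ℂ (E q)]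
  [FiberBundle (Fib r) E] [VectorBundle ℂ (Fib r) E] [VectorBundle ℝ (Fib r) E]
  {γ : HermitianMetric n r E} {L : Sec n r E →ₗ[ℝ] Sec n r E} {W : ∀ q, E q →ₗ[ℂ] E q}
  {V φ : M → ℝ} {p : M} {U : Set M} {x : OpenPartialHomeomorph M (Vec n)}
  {e : Fin r → ∀ q, E q} {D : LocalData n r}

theorem IsNormalData.isRegular (hD : IsNormalData g γ L W V φ p x e D)
    (hH : IsSchrodingerSetup g γ L W V p) (hφ : IsEikonalSolution g V p U φ) : D.IsRegular := by
  have hx := hD.chart_mem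
  have hmet : D.metric = chartMetric g x := congrArg LocalData.metric hD.data_eq
  have hgram : D.gram = fun y => Matrix.of fun k l =>
    γ.inner (x.symm y) (e k (x.symm y)) (e l (x.symm y)) := congrArg LocalData.gram hD.data_eq
  have hV : D.V = V ∘ x.symm := congrArg LocalData.V hD.data_eq
  have hDφ : D.φ = φ ∘ x.symm := congrArg LocalData.φ hD.data_eq
  have h0 : (0 : Vec n) ∈ x.target := hD.centred ▸ x.map_source hD.mem_source
  have hp : x.symm 0 = p := by rw [← hD.centred, x.left_inv hD.mem_source]
  have hnhds : x.target ∈ 𝓝 (0 : Vec n) := x.open_target.mem_nhds h0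
  have hcont : ContinuousAt x.symm 0 := x.continuousOn_symm.continuousAt hnhds
  have htend : Filter.Tendsto x.symm (𝓝 0) (𝓝 p) := by simpa [hp] using hcont.tendsto
  have hU : ∀ᶠ y in 𝓝 (0 : Vec n), x.symm y ∈ U :=
    htend.eventually (hφ.isOpen.mem_nhds hφ.mem)
  have hφs : ContDiffAt ℝ ∞ D.φ 0 := by
    rw [hDφ]
    refine contDiffAt_comp_symm_chart hx h0 ?_
    rw [hp]
    exact (hφ.smooth p hφ.mem).contMDiffAt (hφ.isOpen.mem_nhds hφ.mem)
  have hmin : IsLocalMin D.φ 0 := by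
    have : ∀ᶠ y in 𝓝 (0 : Vec n), φ p ≤ φ (x.symm y) := htend.eventually hφ.nondegMin.isLocalMin
    rw [hDφ]
    filter_upwards [this] with y hy
    simpa [hp] using hy
  have hgs : ∀ a b, ContDiffAt ℝ ∞ (fun y => D.gram y a b) 0 := fun a b => by
    rw [hgram]
    exact contDiffAt_inner_frame hx (hD.frame.smooth a) (hD.frame.smooth b) h0
  have hN : ∀ y ∈ x.target, ∀ a b, γ.inner (x.symm y) (e a (x.symm y))
      (W (x.symm y) (e b (x.symm y))) = ∑ k, D.gram y a k * D.w y k b := fun y hy a b => by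
    rw [hD.endForm y hy, inner_sum_right, hgram]
    exact Finset.sum_congr rfl fun k _ => mul_comm _ _
  have hdet : ∀ y ∈ x.target, (D.gram y).det ≠ 0 := fun y hy => by
    rw [hgram]
    exact det_gram_ne_zero hD.frame hy
  refine
    { metric_smooth := fun i j => by
        rw [hmet]
        exact contDiffAt_chartMetric g hx h0 i j
      metric_posDef := by
        filter_upwards [hnhds] with y hy
        rw [hmet]
        exact posDef_chartMetric g hx hy
      metric_zero := hD.metric_zero
      gram_smooth := hgs
      gram_herm := Filter.Eventually.of_forall fun y a b => by
        rw [hgram]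
        exact γ.conj_symm _ _ _
      gram_zero := hD.gram_zero
      b_smooth := fun j a b => (hD.laplaceForm.smooth_b j a b).contDiffAt hnhds
      c_smooth := fun a b => (hD.laplaceForm.smooth_c a b).contDiffAt hnhds
      w_smooth := fun a b => ?_
      w_symm := ?_
      V_smooth := by
        rw [hV]
        exact contDiffAt_comp_symm_chart hx h0 hH.smooth_V.contMDiffAt
      φ_smooth := hφs
      pd_φ_zero := pd_eq_zero_of_isLocalMin hmin
      diagonal := hD.diagonal
      lam_pos := fun i => ?_
      eikonal := by
        filter_upwards [hnhds, hU] with y hy hyU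
        rw [hV, hDφ, hmet]
        exact eikonal_chart hφ hx hy hyU
      adjoint := by
        filter_upwards [hnhds] with y hy a b
        have := adjoint_identities_chart hx hD.frame hD.laplaceForm hH.symm_L D.gram hgram
          (fun y => (Real.sqrt (D.metric y).det : ℂ)) (by rw [hmet]) a b y hy
        rw [← hmet] at this
        exact this }
  -- The matrix of W is not smooth by definition: it is recovered as (Gram matrix)⁻¹ N, where the
  -- pairings N of the frame with W e_b are smooth.
  · let N : Vec n → Fin r → ℂ := fun y k =>
      γ.inner (x.symm y) (e k (x.symm y)) (W (x.symm y) (e b (x.symm y)))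
    have hNs : ∀ k, ContDiffAt ℝ ∞ (fun y => N y k) 0 := fun k =>
      contDiffAt_inner_frame (u := e k) (v := fun q => W q (e b q)) hx (hD.frame.smooth k)
        (hH.smooth_W _ x.open_source _ (hD.frame.smooth b)) h0
    have h1 : ContDiffAt ℝ ∞ (fun y => ∑ k, (D.gram y)⁻¹ a k * N y k) 0 :=
      ContDiffAt.sum fun k _ => (ContDiffAt.matrix_inv hgs (hdet 0 h0) a k).mul (hNs k)
    refine h1.congr_of_eventuallyEq ?_
    filter_upwards [hnhds] with y hy
    have h2 : (D.gram y)⁻¹.mulVec (N y) = fun k => D.w y k b := by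
      have : N y = (D.gram y).mulVec fun k => D.w y k b := funext fun k => hN y hy k b
      rw [this, Matrix.mulVec_mulVec, Matrix.nonsing_inv_mul _ (hdet y hy).isUnit,
        Matrix.one_mulVec]
    exact (congrFun h2 a).symm
  · filter_upwards [hnhds] with y hy a b
    rw [← hN y hy, ← hH.symm_W, hD.endForm y hy, inner_sum_left, hgram]
    rfl
  -- The Hessian in this chart is diagonal with entries λ_i ≥ 0, so a vanishing λ_i would contradict
  -- the non-degeneracy of the minimum.
  · refine lt_of_le_of_ne (pd_pd_nonneg_of_isLocalMin hφs hmin i) fun h => ?_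
    have h1 := hφ.nondegMin.nondeg x hx hD.mem_source
    have h2 : chartHess x φ p = Matrix.diagonal D.lam := by
      ext k l
      rw [chartHess, Matrix.of_apply, hD.centred, ← hDφ]
      by_cases hkl : k = l
      · subst hkl
        rw [Matrix.diagonal_apply_eq]
        rfl
      · rw [Matrix.diagonal_apply_ne _ hkl, hD.diagonal k l hkl]
    rw [h2, Matrix.det_diagonal] at h1
    exact h1 (Finset.prod_eq_zero (Finset.mem_univ i) h.symm)

end Regular

/-! ## The ring `ℂ[y]((t))` and its derivations -/

section LaurentPolynomials

variable {n r : ℕ}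

/-- The ring `ℂ[y]((t))`. -/
abbrev Lau (n : ℕ) := LaurentSeries (MvPolynomial (Fin n) ℂ)

/-- The range of summation depends only on lower bounds for the two factors and not on their
supports, so products of different series can be compared term by term. -/
theorem HahnSeries.coeff_mul_Icc {R : Type*} [Ring R] (x y : HahnSeries ℤ R)
    {a b : ℤ} (ha : ∀ i, i < a → x.coeff i = 0) (hb : ∀ i, i < b → y.coeff i = 0) (k : ℤ) :
    (x * y).coeff k = ∑ i ∈ Finset.Icc a (k - b), x.coeff i * y.coeff (k - i) := by
  rw [HahnSeries.coeff_mul]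
  refine Finset.sum_bij_ne_zero (fun ij _ _ => ij.1) ?_ ?_ ?_ ?_
  · rintro ⟨i, j⟩ h hne
    rw [Finset.mem_antidiagonal] at h
    obtain ⟨h1, h2, h3⟩ := h
    simp only at h1 h2 h3
    rw [Finset.mem_Icc]
    constructor
    · by_contra hc
      exact h1 (ha i (not_le.1 hc))
    · by_contra hc
      exact h2 (hb j (by simp only at hc; omega))
  · rintro ⟨i, j⟩ h _ ⟨i', j'⟩ h' _ heq
    rw [Finset.mem_antidiagonal] at h h'
    obtain ⟨-, -, h3⟩ := h
    obtain ⟨-, -, h3'⟩ := h'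
    simp only at h3 h3' heq
    subst heq
    simp only [Prod.mk.injEq, true_and]
    omega
  · intro i _ hne
    refine ⟨(i, k - i), ?_, ?_, rfl⟩
    · rw [Finset.mem_antidiagonal]
      exact ⟨left_ne_zero_of_mul hne, right_ne_zero_of_mul hne, by simp⟩
    · exact hne
  · rintro ⟨i, j⟩ h _
    rw [Finset.mem_antidiagonal] at h
    obtain ⟨-, -, h3⟩ := h
    simp only at h3 ⊢
    have : j = k - i := by omega
    rw [this]

theorem HahnSeries.exists_lower {R : Type*} [Zero R] (x : HahnSeries ℤ R) :
    ∃ a : ℤ, ∀ i, i < a → x.coeff i = 0 :=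
  ⟨x.order, fun _ hi => HahnSeries.coeff_eq_zero_of_lt_order hi⟩

theorem HahnSeries.coeff_single_mul_int {R : Type*} [Ring R] (a : ℤ) (c : R) (x : HahnSeries ℤ R)
    (k : ℤ) : (HahnSeries.single a c * x).coeff k = c * x.coeff (k - a) := by
  have := HahnSeries.coeff_single_mul_add (r := c) (x := x) (a := k - a) (b := a)
  rwa [sub_add_cancel] at this

/-- Coefficientwise application of a derivation. -/
noncomputable def LaurentSeries.mapDerivation {R : Type*} [CommRing R] [Algebra ℂ R]
    (d : Derivation ℂ R R) (x : LaurentSeries R) : LaurentSeries R :=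
  HahnSeries.map x d

theorem LaurentSeries.coeff_mapDerivation {R : Type*} [CommRing R] [Algebra ℂ R]
    (d : Derivation ℂ R R) (x : LaurentSeries R) (k : ℤ) :
    (mapDerivation d x).coeff k = d (x.coeff k) := rfl

theorem LaurentSeries.mapDerivation_add {R : Type*} [CommRing R] [Algebra ℂ R]
    (d : Derivation ℂ R R) (x y : LaurentSeries R) :
    mapDerivation d (x + y) = mapDerivation d x + mapDerivation d y := by
  ext k
  simp [coeff_mapDerivation]

theorem LaurentSeries.mapDerivation_mul {R : Type*} [CommRing R] [Algebra ℂ R]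
    (d : Derivation ℂ R R) (x y : LaurentSeries R) :
    mapDerivation d (x * y) = x * mapDerivation d y + y * mapDerivation d x := by
  obtain ⟨a, ha⟩ := HahnSeries.exists_lower x
  obtain ⟨b, hb⟩ := HahnSeries.exists_lower y
  have ha' : ∀ i, i < a → (mapDerivation d x).coeff i = 0 := fun i hi => by
    rw [coeff_mapDerivation, ha i hi, map_zero]
  have hb' : ∀ i, i < b → (mapDerivation d y).coeff i = 0 := fun i hi => by
    rw [coeff_mapDerivation, hb i hi, map_zero]
  ext k
  rw [mul_comm y, coeff_mapDerivation, HahnSeries.coeff_add, HahnSeries.coeff_mul_Icc x y ha hb,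
    HahnSeries.coeff_mul_Icc x _ ha hb', HahnSeries.coeff_mul_Icc _ y ha' hb, map_sum,
    ← Finset.sum_add_distrib]
  refine Finset.sum_congr rfl fun i _ => ?_
  rw [Derivation.leibniz, coeff_mapDerivation, coeff_mapDerivation, smul_eq_mul, smul_eq_mul,
    mul_comm (y.coeff _)]

/-- The monomial `t ^ k`. -/
noncomputable def tmon (n : ℕ) (k : ℤ) : Lau n := HahnSeries.single k 1

theorem coeff_tmon_mul (k : ℤ) (F : Lau n) (i : ℤ) : (tmon n k * F).coeff i = F.coeff (i - k) := by
  rw [tmon, HahnSeries.coeff_single_mul_int, one_mul]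

theorem tmon_mul_tmon (k l : ℤ) : tmon n k * tmon n l = tmon n (k + l) := by
  simp [tmon, HahnSeries.single_mul_single]

theorem tmon_zero : tmon n 0 = 1 := rfl

/-- The derivation `t⁻¹ ∂_{y_j}`, which corresponds to `∂_{x_j}` under `x = t y`. -/
noncomputable def dX (j : Fin n) (F : Lau n) : Lau n :=
  tmon n (-1) * LaurentSeries.mapDerivation (MvPolynomial.pderiv j) F

theorem coeff_dX (j : Fin n) (F : Lau n) (k : ℤ) :
    (dX j F).coeff k = MvPolynomial.pderiv j (F.coeff (k + 1)) := by
  rw [dX, coeff_tmon_mul, LaurentSeries.coeff_mapDerivation, sub_neg_eq_add]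

theorem dX_add (j : Fin n) (F G : Lau n) : dX j (F + G) = dX j F + dX j G := by
  rw [dX, LaurentSeries.mapDerivation_add, mul_add]; rfl

theorem dX_mul (j : Fin n) (F G : Lau n) : dX j (F * G) = F * dX j G + G * dX j F := by
  simp only [dX, LaurentSeries.mapDerivation_mul]
  ring

theorem dX_zero (j : Fin n) : dX j (0 : Lau n) = 0 := by
  ext k
  simp [coeff_dX]

theorem dX_neg (j : Fin n) (F : Lau n) : dX j (-F) = -dX j F := by
  ext k
  simp [coeff_dX]

theorem dX_sub (j : Fin n) (F G : Lau n) : dX j (F - G) = dX j F - dX j G := by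
  rw [sub_eq_add_neg, dX_add, dX_neg, sub_eq_add_neg]

theorem dX_sum {ι : Type*} (s : Finset ι) (j : Fin n) (F : ι → Lau n) :
    dX j (∑ i ∈ s, F i) = ∑ i ∈ s, dX j (F i) := by
  classical
  induction s using Finset.induction_on with
  | empty => simp [dX_zero]
  | insert a s ha ih => rw [Finset.sum_insert ha, Finset.sum_insert ha, dX_add, ih]

theorem dX_tmon (j : Fin n) (k : ℤ) : dX j (tmon n k) = 0 := by
  ext i
  rw [coeff_dX, tmon, HahnSeries.coeff_single]
  split_ifs <;> simp

/-- Each splitting of a monomial of degree k determines exactly one pair of degrees with sum k. -/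
theorem homPart_mul (k : ℕ) (f g : MvPowerSeries (Fin n) ℂ) :
    homPart k (f * g) = ∑ ij ∈ Finset.HasAntidiagonal.antidiagonal k, homPart ij.1 f * homPart ij.2 g := by
  classical
  ext α
  rw [coeff_homPart, MvPolynomial.coeff_sum]
  simp only [MvPolynomial.coeff_mul, coeff_homPart, MvPowerSeries.coeff_mul]
  rw [Finset.sum_comm]
  have h : ∀ p ∈ Finset.HasAntidiagonal.antidiagonal α, ∑ ij ∈ Finset.HasAntidiagonal.antidiagonal k,
      (if p.1.degree = ij.1 then MvPowerSeries.coeff p.1 f else 0) *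
        (if p.2.degree = ij.2 then MvPowerSeries.coeff p.2 g else 0) =
      if α.degree = k then MvPowerSeries.coeff p.1 f * MvPowerSeries.coeff p.2 g else 0 := by
    intro p hp
    have hdeg : p.1.degree + p.2.degree = α.degree := by
      rw [← map_add, Finset.HasAntidiagonal.mem_antidiagonal.1 hp]
    split_ifs with hk
    · rw [Finset.sum_eq_single (p.1.degree, p.2.degree)]
      · simp
      · rintro ⟨i, j⟩ _ hne
        by_cases h1 : p.1.degree = i
        · have : p.2.degree ≠ j := fun h2 => hne (by rw [h1, h2])
          simp [this]
        · simp [h1]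
      · intro h
        exact absurd (Finset.HasAntidiagonal.mem_antidiagonal.2 (hdeg.trans hk)) h
    · refine Finset.sum_eq_zero fun ij hij => ?_
      have := Finset.HasAntidiagonal.mem_antidiagonal.1 hij
      by_cases h1 : p.1.degree = ij.1
      · have : p.2.degree ≠ ij.2 := fun h2 => hk (by omega)
        simp [this]
      · simp [h1]
  rw [Finset.sum_congr rfl h]
  split_ifs <;> simp

/-- The substitution `x = t y` as a ring homomorphism `ℂ[[x]] → ℂ[y][[t]]`. -/
noncomputable def rescaleHom (n : ℕ) :
    MvPowerSeries (Fin n) ℂ →+* PowerSeries (MvPolynomial (Fin n) ℂ) where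
  toFun := LocalData.rescaleSer
  map_zero' := by
    ext k α
    simp [LocalData.rescaleSer, coeff_homPart]
  map_add' f g := by
    ext k α
    simp only [LocalData.rescaleSer, PowerSeries.coeff_mk, coeff_homPart, map_add,
      MvPolynomial.coeff_add]
    split_ifs <;> simp
  map_one' := by
    classical
    ext k α
    simp only [LocalData.rescaleSer, PowerSeries.coeff_mk, coeff_homPart, PowerSeries.coeff_one,
      MvPowerSeries.coeff_one]
    by_cases hα : α = 0
    · subst hα
      by_cases hk : k = 0
      · simp [hk]
      · simp [hk, Ne.symm hk]
    · by_cases hk : k = 0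
      · simp [hk, hα, MvPolynomial.coeff_one, Ne.symm hα]
      · simp [hk, hα]
  map_mul' f g := by
    ext1 k
    rw [PowerSeries.coeff_mul]
    simp only [LocalData.rescaleSer, PowerSeries.coeff_mk, homPart_mul]

/-- The substitution `x = t y` as a ring homomorphism `ℂ[[x]] → ℂ[y]((t))`. -/
noncomputable def rho (n : ℕ) : MvPowerSeries (Fin n) ℂ →+* Lau n :=
  (HahnSeries.ofPowerSeries ℤ (MvPolynomial (Fin n) ℂ)).comp (rescaleHom n)

theorem coeff_ofPowerSeries_int {R : Type*} [CommRing R] (f : PowerSeries R) (k : ℤ) :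
    (HahnSeries.ofPowerSeries ℤ R f).coeff k =
      if 0 ≤ k then PowerSeries.coeff k.toNat f else 0 := by
  split_ifs with hk
  · obtain ⟨m, rfl⟩ := Int.eq_ofNat_of_zero_le hk
    exact HahnSeries.ofPowerSeries_apply_coeff f m
  · rw [HahnSeries.ofPowerSeries_apply, HahnSeries.embDomain_of_notMem_range]
    rintro ⟨m, hm⟩
    apply hk
    rw [← hm]
    exact Int.natCast_nonneg m

theorem coeff_rho (f : MvPowerSeries (Fin n) ℂ) (k : ℤ) (α : Fin n →₀ ℕ) :
    ((rho n f).coeff k).coeff α =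
      if (α.degree : ℤ) = k then MvPowerSeries.coeff α f else 0 := by
  change ((HahnSeries.ofPowerSeries ℤ _ (LocalData.rescaleSer f)).coeff k).coeff α = _
  rw [coeff_ofPowerSeries_int]
  by_cases hk : 0 ≤ k
  · rw [if_pos hk, LocalData.rescaleSer, PowerSeries.coeff_mk, coeff_homPart]
    congr 1
    rw [eq_iff_iff]
    omega
  · rw [if_neg hk, if_neg (by omega), MvPolynomial.coeff_zero]

/-- This is the chain rule for x = t y. -/
theorem dX_rho (j : Fin n) (f : MvPowerSeries (Fin n) ℂ) :
    dX j (rho n f) = rho n (MvPowerSeries.pderiv ℂ j f) := by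
  ext k α
  rw [coeff_dX, coeff_rho, MvPolynomial.coeff_pderiv, coeff_rho, MvPowerSeries.coeff_pderiv]
  have : (((α + Finsupp.single j 1 : Fin n →₀ ℕ).degree : ℕ) : ℤ) = α.degree + 1 := by
    simp
  rw [this]
  by_cases h : (α.degree : ℤ) = k
  · rw [if_pos h, if_pos (by omega)]
  · rw [if_neg h, if_neg (by omega), zero_mul]

end LaurentPolynomials

open LocalData

/-! ## The operator `Q` in components -/

section Components

variable {n r : ℕ}

theorem coeff_comp (u : S0 n r) (a : Fin r) (k : ℤ) :
    (comp u a).coeff k = tcoeff (u : FormalY n r) k a := rfl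

theorem S0_ext {u v : S0 n r} (h : ∀ a, comp u a = comp v a) : u = v :=
  Subtype.ext (tcoeff_ext fun k => funext fun a => by rw [← coeff_comp, ← coeff_comp, h a])

theorem comp_add (u v : S0 n r) (a : Fin r) : comp (u + v) a = comp u a + comp v a := by
  ext k : 2
  rfl

theorem comp_zero (a : Fin r) : comp (0 : S0 n r) a = 0 := by
  ext k : 2
  rfl

/-- The inclusion `ℂ((t)) ⊆ ℂ[y]((t))`. -/
noncomputable def embC (n : ℕ) (s : Scal) : Lau n :=
  HahnSeries.map s (MvPolynomial.C : ℂ →+* MvPolynomial (Fin n) ℂ)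

theorem coeff_embC (s : Scal) (k : ℤ) : (embC n s).coeff k = MvPolynomial.C (s.coeff k) := rfl

theorem embC_tpow (k : ℤ) : embC n (tpow k) = tmon n k := by
  ext i : 2
  rw [coeff_embC, tpow, tmon, HahnSeries.coeff_single, HahnSeries.coeff_single]
  split_ifs <;> simp

theorem comp_smul (s : Scal) (u : S0 n r) (a : Fin r) : comp (s • u) a = embC n s * comp u a := by
  obtain ⟨l, hl⟩ := HahnSeries.exists_lower s
  obtain ⟨m, hm⟩ := exists_lower (u : FormalY n r)
  ext k : 2
  rw [HahnSeries.coeff_mul_Icc (a := l) (b := m) _ _ (fun i hi => by rw [coeff_embC, hl i hi, map_zero])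
    (fun i hi => by rw [coeff_comp, hm i hi]; rfl), coeff_comp, Submodule.coe_smul,
    tcoeff_smul s _ hl hm, Finset.sum_apply]
  refine Finset.sum_congr rfl fun i _ => ?_
  rw [coeff_embC, coeff_comp, Pi.smul_apply, MvPolynomial.smul_eq_C_mul]

/-- The component of `R v`, as an additive map. -/
noncomputable def rcomp (a : Fin r) : FormalX n r →+ Lau n where
  toFun v := comp (rescale n r v) a
  map_zero' := by rw [map_zero, comp_zero]
  map_add' u v := by rw [map_add, comp_add]

theorem coeff_rcomp (a : Fin r) (v : FormalX n r) (k : ℤ) (α : Fin n →₀ ℕ) :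
    ((rcomp a v).coeff k).coeff α = MvPowerSeries.coeff α (tcoeff v (k - α.degree) a) :=
  coeff_rescaleFun v k a α

theorem rcomp_tpow_smul (a : Fin r) (k : ℤ) (v : FormalX n r) :
    rcomp a (tpow k • v) = tmon n k * rcomp a v := by
  change comp (rescale n r (tpow k • v)) a = _
  rw [map_smul, comp_smul, embC_tpow]
  rfl

theorem exists_lower_rcomp (a : Fin r) (v : FormalX n r) :
    ∃ m : ℤ, (∀ i, i < m → (rcomp a v).coeff i = 0) ∧ ∀ i, i < m → tcoeff v i = 0 := by
  obtain ⟨m, hm⟩ := HahnSeries.exists_lower (rcomp a v)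
  obtain ⟨m', hm'⟩ := exists_lower v
  exact ⟨min m m', fun i hi => hm i (by omega), fun i hi => hm' i (by omega)⟩

/-- Rescaling shifts the index of a monomial by its degree. As degrees add under multiplication, all
splittings of α meet the same coefficient of v, the one with index k - |α|. -/
theorem rho_mul_rcomp_coeff (f : MvPowerSeries (Fin n) ℂ) (a : Fin r) (v : FormalX n r) (k : ℤ)
    (α : Fin n →₀ ℕ) : ((rho n f * rcomp a v).coeff k).coeff α =
      MvPowerSeries.coeff α (f * tcoeff v (k - α.degree) a) := by
  classical
  obtain ⟨m, hm, hm'⟩ := exists_lower_rcomp a v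
  rw [HahnSeries.coeff_mul_Icc (a := 0) (b := m) _ _ (fun i hi => ?_) hm, MvPolynomial.coeff_sum]
  · simp only [MvPolynomial.coeff_mul, coeff_rho, coeff_rcomp, MvPowerSeries.coeff_mul]
    rw [Finset.sum_comm]
    refine Finset.sum_congr rfl fun p hp => ?_
    have hdeg : (p.1.degree : ℤ) + p.2.degree = α.degree := by
      rw [← Finset.HasAntidiagonal.mem_antidiagonal.1 hp]
      simp
    simp only [ite_mul, zero_mul]
    rw [Finset.sum_ite_eq]
    have e : k - p.1.degree - p.2.degree = k - (α.degree : ℤ) := by omega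
    split_ifs with h
    · rw [e]
    · rw [Finset.mem_Icc, not_and, not_le] at h
      have h1 := h (Int.natCast_nonneg _)
      rw [← e, hm' _ (by omega)]
      simp
  · ext β
    rw [coeff_rho, if_neg (by omega), MvPolynomial.coeff_zero]

theorem rcomp_lift_mulSer (f : MvPowerSeries (Fin n) ℂ) (a : Fin r) (v : FormalX n r) :
    rcomp a (lift (mulSer f) v) = rho n f * rcomp a v := by
  ext k α
  rw [rho_mul_rcomp_coeff, coeff_rcomp]
  rfl

theorem rcomp_lift_mulMat (A : Matrix (Fin r) (Fin r) (MvPowerSeries (Fin n) ℂ)) (a : Fin r)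
    (v : FormalX n r) : rcomp a (lift (mulMat A) v) = ∑ b, rho n (A a b) * rcomp b v := by
  ext k α
  rw [HahnSeries.coeff_sum, MvPolynomial.coeff_sum]
  simp only [rho_mul_rcomp_coeff, coeff_rcomp]
  rw [← map_sum]
  rfl

theorem rcomp_lift_pdSer (j : Fin n) (a : Fin r) (v : FormalX n r) :
    rcomp a (lift (pdSer j) v) = dX j (rcomp a v) := by
  ext k α
  rw [coeff_rcomp, coeff_dX, MvPolynomial.coeff_pderiv, coeff_rcomp]
  have : k + 1 - (((α + Finsupp.single j 1 : Fin n →₀ ℕ).degree : ℕ) : ℤ) = k - α.degree := by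
    simp
  rw [this]
  exact MvPowerSeries.coeff_pderiv _ _

variable (D : LocalData n r)

/-- The operator `∂_{x_j} - t⁻² ∂_jφ` on `ℂ[y]((t))`. -/
noncomputable def LocalData.dConj (j : Fin n) (F : Lau n) : Lau n :=
  dX j F - tmon n (-2) * (rho n (MvPowerSeries.pderiv ℂ j D.φSer) * F)

theorem rcomp_conjPd (j : Fin n) (a : Fin r) (v : FormalX n r) :
    rcomp a (D.conjPd j v) = D.dConj j (rcomp a v) := by
  rw [conjPd, LinearMap.sub_apply, map_sub, rcomp_lift_pdSer, LinearMap.smul_apply,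
    rcomp_tpow_smul, rcomp_lift_mulSer]
  rfl

/-- The Taylor series of the entries of the inverse metric. -/
noncomputable def LocalData.invSer (i j : Fin n) : MvPowerSeries (Fin n) ℂ :=
  taylor fun y => (((D.metric y)⁻¹ i j : ℝ) : ℂ)

/-- This transports Q from `FormalX` to the commutative ring ℂ[y]((t)), where it is built from
multiplications by `rho` and the derivations `dX`; the following computations are ring identities
there. -/
theorem comp_Q (u : S0 n r) (a : Fin r) : comp (D.Q u) a = tmon n (-2) *
    (tmon n 4 * (-(∑ i, ∑ j, rho n (D.invSer i j) * D.dConj i (D.dConj j (comp u a)))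
      + (∑ j, ∑ b, rho n (taylorMat (D.b j) a b) * D.dConj j (comp u b))
      + ∑ b, rho n (taylorMat D.c a b) * comp u b)
    + tmon n 2 * (∑ b, rho n (taylorMat D.w a b) * comp u b)
    + rho n (taylor fun y => (D.V y : ℂ)) * comp u a) := by
  obtain ⟨v, rfl⟩ := (rescale n r).surjective u
  have h1 : D.Q (rescale n r v) = tpow (-2) • rescale n r (D.Hφ v) := by
    rw [LocalData.Q, LinearMap.smul_apply, LinearEquiv.conj_apply_apply,
      LinearEquiv.symm_apply_apply]
  have h2 : ∀ b, comp (rescale n r v) b = rcomp b v := fun _ => rfl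
  rw [h1, comp_smul, embC_tpow, show comp (rescale n r (D.Hφ v)) a = rcomp a (D.Hφ v) from rfl]
  simp only [h2, LocalData.Hφ, LinearMap.add_apply, LinearMap.smul_apply, map_add, map_sum,
    LinearMap.neg_apply, map_neg, LinearMap.sum_apply, rcomp_tpow_smul, Module.End.mul_apply,
    rcomp_lift_mulSer, rcomp_lift_mulMat, rcomp_conjPd, LocalData.invSer]

end Components

/-! ## The filtration of `ℂ[y]((t))` and the leading part of `Q` -/

section Filtration

variable {n r : ℕ}

/-- The Laurent series in which `t ^ k y ^ α` occurs only for `m ≤ k` and `|α| ≤ k + d`. -/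
noncomputable def lauFil (n : ℕ) (m d : ℤ) : AddSubgroup (Lau n) where
  carrier := {F | ∀ k α, (F.coeff k).coeff α ≠ 0 → m ≤ k ∧ (α.degree : ℤ) ≤ k + d}
  zero_mem' := fun k α h => by simp at h
  add_mem' := by
    intro F G hF hG k α h
    rw [HahnSeries.coeff_add, MvPolynomial.coeff_add] at h
    by_cases h1 : (F.coeff k).coeff α = 0
    · rw [h1, zero_add] at h
      exact hG k α h
    · exact hF k α h1
  neg_mem' := by
    intro F hF k α h
    rw [HahnSeries.coeff_neg, MvPolynomial.coeff_neg] at h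
    exact hF k α (neg_ne_zero.1 h)

theorem lauFil_mono {m m' d d' : ℤ} (hm : m' ≤ m) (hd : d ≤ d') {F : Lau n}
    (hF : F ∈ lauFil n m d) : F ∈ lauFil n m' d' := fun k α h => by
  have := hF k α h
  omega

theorem coeff_eq_zero_of_mem_lauFil {m d : ℤ} {F : Lau n} (hF : F ∈ lauFil n m d) {k : ℤ}
    (hk : k < m) : F.coeff k = 0 := by
  ext α
  by_contra h
  have := hF k α h
  omega

theorem mul_mem_lauFil {m d m' d' : ℤ} {F G : Lau n} (hF : F ∈ lauFil n m d)
    (hG : G ∈ lauFil n m' d') : F * G ∈ lauFil n (m + m') (d + d') := by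
  classical
  intro k α h
  rw [HahnSeries.coeff_mul_Icc F G (fun i hi => coeff_eq_zero_of_mem_lauFil hF hi)
    (fun i hi => coeff_eq_zero_of_mem_lauFil hG hi), MvPolynomial.coeff_sum] at h
  obtain ⟨i, -, hi⟩ := Finset.exists_ne_zero_of_sum_ne_zero h
  rw [MvPolynomial.coeff_mul] at hi
  obtain ⟨p, hp, hne⟩ := Finset.exists_ne_zero_of_sum_ne_zero hi
  have h1 := hF i p.1 (left_ne_zero_of_mul hne)
  have h2 := hG _ p.2 (right_ne_zero_of_mul hne)
  have hdeg : p.1.degree + p.2.degree = α.degree := by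
    rw [← Finset.HasAntidiagonal.mem_antidiagonal.1 hp]
    simp
  omega

theorem tmon_mem_lauFil (k : ℤ) : tmon n k ∈ lauFil n k (-k) := by
  classical
  intro i α h
  rw [tmon, HahnSeries.coeff_single] at h
  split_ifs at h with hi
  · rw [MvPolynomial.coeff_one] at h
    have : α = 0 := by
      by_contra hc
      exact h (if_neg (Ne.symm hc))
    subst this
    simp
    omega
  · simp at h

theorem rho_mem_lauFil (f : MvPowerSeries (Fin n) ℂ) : rho n f ∈ lauFil n 0 0 := by
  intro k α h
  rw [coeff_rho] at h
  split_ifs at h with hk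
  · omega
  · exact absurd rfl h

theorem rho_mem_lauFil_one {f : MvPowerSeries (Fin n) ℂ}
    (hf : MvPowerSeries.constantCoeff f = 0) : rho n f ∈ lauFil n 1 0 := by
  intro k α h
  rw [coeff_rho] at h
  split_ifs at h with hk
  · have : α ≠ 0 := by
      rintro rfl
      exact h hf
    have h2 : α.degree ≠ 0 := fun h0 => this ((Finsupp.degree_eq_zero_iff α).1 h0)
    omega
  · exact absurd rfl h

/-- One power of t and one degree in y are lost together, so the offset d does not change. -/
theorem dX_mem_lauFil {m d : ℤ} {F : Lau n} (hF : F ∈ lauFil n m d) (j : Fin n) :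
    dX j F ∈ lauFil n (m - 1) d := by
  intro k α h
  rw [coeff_dX, MvPolynomial.coeff_pderiv] at h
  have h1 := hF _ _ (left_ne_zero_of_mul h)
  rw [map_add, Finsupp.degree_single] at h1
  push_cast at h1
  omega

theorem rho_mul_coeff_zero {d : ℤ} (f : MvPowerSeries (Fin n) ℂ) {F : Lau n}
    (hF : F ∈ lauFil n 0 d) :
    (rho n f * F).coeff 0 = MvPolynomial.C (MvPowerSeries.constantCoeff f) * F.coeff 0 := by
  rw [HahnSeries.coeff_mul_Icc _ F
    (fun i hi => coeff_eq_zero_of_mem_lauFil (rho_mem_lauFil f) hi)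
    (fun i hi => coeff_eq_zero_of_mem_lauFil hF hi), sub_zero, Finset.Icc_self,
    Finset.sum_singleton, sub_zero]
  congr 1
  ext α
  rw [coeff_rho, MvPolynomial.coeff_C]
  by_cases hα : α = 0
  · subst hα
    simp
  · have h2 : α.degree ≠ 0 := fun h0 => hα ((Finsupp.degree_eq_zero_iff α).1 h0)
    rw [if_neg (by omega), if_neg (Ne.symm hα)]

variable (D : LocalData n r)

/-- The partial derivatives of the Taylor series of `φ`. -/
noncomputable def LocalData.dφ (i : Fin n) : MvPowerSeries (Fin n) ℂ :=
  MvPowerSeries.pderiv ℂ i D.φSer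

theorem dConj_dConj (i j : Fin n) (F : Lau n) : D.dConj i (D.dConj j F) =
    dX i (dX j F) - tmon n (-2) * (rho n (MvPowerSeries.pderiv ℂ i (D.dφ j)) * F
      + rho n (D.dφ j) * dX i F + rho n (D.dφ i) * dX j F)
      + tmon n (-4) * (rho n (D.dφ i) * rho n (D.dφ j) * F) := by
  have h4 : tmon n (-4) = tmon n (-2) * tmon n (-2) := by rw [tmon_mul_tmon]; rfl
  rw [h4]
  simp only [LocalData.dConj, LocalData.dφ, dX_sub, dX_mul, dX_rho, dX_tmon]
  ring

/-- Among the terms produced by the two conjugated derivatives, t² t⁻⁴ ∑ g^{ij} ∂_iφ ∂_jφ equals t⁻²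
V by the eikonal equation and cancels the potential. That term would raise the degree in y; without
it Q respects the filtration. -/
theorem comp_Q_reduced (hV : taylor (fun y => (D.V y : ℂ)) =
      ∑ i, ∑ j, D.invSer i j * D.dφ i * D.dφ j) (u : S0 n r) (a : Fin r) :
    comp (D.Q u) a =
      -(tmon n 2 * ∑ i, ∑ j, rho n (D.invSer i j) * dX i (dX j (comp u a)))
      + ∑ i, ∑ j, rho n (D.invSer i j * MvPowerSeries.pderiv ℂ i (D.dφ j)) * comp u a
      + ∑ i, ∑ j, rho n (D.invSer i j * D.dφ j) * dX i (comp u a)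
      + ∑ i, ∑ j, rho n (D.invSer i j * D.dφ i) * dX j (comp u a)
      + tmon n 2 * ∑ j, ∑ b, rho n (taylorMat (D.b j) a b) * dX j (comp u b)
      - ∑ j, ∑ b, rho n (taylorMat (D.b j) a b * D.dφ j) * comp u b
      + tmon n 2 * ∑ b, rho n (taylorMat D.c a b) * comp u b
      + ∑ b, rho n (taylorMat D.w a b) * comp u b := by
  have e2 : tmon n (-2) * tmon n 4 = tmon n 2 := by rw [tmon_mul_tmon]; rfl
  have e0 : tmon n (-2) * tmon n 2 = 1 := by rw [tmon_mul_tmon]; rfl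
  have e4 : tmon n 2 * tmon n (-4) = tmon n (-2) := by rw [tmon_mul_tmon]; rfl
  have h1 : tmon n 2 * ∑ i, ∑ j, rho n (D.invSer i j) * D.dConj i (D.dConj j (comp u a)) =
      tmon n 2 * ∑ i, ∑ j, rho n (D.invSer i j) * dX i (dX j (comp u a))
      - ∑ i, ∑ j, rho n (D.invSer i j * MvPowerSeries.pderiv ℂ i (D.dφ j)) * comp u a
      - ∑ i, ∑ j, rho n (D.invSer i j * D.dφ j) * dX i (comp u a)
      - ∑ i, ∑ j, rho n (D.invSer i j * D.dφ i) * dX j (comp u a)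
      + tmon n (-2) * (rho n (taylor fun y => (D.V y : ℂ)) * comp u a) := by
    rw [hV]
    simp only [map_sum, Finset.sum_mul, Finset.mul_sum, ← Finset.sum_sub_distrib,
      ← Finset.sum_add_distrib]
    refine Finset.sum_congr rfl fun i _ => Finset.sum_congr rfl fun j _ => ?_
    rw [dConj_dConj]
    simp only [map_mul]
    linear_combination (-rho n (D.invSer i j) * (rho n (MvPowerSeries.pderiv ℂ i (D.dφ j)) *
      comp u a + rho n (D.dφ j) * dX i (comp u a) + rho n (D.dφ i) * dX j (comp u a))) * e0
      + (rho n (D.invSer i j) * (rho n (D.dφ i) * rho n (D.dφ j) * comp u a)) * e4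
  have h2 : tmon n 2 * ∑ j, ∑ b, rho n (taylorMat (D.b j) a b) * D.dConj j (comp u b) =
      tmon n 2 * ∑ j, ∑ b, rho n (taylorMat (D.b j) a b) * dX j (comp u b)
      - ∑ j, ∑ b, rho n (taylorMat (D.b j) a b * D.dφ j) * comp u b := by
    simp only [Finset.mul_sum, ← Finset.sum_sub_distrib]
    refine Finset.sum_congr rfl fun j _ => Finset.sum_congr rfl fun b _ => ?_
    simp only [LocalData.dConj, LocalData.dφ, map_mul]
    linear_combination (-rho n (taylorMat (D.b j) a b) *
      (rho n (MvPowerSeries.pderiv ℂ j D.φSer) * comp u b)) * e0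
  rw [comp_Q]
  linear_combination (-(∑ i, ∑ j, rho n (D.invSer i j) * D.dConj i (D.dConj j (comp u a)))
      + (∑ j, ∑ b, rho n (taylorMat (D.b j) a b) * D.dConj j (comp u b))
      + ∑ b, rho n (taylorMat D.c a b) * comp u b) * e2
    + (∑ b, rho n (taylorMat D.w a b) * comp u b) * e0 - h1 + h2

variable {D}

namespace LocalData.IsRegular

theorem det_ne_zero (hD : D.IsRegular) : (D.metric 0).det ≠ 0 := by
  rw [hD.metric_zero, Matrix.det_one]
  exact one_ne_zero

theorem contDiffAt_inv (hD : D.IsRegular) (i j : Fin n) :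
    ContDiffAt ℝ ∞ (fun y => (((D.metric y)⁻¹ i j : ℝ) : ℂ)) 0 :=
  Complex.ofRealCLM.contDiff.contDiffAt.comp (0 : Vec n)
    (ContDiffAt.matrix_inv hD.metric_smooth hD.det_ne_zero i j)

theorem contDiffAt_φ (hD : D.IsRegular) : ContDiffAt ℝ ∞ (fun y => (D.φ y : ℂ)) 0 :=
  Complex.ofRealCLM.contDiff.contDiffAt.comp (0 : Vec n) hD.φ_smooth

theorem eventually_pd_φ (hD : D.IsRegular) (i : Fin n) :
    pd i (fun y => (D.φ y : ℂ)) =ᶠ[𝓝 0] fun y => ((pd i D.φ y : ℝ) : ℂ) := by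
  filter_upwards [hD.φ_smooth.eventually_differentiableAt] with y hy
  exact pd_ofReal hy i

theorem dφ_eq (hD : D.IsRegular) (i : Fin n) :
    D.dφ i = taylor fun y => ((pd i D.φ y : ℝ) : ℂ) := by
  rw [LocalData.dφ, LocalData.φSer, pderiv_taylor hD.contDiffAt_φ]
  exact taylor_congr (hD.eventually_pd_φ i)

theorem contDiffAt_pd_φ (hD : D.IsRegular) (i : Fin n) :
    ContDiffAt ℝ ∞ (fun y => ((pd i D.φ y : ℝ) : ℂ)) 0 :=
  Complex.ofRealCLM.contDiff.contDiffAt.comp (0 : Vec n) (hD.φ_smooth.pd i)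

theorem pderiv_dφ (hD : D.IsRegular) (i j : Fin n) :
    MvPowerSeries.pderiv ℂ i (D.dφ j) = taylor fun y => ((pd i (pd j D.φ) y : ℝ) : ℂ) := by
  rw [hD.dφ_eq, pderiv_taylor (hD.contDiffAt_pd_φ j)]
  refine taylor_congr ?_
  filter_upwards [(hD.φ_smooth.pd j).eventually_differentiableAt] with y hy
  exact pd_ofReal hy i

theorem constantCoeff_dφ (hD : D.IsRegular) (i : Fin n) :
    MvPowerSeries.constantCoeff (D.dφ i) = 0 := by
  rw [hD.dφ_eq, constantCoeff_taylor, hD.pd_φ_zero, Complex.ofReal_zero]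

theorem constantCoeff_pderiv_dφ (hD : D.IsRegular) (i j : Fin n) :
    MvPowerSeries.constantCoeff (MvPowerSeries.pderiv ℂ i (D.dφ j)) =
      if i = j then (D.lam j : ℂ) else 0 := by
  rw [hD.pderiv_dφ, constantCoeff_taylor]
  split_ifs with h
  · rw [h]; rfl
  · rw [hD.diagonal i j h, Complex.ofReal_zero]

theorem coeff_single_dφ (hD : D.IsRegular) (i j : Fin n) :
    MvPowerSeries.coeff (Finsupp.single i 1) (D.dφ j) = if i = j then (D.lam j : ℂ) else 0 := by
  have h := MvPowerSeries.coeff_pderiv (R := ℂ) (i := i) (D.dφ j) 0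
  rw [zero_add, Finsupp.coe_zero, Pi.zero_apply, Nat.cast_zero, zero_add, mul_one,
    MvPowerSeries.coeff_zero_eq_constantCoeff_apply, hD.constantCoeff_pderiv_dφ] at h
  exact h.symm

theorem constantCoeff_invSer (hD : D.IsRegular) (i j : Fin n) :
    MvPowerSeries.constantCoeff (D.invSer i j) = if i = j then 1 else 0 := by
  rw [LocalData.invSer, constantCoeff_taylor, hD.metric_zero, inv_one, Matrix.one_apply]
  split_ifs <;> simp

theorem taylor_V (hD : D.IsRegular) : taylor (fun y => (D.V y : ℂ)) =
    ∑ i, ∑ j, D.invSer i j * D.dφ i * D.dφ j := by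
  have h : (fun y => (D.V y : ℂ)) =ᶠ[𝓝 0] fun y => ∑ i, ∑ j,
      (((D.metric y)⁻¹ i j : ℝ) : ℂ) * ((pd i D.φ y : ℝ) : ℂ) * ((pd j D.φ y : ℝ) : ℂ) := by
    filter_upwards [hD.eikonal] with y hy
    rw [hy]
    push_cast
    rfl
  have hs := fun i j => ((hD.contDiffAt_inv i j).mul (hD.contDiffAt_pd_φ i))
  rw [taylor_congr h, taylor_sum _ fun i _ => ContDiffAt.sum fun j _ =>
    (hs i j).mul (hD.contDiffAt_pd_φ j)]
  refine Finset.sum_congr rfl fun i _ => ?_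
  rw [taylor_sum _ fun j _ => (hs i j).mul (hD.contDiffAt_pd_φ j)]
  refine Finset.sum_congr rfl fun j _ => ?_
  rw [taylor_mul (hs i j) (hD.contDiffAt_pd_φ j),
    taylor_mul (hD.contDiffAt_inv i j) (hD.contDiffAt_pd_φ i), hD.dφ_eq, hD.dφ_eq]
  rfl

theorem Q_mem_lauFil (hD : D.IsRegular) {m d : ℤ} {u : S0 n r}
    (hu : ∀ a, comp u a ∈ lauFil n m d) (a : Fin r) : comp (D.Q u) a ∈ lauFil n m d := by
  have h0 : ∀ (f : MvPowerSeries (Fin n) ℂ) {m' d' : ℤ} {F : Lau n},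
      F ∈ lauFil n m' d' → rho n f * F ∈ lauFil n m' d' := fun f m' d' F hF => by
    simpa using mul_mem_lauFil (rho_mem_lauFil f) hF
  have h1 : ∀ (f : MvPowerSeries (Fin n) ℂ), MvPowerSeries.constantCoeff f = 0 →
      ∀ {m' d' : ℤ} {F : Lau n}, F ∈ lauFil n m' d' → rho n f * F ∈ lauFil n (1 + m') d' :=
    fun f hf m' d' F hF => by
      simpa using mul_mem_lauFil (rho_mem_lauFil_one hf) hF
  have h2 : ∀ {m' d' : ℤ} {F : Lau n}, F ∈ lauFil n m' d' →
      tmon n 2 * F ∈ lauFil n (2 + m') (-2 + d') := fun hF =>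
    mul_mem_lauFil (tmon_mem_lauFil 2) hF
  have hc : ∀ i (f : MvPowerSeries (Fin n) ℂ), MvPowerSeries.constantCoeff (f * D.dφ i) = 0 :=
    fun i f => by rw [map_mul, hD.constantCoeff_dφ, mul_zero]
  rw [comp_Q_reduced D hD.taylor_V]
  refine add_mem (add_mem (sub_mem (add_mem (add_mem (add_mem (add_mem (neg_mem ?_) ?_) ?_) ?_) ?_)
    ?_) ?_) ?_
  · exact lauFil_mono (by omega) (by omega) (h2 (sum_mem fun i _ => sum_mem fun j _ =>
      h0 _ (dX_mem_lauFil (dX_mem_lauFil (hu a) j) i)))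
  · exact sum_mem fun i _ => sum_mem fun j _ => h0 _ (hu a)
  · exact sum_mem fun i _ => sum_mem fun j _ => lauFil_mono (by omega) le_rfl
      (h1 _ (hc _ _) (dX_mem_lauFil (hu a) i))
  · exact sum_mem fun i _ => sum_mem fun j _ => lauFil_mono (by omega) le_rfl
      (h1 _ (hc _ _) (dX_mem_lauFil (hu a) j))
  · exact lauFil_mono (by omega) (by omega) (h2 (sum_mem fun i _ => sum_mem fun j _ =>
      h0 _ (dX_mem_lauFil (hu j) i)))
  · exact sum_mem fun i _ => sum_mem fun j _ => h0 _ (hu j)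
  · exact lauFil_mono (by omega) (by omega) (h2 (sum_mem fun i _ => h0 _ (hu i)))
  · exact sum_mem fun i _ => h0 _ (hu i)

end LocalData.IsRegular

theorem coeff_comp_constS0 (q : PolyY n r) (a : Fin r) (k : ℤ) :
    (comp (constS0 n r q) a).coeff k = if k = 0 then q a else 0 := by
  classical
  rw [coeff_comp]
  change (HahnSeries.single (0 : ℤ) q).coeff k a = _
  rw [HahnSeries.coeff_single]
  split_ifs <;> rfl

theorem comp_constS0_mem {q : PolyY n r} {d : ℕ} (hq : ∀ a, (q a).totalDegree ≤ d) (a : Fin r) :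
    comp (constS0 n r q) a ∈ lauFil n 0 d := by
  intro k α h
  rw [coeff_comp_constS0] at h
  split_ifs at h with hk
  · have := MvPolynomial.le_totalDegree (MvPolynomial.mem_support_iff.2 h)
    have h2 := hq a
    change α.degree ≤ _ at this
    omega
  · simp at h

theorem Q₀_apply (q : PolyY n r) (a : Fin r) :
    D.Q₀ q a = (comp (D.Q (constS0 n r q)) a).coeff 0 := rfl

theorem totalDegree_le_of_coeff {p : MvPolynomial (Fin n) ℂ} {d : ℕ}
    (h : ∀ α, p.coeff α ≠ 0 → α.degree ≤ d) : p.totalDegree ≤ d :=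
  Finset.sup_le fun α hα => h α (MvPolynomial.mem_support_iff.1 hα)

theorem coeff_rho_one {f : MvPowerSeries (Fin n) ℂ} {c : ℂ} {j : Fin n}
    (hf : ∀ i, MvPowerSeries.coeff (Finsupp.single i 1) f = if i = j then c else 0) :
    (rho n f).coeff 1 = MvPolynomial.C c * MvPolynomial.X j := by
  ext β
  rw [coeff_rho, MvPolynomial.coeff_C_mul, MvPolynomial.coeff_X]
  by_cases hβ : (β.degree : ℤ) = 1
  · obtain ⟨i, rfl⟩ : ∃ i, β = Finsupp.single i 1 := by
      obtain ⟨β', i, h⟩ := Finsupp.exists_eq_add_single (α := β)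
        (by rintro rfl; simp at hβ)
      refine ⟨i, ?_⟩
      have h2 : β' = 0 := by
        rw [← Finsupp.degree_eq_zero_iff]
        rw [h, map_add, Finsupp.degree_single] at hβ
        omega
      rw [h, h2, zero_add]
    rw [if_pos hβ, hf]
    by_cases hij : i = j
    · simp [hij]
    · rw [if_neg hij, if_neg fun h => hij (Finsupp.single_left_injective one_ne_zero h).symm,
        mul_zero]
  · rw [if_neg hβ, if_neg, mul_zero]
    rintro rfl
    simp at hβ

/-- The coefficient of `ρ(f) ∂_{x_j} q` at `t ^ 0`, for a series `f` without constant term. -/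
theorem coeff_rho_mul_dX_const {f : MvPowerSeries (Fin n) ℂ} {c : ℂ} (j : Fin n)
    (hf : ∀ i, MvPowerSeries.coeff (Finsupp.single i 1) f = if i = j then c else 0)
    {F : Lau n} (h0 : MvPowerSeries.constantCoeff f = 0) {d : ℤ} (hF : F ∈ lauFil n 0 d)
    (α : Fin n →₀ ℕ) :
    ((rho n f * dX j F).coeff 0).coeff α = c * α j * (F.coeff 0).coeff α := by
  rw [HahnSeries.coeff_mul_Icc _ _
    (fun i hi => coeff_eq_zero_of_mem_lauFil (rho_mem_lauFil_one h0) hi)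
    (fun i hi => coeff_eq_zero_of_mem_lauFil (dX_mem_lauFil hF j) hi)]
  rw [show (0 : ℤ) - (0 - 1) = 1 by norm_num, Finset.Icc_self, Finset.sum_singleton, coeff_rho_one hf,
    coeff_dX,
    mul_assoc, MvPolynomial.coeff_C_mul, mul_comm (MvPolynomial.X j),
    show (0 : ℤ) - 1 + 1 = 0 by norm_num, MvPolynomial.coeff_mul_X', mul_assoc]
  congr 1
  split_ifs with h
  · rw [MvPolynomial.coeff_pderiv, Finsupp.coe_tsub, Pi.sub_apply, Finsupp.single_eq_same]
    have h1 : 1 ≤ α j := Nat.one_le_iff_ne_zero.2 (Finsupp.mem_support_iff.1 h)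
    have h2 : α - Finsupp.single j 1 + Finsupp.single j 1 = α :=
      tsub_add_cancel_of_le (Finsupp.single_le_iff.2 h1)
    rw [h2]
    push_cast [h1]
    ring
  · rw [Finsupp.notMem_support_iff.1 h]
    simp

/-- On the coefficients of maximal degree, `Q₀` acts as `∑_j (2 α_j + 1) λ_j + W(p)`. -/
theorem LocalData.IsRegular.coeff_Q₀_top (hD : D.IsRegular) {q : PolyY n r} {d : ℕ}
    (hq : ∀ a, (q a).totalDegree ≤ d) {α : Fin n →₀ ℕ} (hα : α.degree = d) (a : Fin r) :
    (D.Q₀ q a).coeff α = (∑ j, (2 * (α j : ℂ) + 1) * D.lam j) * (q a).coeff α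
      + ∑ b, D.w 0 a b * (q b).coeff α := by
  have hU := comp_constS0_mem hq
  have e0 : ∀ a, (comp (constS0 n r q) a).coeff 0 = q a := fun a => by
    rw [coeff_comp_constS0, if_pos rfl]
  -- Terms with a smaller degree offset, or beginning at a positive power of t, do not reach the
  -- monomials of degree d at order t^0. This disposes of the second order part, of the b-terms and
  -- of c.
  have hlow : ∀ {m e : ℤ} {F : Lau n}, F ∈ lauFil n m e → (e < d ∨ 0 < m) →
      (F.coeff 0).coeff α = 0 := fun {m e F} hF he => by
    by_contra h
    have := hF 0 α h
    omega
  have h0 : ∀ (f : MvPowerSeries (Fin n) ℂ) {m' d' : ℤ} {F : Lau n},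
      F ∈ lauFil n m' d' → rho n f * F ∈ lauFil n m' d' := fun f m' d' F hF => by
    simpa using mul_mem_lauFil (rho_mem_lauFil f) hF
  have h2 : ∀ {m' d' : ℤ} {F : Lau n}, F ∈ lauFil n m' d' →
      tmon n 2 * F ∈ lauFil n (2 + m') (-2 + d') := fun hF =>
    mul_mem_lauFil (tmon_mem_lauFil 2) hF
  have hc : ∀ i (f : MvPowerSeries (Fin n) ℂ), MvPowerSeries.constantCoeff (f * D.dφ i) = 0 :=
    fun i f => by rw [map_mul, hD.constantCoeff_dφ, mul_zero]
  -- The linear part of f ∂_iφ is f(0) λ_i x_i, since the Hessian of φ at the origin is diagonal.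
  -- Each of the two transport terms therefore contributes the Euler operator ∑ λ_i y_i ∂_{y_i}.
  have hl : ∀ (f : MvPowerSeries (Fin n) ℂ) i l,
      MvPowerSeries.coeff (Finsupp.single l 1) (f * D.dφ i) =
        if l = i then MvPowerSeries.constantCoeff f * D.lam i else 0 := fun f i l => by
    have h := MvPowerSeries.coeff_pderiv (R := ℂ) (i := l) (f * D.dφ i) 0
    rw [zero_add, Finsupp.coe_zero, Pi.zero_apply, Nat.cast_zero, zero_add, mul_one,
      MvPowerSeries.coeff_zero_eq_constantCoeff_apply, Derivation.leibniz, map_add, smul_eq_mul,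
      smul_eq_mul, map_mul, map_mul, hD.constantCoeff_dφ, hD.constantCoeff_pderiv_dφ, zero_mul,
      add_zero] at h
    rw [← h, mul_ite, mul_zero]
  have t1 : ((∑ i, ∑ j, rho n (D.invSer i j * MvPowerSeries.pderiv ℂ i (D.dφ j)) *
      comp (constS0 n r q) a).coeff 0).coeff α = (∑ j, (D.lam j : ℂ)) * (q a).coeff α := by
    simp only [HahnSeries.coeff_sum, rho_mul_coeff_zero _ (hU a), e0, MvPolynomial.coeff_sum,
      MvPolynomial.coeff_C_mul, Finset.sum_mul]
    refine Finset.sum_congr rfl fun i _ => ?_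
    simp only [map_mul, hD.constantCoeff_invSer, hD.constantCoeff_pderiv_dφ]
    rw [Finset.sum_eq_single i (fun j _ hj => by simp [Ne.symm hj]) (by simp)]
    simp
  have t2 : ((∑ i, ∑ j, rho n (D.invSer i j * D.dφ j) * dX i (comp (constS0 n r q) a)).coeff
      0).coeff α = (∑ j, (D.lam j : ℂ) * α j) * (q a).coeff α := by
    simp only [HahnSeries.coeff_sum, MvPolynomial.coeff_sum, Finset.sum_mul]
    refine Finset.sum_congr rfl fun i _ => ?_
    rw [Finset.sum_eq_single i ?_ (by simp)]
    · rw [coeff_rho_mul_dX_const i (hl _ _) (hc _ _) (hU a), e0, hD.constantCoeff_invSer,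
        if_pos rfl, one_mul]
    · intro j _ hj
      rw [coeff_rho_mul_dX_const (c := 0) i (fun l => ?_) (hc _ _) (hU a), zero_mul, zero_mul]
      rw [hl, hD.constantCoeff_invSer, if_neg (Ne.symm hj), zero_mul, ite_self, ite_self]
  have t3 : ((∑ i, ∑ j, rho n (D.invSer i j * D.dφ i) * dX j (comp (constS0 n r q) a)).coeff
      0).coeff α = (∑ j, (D.lam j : ℂ) * α j) * (q a).coeff α := by
    simp only [HahnSeries.coeff_sum, MvPolynomial.coeff_sum, Finset.sum_mul]
    refine Finset.sum_congr rfl fun i _ => ?_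
    rw [Finset.sum_eq_single i ?_ (by simp)]
    · rw [coeff_rho_mul_dX_const i (hl _ _) (hc _ _) (hU a), e0, hD.constantCoeff_invSer,
        if_pos rfl, one_mul]
    · intro j _ hj
      rw [coeff_rho_mul_dX_const (c := 0) j (fun l => ?_) (hc _ _) (hU a), zero_mul, zero_mul]
      rw [hl, hD.constantCoeff_invSer, if_neg (Ne.symm hj), zero_mul, ite_self, ite_self]
  have t4 : ((∑ b, rho n (taylorMat D.w a b) * comp (constS0 n r q) b).coeff 0).coeff α =
      ∑ b, D.w 0 a b * (q b).coeff α := by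
    simp only [HahnSeries.coeff_sum, MvPolynomial.coeff_sum]
    refine Finset.sum_congr rfl fun b _ => ?_
    rw [rho_mul_coeff_zero _ (hU b), MvPolynomial.coeff_C_mul, e0, taylorMat, Matrix.of_apply,
      constantCoeff_taylor]
  have t5 : ((tmon n 2 * ∑ i, ∑ j, rho n (D.invSer i j) *
      dX i (dX j (comp (constS0 n r q) a))).coeff 0).coeff α = 0 :=
    hlow (h2 (sum_mem fun i _ => sum_mem fun j _ =>
      h0 _ (dX_mem_lauFil (dX_mem_lauFil (hU a) j) i))) (by omega)
  have t6 : ((tmon n 2 * ∑ j, ∑ b, rho n (taylorMat (D.b j) a b) *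
      dX j (comp (constS0 n r q) b)).coeff 0).coeff α = 0 :=
    hlow (h2 (sum_mem fun i _ => sum_mem fun j _ => h0 _ (dX_mem_lauFil (hU j) i))) (by omega)
  have t7 : ((∑ j, ∑ b, rho n (taylorMat (D.b j) a b * D.dφ j) *
      comp (constS0 n r q) b).coeff 0).coeff α = 0 :=
    hlow (sum_mem fun i _ => sum_mem fun j _ =>
      mul_mem_lauFil (rho_mem_lauFil_one (hc _ _)) (hU j)) (by omega)
  have t8 : ((tmon n 2 * ∑ b, rho n (taylorMat D.c a b) *
      comp (constS0 n r q) b).coeff 0).coeff α = 0 :=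
    hlow (h2 (sum_mem fun i _ => h0 _ (hU i))) (by omega)
  rw [Q₀_apply, comp_Q_reduced D hD.taylor_V]
  simp only [HahnSeries.coeff_add, HahnSeries.coeff_sub, HahnSeries.coeff_neg,
    MvPolynomial.coeff_add, MvPolynomial.coeff_sub, MvPolynomial.coeff_neg]
  rw [t1, t2, t3, t4, t5, t6, t7, t8]
  have e : (∑ j, (2 * (α j : ℂ) + 1) * D.lam j) =
      (∑ j, (D.lam j : ℂ)) + 2 * ∑ j, (D.lam j : ℂ) * α j := by
    rw [Finset.mul_sum, ← Finset.sum_add_distrib]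
    exact Finset.sum_congr rfl fun j _ => by ring
  rw [e]
  ring

/-- The set of the degrees `|α|`, `(α, k) ∈ I_{E₀}`, is bounded. -/
theorem LocalData.IsRegular.bddAbove_degree (hD : D.IsRegular) (μ : Fin r → ℝ) (E₀ : ℝ) :
    BddAbove ((fun p : (Fin n →₀ ℕ) × Fin r => p.1.degree) '' D.indexSet μ E₀) := by
  obtain ⟨B, hB⟩ : ∃ B : ℕ, ∀ j, ∀ k, (E₀ - μ k) / D.lam j ≤ B := by
    obtain ⟨B, hB⟩ := exists_nat_ge (∑ j, ∑ k, |(E₀ - μ k) / D.lam j|)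
    refine ⟨B, fun j k => (le_abs_self _).trans (le_trans ?_ hB)⟩
    exact (Finset.single_le_sum (f := fun k => |(E₀ - μ k) / D.lam j|)
      (fun _ _ => abs_nonneg _) (Finset.mem_univ k)).trans
      (Finset.single_le_sum (f := fun j => ∑ k, |(E₀ - μ k) / D.lam j|)
      (fun _ _ => Finset.sum_nonneg fun _ _ => abs_nonneg _) (Finset.mem_univ j))
  refine ⟨∑ _j : Fin n, B, ?_⟩
  rintro _ ⟨⟨α, k⟩, hp, rfl⟩
  change D.energy μ α k = E₀ at hp
  simp only [Finsupp.degree_eq_sum]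
  refine Finset.sum_le_sum fun j _ => ?_
  have hj : (α j : ℝ) * D.lam j ≤ E₀ - μ k := by
    have h1 : (2 * (α j : ℝ) + 1) * D.lam j ≤ ∑ j, (2 * (α j : ℝ) + 1) * D.lam j :=
      Finset.single_le_sum (f := fun j => (2 * (α j : ℝ) + 1) * D.lam j)
        (fun j _ => by have := hD.lam_pos j; positivity) (Finset.mem_univ j)
    have h2 := hD.lam_pos j
    have h3 : 0 ≤ (α j : ℝ) * D.lam j := by positivity
    rw [LocalData.energy] at hp
    linarith
  have h := (le_div_iff₀ (hD.lam_pos j)).2 hj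
  exact_mod_cast h.trans (hB j k)

/-- The coefficients of a monomial y^α of top degree form an eigenvector of W(p) with eigenvalue E₀
- ∑ (2α_j + 1) λ_j. This number is one of the μ_k, whence (α, k) lies in I_{E₀}. -/
theorem LocalData.IsRegular.totalDegree_le_of_mem_eigenspace (hD : D.IsRegular) {μ : Fin r → ℝ}
    (hμ : (D.w 0).charpoly = ∏ k, (Polynomial.X - Polynomial.C (μ k : ℂ))) {E₀ : ℝ}
    {q : PolyY n r} (hq : q ∈ Module.End.eigenspace D.Q₀ (E₀ : ℂ)) (a : Fin r) :
    (q a).totalDegree ≤ D.maxDegree μ E₀ := by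
  set d := Finset.univ.sup fun a => (q a).totalDegree with hd
  have hqd : ∀ a, (q a).totalDegree ≤ d := fun a =>
    Finset.le_sup (f := fun a => (q a).totalDegree) (Finset.mem_univ a)
  -- In degree zero there is nothing to prove; this also covers q = 0, which has no top degree
  -- monomial.
  by_cases hd0 : d = 0
  · exact (hqd a).trans (by omega)
  refine (hqd a).trans ?_
  obtain ⟨a₀, -, ha₀⟩ := Finset.exists_mem_eq_sup Finset.univ ⟨a, Finset.mem_univ a⟩
    fun a => (q a).totalDegree
  have hne : (q a₀).support.Nonempty := by
    rw [Finset.nonempty_iff_ne_empty, Ne, MvPolynomial.support_eq_empty]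
    intro h
    rw [h, MvPolynomial.totalDegree_zero] at ha₀
    exact hd0 ha₀
  obtain ⟨α, hα, hαd⟩ := Finset.exists_mem_eq_sup _ hne fun s => s.degree
  have hαd' : α.degree = d := by
    rw [hd, ha₀, ← hαd]
    rfl
  have heq := Module.End.mem_eigenspace_iff.1 hq
  have hv : (D.w 0).mulVec (fun b => (q b).coeff α) =
      ((E₀ - ∑ j, (2 * (α j : ℝ) + 1) * D.lam j : ℝ) : ℂ) • fun b => (q b).coeff α := by
    funext b
    have h1 := hD.coeff_Q₀_top hqd hαd' b
    rw [heq, Pi.smul_apply, MvPolynomial.coeff_smul, smul_eq_mul] at h1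
    rw [Pi.smul_apply, smul_eq_mul]
    change ∑ c, D.w 0 b c * (q c).coeff α = _
    push_cast
    linear_combination -h1
  have hev : Module.End.HasEigenvector (Matrix.toLin' (D.w 0))
      ((E₀ - ∑ j, (2 * (α j : ℝ) + 1) * D.lam j : ℝ) : ℂ) fun b => (q b).coeff α := by
    refine ⟨Module.End.mem_eigenspace_iff.2 ?_, fun h => ?_⟩
    · rw [Matrix.toLin'_apply, hv]
    · exact MvPolynomial.mem_support_iff.1 hα (congrFun h a₀)
  have hroot := (Module.End.hasEigenvalue_iff_isRoot_charpoly _ _).1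
    (Module.End.hasEigenvalue_of_hasEigenvector hev)
  rw [Matrix.charpoly_toLin', hμ, Polynomial.IsRoot, Polynomial.eval_prod,
    Finset.prod_eq_zero_iff] at hroot
  obtain ⟨k, -, hk⟩ := hroot
  rw [Polynomial.eval_sub, Polynomial.eval_X, Polynomial.eval_C, ← Complex.ofReal_sub,
    Complex.ofReal_eq_zero] at hk
  refine hαd' ▸ le_csSup (hD.bddAbove_degree μ E₀) ⟨(α, k), ?_, rfl⟩
  change D.energy μ α k = E₀
  rw [LocalData.energy]
  linarith

end Filtration

/-! ## Recursive constructions -/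

section Recursion

/-- A sequence whose terms satisfy conditions depending only on the preceding terms. -/
theorem exists_seq_of_step {X : Type*} [Nonempty X] (R : ℕ → (ℕ → X) → X → Prop)
    (hloc : ∀ k b b' x, (∀ i < k, b i = b' i) → R k b x → R k b' x)
    (hex : ∀ k b, (∀ i < k, R i b (b i)) → ∃ x, R k b x) : ∃ b : ℕ → X, ∀ k, R k b (b k) := by
  classical
  -- `G` chooses a solution if one exists and an arbitrary element otherwise. The recursion feeds it
  -- the terms already constructed, padded arbitrarily from index k on; by `hloc` the padding has no
  -- effect on the conditions.
  let G : ℕ → (ℕ → X) → X := fun k b => if h : ∃ x, R k b x then h.choose else Classical.arbitrary X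
  let b : ℕ → X := Nat.lt_wfRel.wf.fix fun k ih =>
    G k fun i => if h : i < k then ih i h else Classical.arbitrary X
  have hb : ∀ k, b k = G k fun i => if i < k then b i else Classical.arbitrary X := fun k => by
    have := Nat.lt_wfRel.wf.fix_eq (C := fun _ => X)
      (fun k ih => G k fun i => if h : i < k then ih i h else Classical.arbitrary X) k
    simpa using this
  refine ⟨b, fun k => ?_⟩
  induction k using Nat.strong_induction_on with
  | _ k ih =>
    have h1 : ∃ x, R k (fun i => if i < k then b i else Classical.arbitrary X) x := by
      refine hex k _ fun i hi => ?_
      refine hloc i b _ _ (fun j hj => ?_) ?_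
      · rw [if_pos (hj.trans hi)]
      · simp only [if_pos hi]
        exact ih i hi
    refine hloc k (fun i => if i < k then b i else Classical.arbitrary X) b _
      (fun i hi => by simp only [if_pos hi]) ?_
    rw [hb k]
    simp only [G, dif_pos h1]
    exact h1.choose_spec

/-- A family of eigenvectors of the leading term of `T = ∑ t^l T_l`, with a common eigenvalue `a`,
extends to a family of power series on which `T` acts by a matrix of power series. -/
theorem exists_invariant_family {V : Type*} [AddCommGroup V] [Module ℂ V] {ι : Type*} [Fintype ι]
    [DecidableEq ι] (T : ℕ → V →ₗ[ℂ] V) (F : ℕ → Submodule ℂ V) (hmono : Monotone F)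
    (hT : ∀ l k, ∀ v ∈ F k, T l v ∈ F (k + l)) (a : ℂ) (χ : ι → V) (hχ : ∀ i, χ i ∈ F 0)
    (hχ0 : ∀ i, T 0 (χ i) = a • χ i)
    (hdec : ∀ k, ∀ v ∈ F k, ∃ s ∈ F k, ∃ c : ι → ℂ, v = T 0 s - a • s + ∑ i, c i • χ i) :
    ∃ (Ψ : ℕ → ι → V) (M : ℕ → ι → ι → ℂ), Ψ 0 = χ ∧
      (M 0 = fun i j => if i = j then a else 0) ∧ (∀ k j, Ψ k j ∈ F k) ∧
      ∀ k j, ∑ l ∈ Finset.range (k + 1), T l (Ψ (k - l) j) =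
        ∑ l ∈ Finset.range (k + 1), ∑ i, M l i j • Ψ (k - l) i := by
  -- The condition at k + 1 is the coefficient of t^{k+1} in T Ψ = Ψ M, with the two unknown
  -- contributions, T₀ - a applied to the new vectors and the new matrix coefficients times χ,
  -- written separately from the known terms.
  let R : ℕ → (ℕ → (ι → V) × (ι → ι → ℂ)) → (ι → V) × (ι → ι → ℂ) → Prop := fun k b x =>
    match k with
    | 0 => x = (χ, fun i j => if i = j then a else 0)
    | k + 1 => (∀ j, x.1 j ∈ F (k + 1)) ∧ ∀ j,
        T 0 (x.1 j) + ∑ l ∈ Finset.range (k + 1), T (l + 1) ((b (k - l)).1 j) =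
        a • x.1 j + ∑ l ∈ Finset.range k, ∑ i, (b (l + 1)).2 i j • (b (k - l)).1 i
          + ∑ i, x.2 i j • χ i
  obtain ⟨b, hb⟩ := exists_seq_of_step R (by
    intro k b b' x h hx
    match k with
    | 0 => exact hx
    | k + 1 =>
      refine ⟨hx.1, fun j => ?_⟩
      have h1 : ∑ l ∈ Finset.range (k + 1), T (l + 1) ((b' (k - l)).1 j) =
          ∑ l ∈ Finset.range (k + 1), T (l + 1) ((b (k - l)).1 j) :=
        Finset.sum_congr rfl fun l _ => by rw [h (k - l) (by omega)]
      have h2 : ∑ l ∈ Finset.range k, ∑ i, (b' (l + 1)).2 i j • (b' (k - l)).1 i =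
          ∑ l ∈ Finset.range k, ∑ i, (b (l + 1)).2 i j • (b (k - l)).1 i :=
        Finset.sum_congr rfl fun l hl => by
          rw [h (k - l) (by omega), h (l + 1) (by have := Finset.mem_range.1 hl; omega)]
      rw [h1, h2]
      exact hx.2 j) (by
    intro k b ih
    match k with
    | 0 => exact ⟨_, rfl⟩
    | k + 1 =>
      have hmem : ∀ i ≤ k, ∀ j, (b i).1 j ∈ F i := fun i hi j => by
        have := ih i (by omega)
        match i with
        | 0 =>
          have h0 : b 0 = _ := this
          rw [h0]
          exact hχ j
        | i + 1 => exact this.1 j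
      have hr : ∀ j, ∑ l ∈ Finset.range (k + 1), T (l + 1) ((b (k - l)).1 j) -
          ∑ l ∈ Finset.range k, ∑ i, (b (l + 1)).2 i j • (b (k - l)).1 i ∈ F (k + 1) := fun j => by
        refine sub_mem (sum_mem fun l hl => ?_) (sum_mem fun l _ => sum_mem fun i _ => ?_)
        · have := hT (l + 1) (k - l) _ (hmem (k - l) (by omega) j)
          have hl := Finset.mem_range.1 hl
          rwa [show k - l + (l + 1) = k + 1 by omega] at this
        · exact Submodule.smul_mem _ _ (hmono (by omega) (hmem (k - l) (by omega) i))
      -- Decomposing the known terms as (T₀ - a) s + ∑ c_i χ_i solves the equation: -s is the next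
      -- vector, and c is the next column of the matrix.
      choose s hs c hc using fun j => hdec (k + 1) _ (hr j)
      refine ⟨(fun j => -s j, fun i j => c j i), fun j => neg_mem (hs j), fun j => ?_⟩
      have := hc j
      rw [sub_eq_iff_eq_add] at this
      simp only [this, map_neg, smul_neg]
      abel)
  refine ⟨fun k => (b k).1, fun k => (b k).2, congrArg Prod.fst (hb 0), congrArg Prod.snd (hb 0),
    fun k j => ?_, fun k j => ?_⟩
  · match k with
    | 0 =>
      have h0 : b 0 = _ := hb 0
      simp only [h0]
      exact hχ j
    | k + 1 => exact (hb (k + 1)).1 j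
  · have h0 : b 0 = _ := hb 0
    match k with
    | 0 => simp [h0, hχ0]
    | k + 1 =>
      have h1 := (hb (k + 1)).2 j
      have h2 : ∑ l ∈ Finset.range (k + 1), ∑ i, (b (l + 1)).2 i j • (b (k - l)).1 i =
          ∑ l ∈ Finset.range k, ∑ i, (b (l + 1)).2 i j • (b (k - l)).1 i
            + ∑ i, (b (k + 1)).2 i j • χ i := by
        rw [Finset.sum_range_succ, Nat.sub_self, h0]
      rw [Finset.sum_range_succ', Finset.sum_range_succ' _ (k + 1)]
      simp only [Nat.sub_zero, Nat.add_sub_add_right, h0, ite_smul, zero_smul,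
        Finset.sum_ite_eq', Finset.mem_univ, if_true]
      rw [add_comm, h1, h2]
      abel

/-- A hermitian power series of matrices with leading term `1` is of the form `X^* X`. -/
theorem exists_conjTranspose_mul_self {ι : Type*} [Fintype ι] [DecidableEq ι]
    (G : ℕ → Matrix ι ι ℂ) (h0 : G 0 = 1) (hG : ∀ k, (G k).conjTranspose = G k) :
    ∃ X : ℕ → Matrix ι ι ℂ, X 0 = 1 ∧
      ∀ k, ∑ l ∈ Finset.range (k + 1), (X l).conjTranspose * X (k - l) = G k := by
  -- For hermitian X_{k+1} and X₀ = 1, order k + 1 reads 2 X_{k+1} + S = G_{k+1}, where S is the sum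
  -- of the products of earlier terms; this accounts for the factor 1/2.
  let R : ℕ → (ℕ → Matrix ι ι ℂ) → Matrix ι ι ℂ → Prop := fun k b x =>
    match k with
    | 0 => x = 1
    | k + 1 => x = (1 / 2 : ℂ) • (G (k + 1) -
        ∑ l ∈ Finset.range k, (b (l + 1)).conjTranspose * b (k - l))
  obtain ⟨b, hb⟩ := exists_seq_of_step R (by
    intro k b b' x h hx
    match k with
    | 0 => exact hx
    | k + 1 =>
      have h2 : ∑ l ∈ Finset.range k, (b' (l + 1)).conjTranspose * b' (k - l) =
          ∑ l ∈ Finset.range k, (b (l + 1)).conjTranspose * b (k - l) :=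
        Finset.sum_congr rfl fun l hl => by
          rw [h (k - l) (by omega), h (l + 1) (by have := Finset.mem_range.1 hl; omega)]
      change x = _
      rw [h2]
      exact hx) (by
    intro k b _
    match k with
    | 0 => exact ⟨_, rfl⟩
    | k + 1 => exact ⟨_, rfl⟩)
  have hb0 : b 0 = 1 := hb 0
  refine ⟨b, hb0, fun k => ?_⟩
  match k with
  | 0 => simp [hb0, h0]
  | k + 1 =>
    have h1 : b (k + 1) = _ := hb (k + 1)
    -- Reversing the order of summation exchanges the two factors of each product, so S is hermitian
    -- and X_{k+1} is indeed hermitian.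
    have hS : (∑ l ∈ Finset.range k, (b (l + 1)).conjTranspose * b (k - l)).conjTranspose =
        ∑ l ∈ Finset.range k, (b (l + 1)).conjTranspose * b (k - l) := by
      rw [Matrix.conjTranspose_sum, ← Finset.sum_range_reflect]
      refine Finset.sum_congr rfl fun l hl => ?_
      have hl := Finset.mem_range.1 hl
      rw [Matrix.conjTranspose_mul, Matrix.conjTranspose_conjTranspose,
        show k - (k - 1 - l) = l + 1 by omega, show k - 1 - l + 1 = k - l by omega]
    have h2 : (b (k + 1)).conjTranspose = b (k + 1) := by
      rw [h1, Matrix.conjTranspose_smul, Matrix.conjTranspose_sub, hS, hG]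
      simp
    rw [Finset.sum_range_succ', Finset.sum_range_succ]
    simp only [Nat.sub_zero, Nat.add_sub_add_right, Nat.sub_self, hb0, h2,
      Matrix.conjTranspose_one, one_mul, mul_one]
    set S := ∑ l ∈ Finset.range k, (b (l + 1)).conjTranspose * b (k - l)
    rw [h1, add_assoc, ← add_smul]
    norm_num

end Recursion

/-! ## Matrices of power series -/

section PowerSeriesMatrix

open Matrix

/-- Complex conjugation of the coefficients of a power series. -/
noncomputable instance PowerSeries.instStarRingComplex : StarRing (PowerSeries ℂ) where
  star f := PowerSeries.map (starRingEnd ℂ) f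
  star_involutive f := by
    ext k
    simp
  star_mul f g := by
    change PowerSeries.map _ (f * g) = _
    rw [map_mul, mul_comm]
  star_add f g := map_add _ _ _

theorem PowerSeries.coeff_star (f : PowerSeries ℂ) (k : ℕ) :
    PowerSeries.coeff k (star f) = starRingEnd ℂ (PowerSeries.coeff k f) :=
  PowerSeries.coeff_map _ _ _

theorem PowerSeries.star_map_ofReal (f : PowerSeries ℝ) :
    star (f.map Complex.ofRealHom) = f.map Complex.ofRealHom := by
  ext k
  rw [PowerSeries.coeff_star, PowerSeries.coeff_map]
  simp

theorem PowerSeries.star_X_pow (k : ℕ) : star (PowerSeries.X ^ k : PowerSeries ℂ) =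
    PowerSeries.X ^ k := by
  ext i
  rw [PowerSeries.coeff_star, PowerSeries.coeff_X_pow]
  split_ifs <;> simp

variable {ι κ ν : Type*}

/-- The coefficient of `t ^ k` of a matrix of power series. -/
noncomputable def coeffMat (k : ℕ) (A : Matrix ι κ (PowerSeries ℂ)) : Matrix ι κ ℂ :=
  A.map (PowerSeries.coeff k)

/-- The matrix of power series with given coefficients. -/
noncomputable def mkMat (f : ℕ → Matrix ι κ ℂ) : Matrix ι κ (PowerSeries ℂ) :=
  Matrix.of fun i j => PowerSeries.mk fun k => f k i j

theorem coeffMat_mkMat (f : ℕ → Matrix ι κ ℂ) (k : ℕ) : coeffMat k (mkMat f) = f k := by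
  ext i j
  simp [coeffMat, mkMat]

theorem coeffMat_ext {A B : Matrix ι κ (PowerSeries ℂ)} (h : ∀ k, coeffMat k A = coeffMat k B) :
    A = B := by
  ext i j k
  exact congrFun (congrFun (h k) i) j

theorem coeffMat_mul [Fintype κ] (A : Matrix ι κ (PowerSeries ℂ)) (B : Matrix κ ν (PowerSeries ℂ))
    (k : ℕ) : coeffMat k (A * B) =
      ∑ l ∈ Finset.range (k + 1), coeffMat l A * coeffMat (k - l) B := by
  ext i j
  simp only [coeffMat, Matrix.map_apply, Matrix.mul_apply, Matrix.sum_apply, map_sum,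
    PowerSeries.coeff_mul]
  rw [Finset.sum_comm]
  exact Finset.Nat.sum_antidiagonal_eq_sum_range_succ
    (fun a b => ∑ x, PowerSeries.coeff a (A i x) * PowerSeries.coeff b (B x j)) k

theorem coeffMat_zero_mul [Fintype κ] (A : Matrix ι κ (PowerSeries ℂ))
    (B : Matrix κ ν (PowerSeries ℂ)) : coeffMat 0 (A * B) = coeffMat 0 A * coeffMat 0 B := by
  simp [coeffMat_mul]

theorem coeffMat_conjTranspose (A : Matrix ι κ (PowerSeries ℂ)) (k : ℕ) :
    coeffMat k Aᴴ = (coeffMat k A)ᴴ := by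
  ext i j
  exact PowerSeries.coeff_star _ _

theorem coeffMat_one [DecidableEq ι] (k : ℕ) :
    coeffMat k (1 : Matrix ι ι (PowerSeries ℂ)) = if k = 0 then 1 else 0 := by
  ext i j
  rw [coeffMat, Matrix.map_apply, Matrix.one_apply]
  by_cases hk : k = 0
  · subst hk
    by_cases hij : i = j <;> simp [Matrix.one_apply, hij]
  · by_cases hij : i = j <;> simp [hk, hij, PowerSeries.coeff_one]

/-- Writing G = X^* X, the factor X is invertible because its constant term is 1, and Z = X⁻¹
orthonormalizes. -/
theorem exists_isUnit_conjTranspose_mul_mul [Fintype ι] [DecidableEq ι]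
    {G : Matrix ι ι (PowerSeries ℂ)} (hG : Gᴴ = G) (h0 : coeffMat 0 G = 1) :
    ∃ Z : Matrix ι ι (PowerSeries ℂ), Zᴴ * G * Z = 1 := by
  obtain ⟨X, hX0, hX⟩ := exists_conjTranspose_mul_self (fun k => coeffMat k G) h0
    fun k => by rw [← coeffMat_conjTranspose, hG]
  have h1 : (mkMat X)ᴴ * mkMat X = G := by
    refine coeffMat_ext fun k => ?_
    rw [coeffMat_mul, ← hX k]
    simp only [coeffMat_conjTranspose, coeffMat_mkMat]
  have hdet : IsUnit (mkMat X).det := by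
    rw [PowerSeries.isUnit_iff_constantCoeff, RingHom.map_det]
    have : (PowerSeries.constantCoeff (R := ℂ)).mapMatrix (mkMat X) = 1 := by
      rw [← hX0, ← coeffMat_mkMat X 0]
      ext i j
      simp [coeffMat]
    rw [this, Matrix.det_one]
    exact isUnit_one
  refine ⟨(mkMat X)⁻¹, ?_⟩
  rw [← h1, Matrix.conjTranspose_nonsing_inv, Matrix.mul_assoc, Matrix.mul_assoc,
    Matrix.mul_nonsing_inv _ hdet, Matrix.mul_one, Matrix.nonsing_inv_mul]
  rw [Matrix.det_conjTranspose]
  exact hdet.star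

/-- The leading term of the eigenvalues, if the leading term of the matrix is a scalar. -/
theorem constantCoeff_eigenvalue [Fintype ι] [DecidableEq ι]
    {G M Z : Matrix ι ι (PowerSeries ℂ)} {f : ι → PowerSeries ℂ} {a : ℂ}
    (hM : coeffMat 0 M = a • 1) (hZ : Zᴴ * G * Z = 1) (hMZ : M * Z = Z * Matrix.diagonal f)
    (j : ι) : PowerSeries.constantCoeff (f j) = a := by
  have h1 := congrArg (coeffMat 0) hZ
  rw [coeffMat_zero_mul, coeffMat_one, if_pos rfl] at h1
  -- At order zero the relation Z^* G Z = 1 forbids a zero column in the leading coefficient of Z;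
  -- such a nonzero entry may be cancelled from the eigenvalue equation.
  obtain ⟨i, hi⟩ : ∃ i, coeffMat 0 Z i j ≠ 0 := by
    by_contra hc
    push Not at hc
    have := congrFun (congrFun h1 j) j
    rw [Matrix.mul_apply, Matrix.one_apply_eq] at this
    simp [hc] at this
  have h2 := congrArg (coeffMat 0) hMZ
  rw [coeffMat_zero_mul, coeffMat_zero_mul, hM, Matrix.smul_mul, Matrix.one_mul] at h2
  have h3 := congrFun (congrFun h2 i) j
  have h4 : coeffMat 0 (Matrix.diagonal f) =
      Matrix.diagonal fun i => PowerSeries.constantCoeff (f i) := by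
    ext i j
    rw [coeffMat, Matrix.map_apply, Matrix.diagonal_apply, Matrix.diagonal_apply]
    split_ifs <;> simp
  rw [h4, Matrix.mul_diagonal, Matrix.smul_apply, smul_eq_mul, mul_comm] at h3
  exact (mul_left_cancel₀ hi h3).symm

end PowerSeriesMatrix

/-! ## Diagonalization of self-adjoint matrices of power series -/

section Rellich

open Matrix

/-- The matrix `M`, self-adjoint with respect to the hermitian form with Gram matrix `G`, has a
basis of eigenvectors which is orthonormal with respect to this form. -/
def HasOrthonormalEigenbasis {ι : Type*} [Fintype ι] [DecidableEq ι]
    (G M : Matrix ι ι (PowerSeries ℂ)) : Prop :=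
  ∃ (f : ι → PowerSeries ℝ) (Z : Matrix ι ι (PowerSeries ℂ)), Zᴴ * G * Z = 1 ∧
    M * Z = Z * Matrix.diagonal fun i => (f i).map Complex.ofRealHom

variable {ι : Type*} [Fintype ι] [DecidableEq ι]

/-- Decomposition with respect to an eigenvalue of a hermitian matrix. -/
theorem Matrix.IsHermitian.exists_decomposition {A : Matrix ι ι ℂ} (hA : A.IsHermitian) (a : ℝ)
    (v : ι → ℂ) : ∃ (s : ι → ℂ) (c : {i // hA.eigenvalues i = a} → ℂ),
      v = A.mulVec s - (a : ℂ) • s + ∑ i, c i • ⇑(hA.eigenvectorBasis i.1) := by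
  have hv : v = ∑ i, (hA.eigenvectorBasis.repr (WithLp.toLp 2 v)) i •
      ⇑(hA.eigenvectorBasis i) := by
    have h := congrArg WithLp.ofLp (hA.eigenvectorBasis.sum_repr (WithLp.toLp 2 v))
    rw [WithLp.ofLp_sum] at h
    exact h.symm
  set c := hA.eigenvectorBasis.repr (WithLp.toLp 2 v) with hc
  refine ⟨∑ i, (if hA.eigenvalues i = a then 0 else c i / (hA.eigenvalues i - a)) •
    ⇑(hA.eigenvectorBasis i), fun i => c i.1, ?_⟩
  have h1 : ∑ i : {i // hA.eigenvalues i = a}, c i.1 • ⇑(hA.eigenvectorBasis i.1) =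
      ∑ i, if hA.eigenvalues i = a then c i • ⇑(hA.eigenvectorBasis i) else 0 := by
    rw [← Finset.sum_filter]
    exact (Finset.sum_subtype _ (by simp) (fun i => c i • ⇑(hA.eigenvectorBasis i))).symm
  rw [h1, Matrix.mulVec_sum, Finset.smul_sum, ← Finset.sum_sub_distrib, ← Finset.sum_add_distrib]
  conv_lhs => rw [hv]
  refine Finset.sum_congr rfl fun i _ => ?_
  rw [Matrix.mulVec_smul, hA.mulVec_eigenvectorBasis]
  split_ifs with h
  · simp
  · have h2 : (hA.eigenvalues i : ℂ) - a ≠ 0 := by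
      rw [← Complex.ofReal_sub]
      exact Complex.ofReal_ne_zero.2 (sub_ne_zero.2 h)
    funext k
    simp only [Pi.add_apply, Pi.sub_apply, Pi.smul_apply, smul_eq_mul, add_zero,
      Complex.real_smul, Pi.zero_apply]
    field_simp

/-- The eigenvectors of the leading coefficient for the eigenvalue a extend to a matrix Y of power
series with M Y = Y N'. The pair Y^* G Y, N' again satisfies the hypotheses of Rellich's theorem,
its Gram matrix having leading term 1 by orthonormality, so `ih` diagonalizes it. The leading term
of N' is a, which fixes the constant terms of the eigenvalues. -/
theorem exists_eigenvectors_block {G M : Matrix ι ι (PowerSeries ℂ)} (hG : Gᴴ = G)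
    (h0 : coeffMat 0 G = 1) (hGM : G * M = Mᴴ * G) (hA : (coeffMat 0 M).IsHermitian) (a : ℝ)
    (ih : ∀ G' M' : Matrix {i // hA.eigenvalues i = a} {i // hA.eigenvalues i = a} (PowerSeries ℂ),
      G'ᴴ = G' → coeffMat 0 G' = 1 → G' * M' = M'ᴴ * G' → HasOrthonormalEigenbasis G' M') :
    ∃ (h : {i // hA.eigenvalues i = a} → PowerSeries ℝ)
      (P : Matrix ι {i // hA.eigenvalues i = a} (PowerSeries ℂ)), Pᴴ * G * P = 1 ∧
      M * P = P * Matrix.diagonal (fun i => (h i).map Complex.ofRealHom) ∧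
      ∀ i, PowerSeries.constantCoeff (h i) = a := by
  obtain ⟨Ψ, N, hΨ0, hN0, -, hΨ⟩ := exists_invariant_family
    (fun l => (coeffMat l M).mulVecLin) (fun _ => ⊤) (fun _ _ _ => le_rfl)
    (fun _ _ _ _ => Submodule.mem_top) (a : ℂ)
    (fun i : {i // hA.eigenvalues i = a} => ⇑(hA.eigenvectorBasis i.1))
    (fun _ => Submodule.mem_top)
    (fun i => by
      rw [Matrix.mulVecLin_apply, hA.mulVec_eigenvectorBasis, i.2]
      rfl)
    (fun k v _ => by
      obtain ⟨s, c, hsc⟩ := hA.exists_decomposition a v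
      exact ⟨s, Submodule.mem_top, c, hsc⟩)
  set Y : Matrix ι {i // hA.eigenvalues i = a} (PowerSeries ℂ) :=
    mkMat fun k => Matrix.of fun i j => Ψ k j i with hY
  set N' : Matrix {i // hA.eigenvalues i = a} {i // hA.eigenvalues i = a} (PowerSeries ℂ) :=
    mkMat fun k => Matrix.of (N k) with hN'
  have hMY : M * Y = Y * N' := by
    refine coeffMat_ext fun k => ?_
    rw [coeffMat_mul, coeffMat_mul, ← Finset.sum_range_reflect (fun l => coeffMat l Y * _)]
    ext i j
    have h := congrFun (hΨ k j) i
    rw [Finset.sum_apply, Finset.sum_apply] at h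
    rw [Matrix.sum_apply, Matrix.sum_apply]
    refine Eq.trans ?_ (h.trans ?_)
    · refine Finset.sum_congr rfl fun l _ => ?_
      rw [hY, coeffMat_mkMat]
      rfl
    · refine Finset.sum_congr rfl fun l hl => ?_
      have hl := Finset.mem_range.1 hl
      rw [hY, hN', coeffMat_mkMat, coeffMat_mkMat, Finset.sum_apply, Matrix.mul_apply,
        show k + 1 - 1 - l = k - l by omega, show k - (k - l) = l by omega]
      exact Finset.sum_congr rfl fun x _ => mul_comm _ _
  have hG1 : (Yᴴ * G * Y)ᴴ = Yᴴ * G * Y := by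
    rw [Matrix.conjTranspose_mul, Matrix.conjTranspose_mul, Matrix.conjTranspose_conjTranspose, hG,
      Matrix.mul_assoc]
  have hG0 : coeffMat 0 (Yᴴ * G * Y) = 1 := by
    rw [coeffMat_zero_mul, coeffMat_zero_mul, h0, Matrix.mul_one, coeffMat_conjTranspose, hY,
      coeffMat_mkMat, hΨ0]
    ext i j
    rw [Matrix.mul_apply, Matrix.one_apply]
    have h := orthonormal_iff_ite.1 hA.eigenvectorBasis.orthonormal i.1 j.1
    rw [EuclideanSpace.inner_eq_star_dotProduct] at h
    simp only [Subtype.ext_iff]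
    rw [← h, dotProduct]
    exact Finset.sum_congr rfl fun x _ => mul_comm _ _
  have hGM1 : (Yᴴ * G * Y) * N' = N'ᴴ * (Yᴴ * G * Y) := by
    calc (Yᴴ * G * Y) * N' = Yᴴ * G * (M * Y) := by rw [hMY]; simp only [Matrix.mul_assoc]
      _ = Yᴴ * (G * M) * Y := by simp only [Matrix.mul_assoc]
      _ = (M * Y)ᴴ * G * Y := by
        rw [hGM, Matrix.conjTranspose_mul]
        simp only [Matrix.mul_assoc]
      _ = N'ᴴ * (Yᴴ * G * Y) := by
        rw [hMY, Matrix.conjTranspose_mul]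
        simp only [Matrix.mul_assoc]
  obtain ⟨h, Z, hZ, hNZ⟩ := ih _ _ hG1 hG0 hGM1
  refine ⟨h, Y * Z, ?_, ?_, fun i => ?_⟩
  · rw [← hZ, Matrix.conjTranspose_mul]
    simp only [Matrix.mul_assoc]
  · rw [← Matrix.mul_assoc, hMY, Matrix.mul_assoc, hNZ, Matrix.mul_assoc]
  · have hc : coeffMat 0 N' = (a : ℂ) • 1 := by
      rw [hN', coeffMat_mkMat, hN0]
      ext i j
      simp [Matrix.one_apply]
    have := constantCoeff_eigenvalue hc hZ hNZ i
    rw [← PowerSeries.coeff_zero_eq_constantCoeff_apply, PowerSeries.coeff_map,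
      PowerSeries.coeff_zero_eq_constantCoeff_apply] at this
    exact Complex.ofReal_injective this

/-- The eigenvectors belonging to the eigenvalues of the leading term form a basis. -/
theorem hasOrthonormalEigenbasis_of_blocks {G M : Matrix ι ι (PowerSeries ℂ)}
    (hGM : G * M = Mᴴ * G) (d : ι → ℝ) (h : ∀ a : ℝ, {i // d i = a} → PowerSeries ℝ)
    (P : ∀ a : ℝ, Matrix ι {i // d i = a} (PowerSeries ℂ)) (hP : ∀ a, (P a)ᴴ * G * P a = 1)
    (hMP : ∀ a, M * P a = P a * Matrix.diagonal (fun i => (h a i).map Complex.ofRealHom))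
    (h0 : ∀ a i, PowerSeries.constantCoeff (h a i) = a) : HasOrthonormalEigenbasis G M := by
  set Z : Matrix ι ι (PowerSeries ℂ) := Matrix.of fun i j => P (d j) i ⟨j, rfl⟩ with hZ
  set f : ι → PowerSeries ℝ := fun j => h (d j) ⟨j, rfl⟩ with hf
  have hMZ : M * Z = Z * Matrix.diagonal fun i => (f i).map Complex.ofRealHom := by
    ext1 i j
    have := congrFun (congrFun (hMP (d j)) i) ⟨j, rfl⟩
    rw [Matrix.mul_diagonal] at this ⊢
    exact this
  refine ⟨f, Z, ?_, hMZ⟩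
  have hD : (Matrix.diagonal fun i => (f i).map Complex.ofRealHom)ᴴ =
      Matrix.diagonal fun i => (f i).map Complex.ofRealHom := by
    rw [Matrix.diagonal_conjTranspose]
    congr 1
    funext i
    exact PowerSeries.star_map_ofReal _
  -- Self-adjointness of M and reality of the eigenvalue series make the Gram matrix of the
  -- eigenvectors commute with the diagonal matrix of eigenvalues.
  have hS : Zᴴ * G * Z * (Matrix.diagonal fun i => (f i).map Complex.ofRealHom) =
      (Matrix.diagonal fun i => (f i).map Complex.ofRealHom) * (Zᴴ * G * Z) := by
    calc Zᴴ * G * Z * (Matrix.diagonal fun i => (f i).map Complex.ofRealHom) =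
        Zᴴ * G * (M * Z) := by rw [hMZ]; simp only [Matrix.mul_assoc]
      _ = Zᴴ * (G * M) * Z := by simp only [Matrix.mul_assoc]
      _ = (M * Z)ᴴ * G * Z := by
        rw [hGM, Matrix.conjTranspose_mul]
        simp only [Matrix.mul_assoc]
      _ = _ := by
        rw [hMZ, Matrix.conjTranspose_mul, hD]
        simp only [Matrix.mul_assoc]
  ext1 i j
  by_cases hij : d i = d j
  · have key : ∀ (a : ℝ) (hi : d i = a) (hj : d j = a), (Zᴴ * G * Z) i j =
        ((P a)ᴴ * G * P a) ⟨i, hi⟩ ⟨j, hj⟩ := by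
      intro a hi hj
      have hcol : ∀ l (hl : d l = a) k, Z k l = P a k ⟨l, hl⟩ := fun l hl k => by
        subst hl
        rfl
      simp only [Matrix.mul_apply, Matrix.conjTranspose_apply, hcol i hi, hcol j hj]
    rw [key (d j) hij rfl, hP, Matrix.one_apply, Matrix.one_apply]
    simp only [Subtype.mk.injEq]
  -- Between different blocks the eigenvalue series have different constant terms, so their
  -- difference is nonzero; as ℂ[[t]] is a domain, the entry of the Gram matrix vanishes.
  · have h1 := congrFun (congrFun hS i) j
    rw [Matrix.mul_diagonal, Matrix.diagonal_mul, mul_comm, ← sub_eq_zero, ← sub_mul] at h1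
    have hne : i ≠ j := fun h => hij (h ▸ rfl)
    rw [Matrix.one_apply_ne hne]
    refine (mul_eq_zero.1 h1).resolve_left fun h2 => hij ?_
    have h3 := congrArg (PowerSeries.coeff 0) h2
    rw [map_sub, PowerSeries.coeff_map, PowerSeries.coeff_map, map_zero, sub_eq_zero] at h3
    have h4 := Complex.ofReal_injective h3
    rw [PowerSeries.coeff_zero_eq_constantCoeff_apply,
      PowerSeries.coeff_zero_eq_constantCoeff_apply, h0, h0] at h4
    exact h4.symm

/-- **Rellich's theorem** for formal power series. -/
theorem hasOrthonormalEigenbasis (m : ℕ) : ∀ {ι : Type} [Fintype ι] [DecidableEq ι],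
    Fintype.card ι = m → ∀ G M : Matrix ι ι (PowerSeries ℂ), Gᴴ = G → coeffMat 0 G = 1 →
      G * M = Mᴴ * G → HasOrthonormalEigenbasis G M := by
  induction m using Nat.strong_induction_on with
  | _ m ih =>
    intro ι _ _ hcard G M hG h0 hGM
    -- If every coefficient is a real scalar, M is already diagonal in every basis, and only
    -- orthonormalization remains.
    by_cases hsc : ∀ k, ∃ c : ℝ, coeffMat k M = (c : ℂ) • 1
    · choose c hc using hsc
      obtain ⟨Z, hZ⟩ := exists_isUnit_conjTranspose_mul_mul hG h0
      refine ⟨fun _ => PowerSeries.mk c, Z, hZ, ?_⟩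
      have hM : M = Matrix.diagonal fun _ => (PowerSeries.mk c).map Complex.ofRealHom := by
        refine coeffMat_ext fun k => ?_
        rw [hc]
        ext i j
        rw [coeffMat, Matrix.map_apply, Matrix.diagonal_apply, Matrix.smul_apply, Matrix.one_apply]
        split_ifs <;> simp
      conv_lhs => rw [hM]
      ext1 i j
      rw [Matrix.mul_diagonal, Matrix.diagonal_mul, mul_comm]
    · push Not at hsc
      classical
      -- Otherwise the real scalar part below the first exceptional order k is subtracted and the
      -- rest is divided by t^k. Neither operation affects the eigenvectors or self-adjointness, and
      -- the leading coefficient is now not a real scalar.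
      have hk := Nat.find_spec hsc
      have hlt : ∀ l < Nat.find hsc, ∃ c : ℝ, coeffMat l M = (c : ℂ) • 1 := fun l hl => by
        have := Nat.find_min hsc hl
        push Not at this
        exact this
      generalize Nat.find hsc = k at hk hlt
      -- The value 0 from index k on leaves the whole tail of M to M'.
      set c : ℕ → ℝ := fun l => if h : l < k then (hlt l h).choose else 0 with hc
      set f : PowerSeries ℝ := PowerSeries.mk c with hf
      set F : PowerSeries ℂ := f.map Complex.ofRealHom with hF
      set M' : Matrix ι ι (PowerSeries ℂ) := mkMat fun l => coeffMat (l + k) M with hM'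
      have hMM : M = F • (1 : Matrix ι ι (PowerSeries ℂ)) + (PowerSeries.X ^ k : PowerSeries ℂ) • M' := by
        refine coeffMat_ext fun l => ?_
        ext i j
        change PowerSeries.coeff l (M i j) = PowerSeries.coeff l
          (F * (1 : Matrix ι ι (PowerSeries ℂ)) i j + PowerSeries.X ^ k * M' i j)
        rw [map_add, PowerSeries.coeff_X_pow_mul', Matrix.one_apply]
        by_cases hl : l < k
        · have h1 := congrFun (congrFun (hlt l hl).choose_spec i) j
          change PowerSeries.coeff l (M i j) = _ * (1 : Matrix ι ι ℂ) i j at h1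
          rw [Matrix.one_apply] at h1
          rw [h1, if_neg (show ¬k ≤ l by omega), add_zero, hF]
          split_ifs <;> simp [hf, hc, hl]
        · rw [if_pos (show k ≤ l by omega)]
          have h2 : PowerSeries.coeff l (F * if i = j then 1 else 0) = 0 := by
            rw [mul_ite, mul_one, mul_zero]
            split_ifs <;> simp [hF, hf, hc, hl]
          rw [h2, zero_add, hM', mkMat, Matrix.of_apply, PowerSeries.coeff_mk,
            show l - k + k = l by omega]
          rfl
      have hX : (PowerSeries.X ^ k : PowerSeries ℂ) ≠ 0 := pow_ne_zero _ PowerSeries.X_ne_zero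
      have hGM' : G * M' = M'ᴴ * G := by
        have h1 := hGM
        rw [hMM, Matrix.conjTranspose_add, Matrix.conjTranspose_smul, Matrix.conjTranspose_smul,
          Matrix.conjTranspose_one, hF, PowerSeries.star_map_ofReal, PowerSeries.star_X_pow,
          Matrix.mul_add, Matrix.add_mul, Matrix.mul_smul, Matrix.smul_mul, Matrix.mul_one,
          Matrix.one_mul, add_right_inj, Matrix.mul_smul, Matrix.smul_mul] at h1
        ext1 i j
        exact mul_left_cancel₀ hX (congrFun (congrFun h1 i) j)
      -- Because G has leading term 1, self-adjointness for G is ordinary self-adjointness at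
      -- leading order.
      have hA : (coeffMat 0 M').IsHermitian := by
        have h1 := congrArg (coeffMat 0) hGM'
        rw [coeffMat_zero_mul, coeffMat_zero_mul, h0, Matrix.one_mul, Matrix.mul_one,
          coeffMat_conjTranspose] at h1
        exact h1.symm
      have hA0 : coeffMat 0 M' = coeffMat k M := by rw [hM', coeffMat_mkMat, zero_add]
      -- A block of full size would make the leading coefficient of M' the real scalar a, against
      -- the choice of k; hence the induction hypothesis applies to every block.
      have hsub : ∀ a : ℝ, Fintype.card {i // hA.eigenvalues i = a} < m := by
        intro a
        rw [← hcard]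
        by_contra hle
        have hall : ∀ i, hA.eigenvalues i = a := fun i => by
          by_contra hi
          exact hle (Fintype.card_subtype_lt hi)
        refine hk a ?_
        rw [← hA0]
        refine Matrix.toLin'.injective (LinearMap.ext fun v => ?_)
        obtain ⟨s, e, hv⟩ : ∃ (s : ι → ℂ) (e : ι → ℂ),
            v = ∑ i, e i • ⇑(hA.eigenvectorBasis i) := by
          have h := congrArg WithLp.ofLp (hA.eigenvectorBasis.sum_repr (WithLp.toLp 2 v))
          rw [WithLp.ofLp_sum] at h
          exact ⟨0, _, h.symm⟩
        rw [hv, map_sum, map_sum]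
        refine Finset.sum_congr rfl fun i _ => ?_
        rw [map_smul, map_smul, Matrix.toLin'_apply, Matrix.toLin'_apply,
          hA.mulVec_eigenvectorBasis, hall, Matrix.smul_mulVec, Matrix.one_mulVec]
        rfl
      choose h P hP hMP hh using fun a : ℝ => exists_eigenvectors_block hG h0 hGM' hA a
        (fun G' M' => ih _ (hsub a) rfl G' M')
      obtain ⟨f', Z, hZ, hMZ⟩ := hasOrthonormalEigenbasis_of_blocks hGM' hA.eigenvalues h P hP hMP hh
      refine ⟨fun i => f + PowerSeries.X ^ k * f' i, Z, hZ, ?_⟩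
      conv_lhs => rw [hMM]
      rw [Matrix.add_mul, Matrix.smul_mul, Matrix.smul_mul, Matrix.one_mul, hMZ]
      ext1 i j
      rw [Matrix.add_apply, Matrix.smul_apply, Matrix.smul_apply, Matrix.mul_diagonal,
        Matrix.mul_diagonal, map_add, map_mul, map_pow, PowerSeries.map_X, smul_eq_mul, smul_eq_mul]
      ring

end Rellich

/-! ## The Gaussian integral of polynomials -/

section Gaussian

variable {n r : ℕ}

/-- The value of a polynomial at a real point. -/
noncomputable abbrev evalReal (y : Fin n → ℝ) : MvPolynomial (Fin n) ℂ →+* ℂ :=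
  MvPolynomial.eval fun i => (y i : ℂ)

theorem continuous_evalReal (q : MvPolynomial (Fin n) ℂ) : Continuous fun y => evalReal y q := by
  induction q using MvPolynomial.induction_on with
  | C a => simpa [evalReal] using continuous_const
  | add p q hp hq =>
    simp only [map_add]
    exact Continuous.add hp hq
  | mul_X p i hp =>
    have h : Continuous fun y : Fin n → ℝ => (y i : ℂ) :=
      Complex.continuous_ofReal.comp (continuous_apply i)
    simp only [map_mul, MvPolynomial.eval_X]
    exact Continuous.mul hp h

theorem evalReal_map_conj (q : MvPolynomial (Fin n) ℂ) (y : Fin n → ℝ) :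
    evalReal y (MvPolynomial.map (starRingEnd ℂ) q) = starRingEnd ℂ (evalReal y q) := by
  induction q using MvPolynomial.induction_on with
  | C a => simp [evalReal]
  | add p q hp hq => rw [map_add, map_add, hp, hq, map_add, map_add]
  | mul_X p i hp =>
    rw [map_mul, map_mul, hp, map_mul, map_mul, MvPolynomial.map_X]
    simp [evalReal]

theorem hasLineDerivAt_evalReal (q : MvPolynomial (Fin n) ℂ) (y : Fin n → ℝ) (j : Fin n) :
    HasLineDerivAt ℝ (fun y => evalReal y q) (evalReal y (MvPolynomial.pderiv j q)) y
      (Pi.single j 1) := by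
  induction q using MvPolynomial.induction_on with
  | C a =>
    simp only [evalReal, MvPolynomial.eval_C, MvPolynomial.pderiv_C, map_zero]
    exact hasDerivAt_const _ _
  | add p q hp hq =>
    simp only [map_add]
    exact HasDerivAt.add hp hq
  | mul_X p i hp =>
    have h : HasLineDerivAt ℝ (fun y : Fin n → ℝ => evalReal y (MvPolynomial.X i))
        (evalReal y (MvPolynomial.pderiv j (MvPolynomial.X i))) y (Pi.single j 1) := by
      have h1 : HasDerivAt (fun t : ℝ => (((y + t • (Pi.single j 1 : Fin n → ℝ)) i : ℝ) : ℂ))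
          (((Pi.single j 1 : Fin n → ℝ) i : ℝ) : ℂ) 0 := by
        refine HasDerivAt.ofReal_comp ?_
        simpa using ((hasDerivAt_id (0 : ℝ)).mul_const ((Pi.single j 1 : Fin n → ℝ) i)).const_add
          (y i)
      have h2 : evalReal y (MvPolynomial.pderiv j (MvPolynomial.X i)) =
          (((Pi.single j 1 : Fin n → ℝ) i : ℝ) : ℂ) := by
        rw [MvPolynomial.pderiv_X, Pi.single_apply, Pi.single_apply]
        by_cases hij : i = j
        · simp [hij]
        · simp [hij]
      rw [h2]
      simpa [HasLineDerivAt, evalReal] using h1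
    have h3 := HasDerivAt.mul hp h
    simp only [zero_smul, add_zero] at h3
    rw [MvPolynomial.pderiv_mul, map_add, map_mul, map_mul]
    simp only [map_mul]
    exact h3

variable (D : LocalData n r)

/-- The Gaussian weight `e^{-⟨y, Λ y⟩}`. -/
noncomputable def LocalData.weight (y : Fin n → ℝ) : ℂ := (Real.exp (-∑ i, D.lam i * y i ^ 2) : ℂ)

theorem hasLineDerivAt_weight (y : Fin n → ℝ) (j : Fin n) :
    HasLineDerivAt ℝ D.weight (-(2 * D.lam j * y j) * D.weight y) y (Pi.single j 1) := by
  have h1 : HasDerivAt (fun t : ℝ => -∑ i, D.lam i * (y + t • (Pi.single j 1 : Fin n → ℝ)) i ^ 2)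
      (-(2 * D.lam j * y j)) 0 := by
    have h2 : ∀ i, HasDerivAt (fun t : ℝ => D.lam i * (y + t • (Pi.single j 1 : Fin n → ℝ)) i ^ 2)
        (D.lam i * (2 * y i * (Pi.single j 1 : Fin n → ℝ) i)) 0 := fun i => by
      have h3 := (((hasDerivAt_id (0 : ℝ)).mul_const ((Pi.single j 1 : Fin n → ℝ) i)).const_add
          (y i)).pow 2
      simpa using h3.const_mul (D.lam i)
    have h4 := (HasDerivAt.fun_sum (u := Finset.univ) fun i _ => h2 i).neg
    refine HasDerivAt.congr_deriv h4 ?_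
    rw [Finset.sum_eq_single j (fun i _ hi => by simp [hi]) (by simp), Pi.single_eq_same]
    ring
  refine HasDerivAt.congr_deriv h1.exp.ofReal_comp ?_
  rw [LocalData.weight]
  simp only [zero_smul, add_zero]
  push_cast
  ring

theorem gaussInt_apply (q : MvPolynomial (Fin n) ℂ) :
    D.gaussInt q = ∫ y : Fin n → ℝ, evalReal y q * D.weight y := rfl

theorem integrable_pow_mul_exp {b : ℝ} (hb : 0 < b) (k : ℕ) :
    Integrable fun x : ℝ => ((x ^ k * Real.exp (-b * x ^ 2) : ℝ) : ℂ) := by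
  have := integrable_rpow_mul_exp_neg_mul_sq hb (s := (k : ℝ))
    (by have : (0 : ℝ) ≤ k := Nat.cast_nonneg k
        linarith)
  simp only [Real.rpow_natCast] at this
  exact this.ofReal

variable {D}

/-- For a monomial the integrand is a product of one-dimensional Gaussian moments, each integrable
since λ_i > 0. -/
theorem integrable_evalReal (hD : D.IsRegular) (q : MvPolynomial (Fin n) ℂ) :
    Integrable fun y : Fin n → ℝ => evalReal y q * D.weight y := by
  induction q using MvPolynomial.induction_on' with
  | monomial α c =>
    have h := (Integrable.fintype_prod (μ := fun _ : Fin n => (volume : Measure ℝ))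
      (f := fun i (x : ℝ) => ((x ^ α i * Real.exp (-D.lam i * x ^ 2) : ℝ) : ℂ))
      fun i => integrable_pow_mul_exp (hD.lam_pos i) (α i)).const_mul c
    refine h.congr (Filter.Eventually.of_forall fun y => ?_)
    simp only [evalReal, LocalData.weight, MvPolynomial.eval_monomial]
    rw [Finsupp.prod_fintype _ _ (by simp), mul_assoc, ← Finset.sum_neg_distrib, Real.exp_sum]
    push_cast
    rw [← Finset.prod_mul_distrib]
    simp only [neg_mul]
  | add p q hp hq =>
    simp only [map_add, add_mul]
    exact hp.add hq

theorem gaussInt_add (hD : D.IsRegular) (p q : MvPolynomial (Fin n) ℂ) :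
    D.gaussInt (p + q) = D.gaussInt p + D.gaussInt q := by
  simp only [gaussInt_apply, map_add, add_mul]
  exact integral_add (integrable_evalReal hD p) (integrable_evalReal hD q)

theorem gaussInt_C_mul (c : ℂ) (q : MvPolynomial (Fin n) ℂ) :
    D.gaussInt (MvPolynomial.C c * q) = c * D.gaussInt q := by
  simp only [gaussInt_apply, map_mul, MvPolynomial.eval_C, mul_assoc]
  exact integral_const_mul _ _

/-- The Gaussian integral as a linear form. -/
noncomputable def gaussLin (hD : D.IsRegular) : MvPolynomial (Fin n) ℂ →ₗ[ℂ] ℂ where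
  toFun := D.gaussInt
  map_add' := gaussInt_add hD
  map_smul' c q := by
    rw [MvPolynomial.smul_eq_C_mul, gaussInt_C_mul]
    rfl

theorem gaussLin_apply (hD : D.IsRegular) (q : MvPolynomial (Fin n) ℂ) :
    gaussLin hD q = D.gaussInt q := rfl

theorem gaussInt_conj (q : MvPolynomial (Fin n) ℂ) :
    D.gaussInt (MvPolynomial.map (starRingEnd ℂ) q) = starRingEnd ℂ (D.gaussInt q) := by
  rw [gaussInt_apply, gaussInt_apply, ← integral_conj]
  refine integral_congr_ae (Filter.Eventually.of_forall fun y => ?_)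
  simp only
  rw [evalReal_map_conj, map_mul]
  congr 1
  exact (Complex.conj_ofReal _).symm

/-- Integration by parts against the Gaussian weight. -/
theorem gaussInt_pderiv (hD : D.IsRegular) (q : MvPolynomial (Fin n) ℂ) (j : Fin n) :
    D.gaussInt (MvPolynomial.pderiv j q) =
      D.gaussInt (MvPolynomial.C (2 * D.lam j : ℂ) * MvPolynomial.X j * q) := by
  have hder : ∀ y : Fin n → ℝ, HasLineDerivAt ℝ (fun y => evalReal y q * D.weight y)
      (evalReal y (MvPolynomial.pderiv j q - MvPolynomial.C (2 * D.lam j : ℂ) * MvPolynomial.X j * q)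
        * D.weight y) y (Pi.single j 1) := fun y => by
    have h := HasDerivAt.mul (hasLineDerivAt_evalReal q y j) (hasLineDerivAt_weight D y j)
    simp only [zero_smul, add_zero] at h
    refine HasDerivAt.congr_deriv h ?_
    rw [map_sub, map_mul, map_mul, MvPolynomial.eval_C, MvPolynomial.eval_X]
    ring
  have hi := integrable_evalReal hD
    (MvPolynomial.pderiv j q - MvPolynomial.C (2 * D.lam j : ℂ) * MvPolynomial.X j * q)
  -- Integration by parts against the constant function 1 says that the integral of a total
  -- derivative vanishes.
  have h := integral_bilinear_hasLineDerivAt_right_eq_neg_left_of_integrable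
    (μ := (volume : Measure (Fin n → ℝ))) (B := ContinuousLinearMap.mul ℝ ℂ)
    (f := fun _ => (1 : ℂ)) (f' := fun _ => (0 : ℂ)) (v := Pi.single j 1)
    (by simp)
    (by simpa only [ContinuousLinearMap.mul_apply', one_mul] using hi)
    (by simpa only [ContinuousLinearMap.mul_apply', one_mul] using integrable_evalReal hD q)
    (fun y _ => hasDerivAt_const _ _) (fun y _ => hder y)
  simp only [ContinuousLinearMap.mul_apply', one_mul, zero_mul, integral_zero, neg_zero] at h
  rw [← gaussInt_apply] at h
  rw [← sub_eq_zero, ← gaussLin_apply hD, ← gaussLin_apply hD, ← map_sub]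
  exact h

theorem evalReal_conj_mul_self (q : MvPolynomial (Fin n) ℂ) (y : Fin n → ℝ) :
    evalReal y (MvPolynomial.map (starRingEnd ℂ) q * q) * D.weight y =
      ((‖evalReal y q‖ ^ 2 * Real.exp (-∑ i, D.lam i * y i ^ 2) : ℝ) : ℂ) := by
  rw [map_mul, evalReal_map_conj, Complex.conj_mul', LocalData.weight]
  push_cast
  rfl

theorem gaussInt_conj_mul_self (q : MvPolynomial (Fin n) ℂ) :
    D.gaussInt (MvPolynomial.map (starRingEnd ℂ) q * q) =
      ((∫ y : Fin n → ℝ, ‖evalReal y q‖ ^ 2 * Real.exp (-∑ i, D.lam i * y i ^ 2) : ℝ) : ℂ) := by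
  rw [gaussInt_apply]
  simp only [evalReal_conj_mul_self]
  exact integral_ofReal

theorem gaussInt_conj_mul_self_nonneg (q : MvPolynomial (Fin n) ℂ) :
    0 ≤ (D.gaussInt (MvPolynomial.map (starRingEnd ℂ) q * q)).re := by
  rw [gaussInt_conj_mul_self, Complex.ofReal_re]
  exact integral_nonneg fun y => by positivity

/-- The integrand is continuous and nonnegative, so it vanishes identically. A polynomial vanishing
at all real points is zero, because the reals are infinite. -/
theorem eq_zero_of_gaussInt_conj_mul_self (hD : D.IsRegular) {q : MvPolynomial (Fin n) ℂ}
    (h : (D.gaussInt (MvPolynomial.map (starRingEnd ℂ) q * q)).re = 0) : q = 0 := by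
  rw [gaussInt_conj_mul_self, Complex.ofReal_re, integral_eq_zero_iff_of_nonneg] at h
  · have hc : Continuous fun y : Fin n → ℝ => ‖evalReal y q‖ ^ 2 *
        Real.exp (-∑ i, D.lam i * y i ^ 2) := by
      have := continuous_evalReal q
      fun_prop
    have h1 := (hc.ae_eq_iff_eq volume continuous_const).1 h
    refine MvPolynomial.funext_set (fun _ : Fin n => Set.range ((↑) : ℝ → ℂ)) (fun _ =>
      Set.infinite_range_of_injective Complex.ofReal_injective) fun x hx => ?_
    choose y hy using fun i => hx i (Set.mem_univ i)
    have h2 := congrFun h1 y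
    have h3 : ‖evalReal y q‖ ^ 2 = 0 := (mul_eq_zero.1 h2).resolve_right (Real.exp_pos _).ne'
    have h4 : evalReal y q = 0 := norm_eq_zero.1 (pow_eq_zero_iff two_ne_zero |>.1 h3)
    rw [map_zero, ← h4]
    congr 1
    simp [evalReal, funext hy]
  · exact fun y => by positivity
  · have h2 := (integrable_evalReal hD (MvPolynomial.map (starRingEnd ℂ) q * q)).re
    refine h2.congr (Filter.Eventually.of_forall fun y => ?_)
    simp only [evalReal_conj_mul_self]
    exact Complex.ofReal_re _

end Gaussian

/-! ## The functional defining the hermitian form -/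

section Functional

variable {n r : ℕ}

theorem HahnSeries.coeff_mul_eq_zero_of_lt {R : Type*} [Ring R] {x y : HahnSeries ℤ R} {a b : ℤ}
    (ha : ∀ i, i < a → x.coeff i = 0) (hb : ∀ i, i < b → y.coeff i = 0) {k : ℤ} (hk : k < a + b) :
    (x * y).coeff k = 0 := by
  rw [HahnSeries.coeff_mul_Icc x y ha hb, Finset.Icc_eq_empty (by omega), Finset.sum_empty]

theorem HahnSeries.coeff_mul_zero_of_nonneg {R : Type*} [Ring R] {x y : HahnSeries ℤ R}
    (ha : ∀ i, i < 0 → x.coeff i = 0) (hb : ∀ i, i < 0 → y.coeff i = 0) :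
    (x * y).coeff 0 = x.coeff 0 * y.coeff 0 := by
  rw [HahnSeries.coeff_mul_Icc x y ha hb, sub_zero, Finset.Icc_self, Finset.sum_singleton, sub_zero]

/-- Complex conjugation of the coefficients, on `ℂ[y]((t))`. -/
noncomputable def conjL (F : Lau n) : Lau n := F.map (MvPolynomial.map (starRingEnd ℂ))

theorem coeff_conjL (F : Lau n) (k : ℤ) :
    (conjL F).coeff k = MvPolynomial.map (starRingEnd ℂ) (F.coeff k) := rfl

theorem conjL_add (F G : Lau n) : conjL (F + G) = conjL F + conjL G := by
  ext k : 2
  simp [coeff_conjL]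

theorem conjL_neg (F : Lau n) : conjL (-F) = -conjL F := by
  ext k : 2
  simp [coeff_conjL]

theorem conjL_sub (F G : Lau n) : conjL (F - G) = conjL F - conjL G := by
  ext k : 2
  simp [coeff_conjL]

theorem conjL_sum {ι : Type*} (s : Finset ι) (F : ι → Lau n) :
    conjL (∑ i ∈ s, F i) = ∑ i ∈ s, conjL (F i) := by
  ext k : 2
  simp [coeff_conjL, HahnSeries.coeff_sum, map_sum]

theorem conjL_mul (F G : Lau n) : conjL (F * G) = conjL F * conjL G := by
  obtain ⟨a, ha⟩ := HahnSeries.exists_lower F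
  obtain ⟨b, hb⟩ := HahnSeries.exists_lower G
  ext k : 2
  rw [HahnSeries.coeff_mul_Icc (conjL F) (conjL G) (a := a) (b := b)
    (fun i hi => by rw [coeff_conjL, ha i hi, map_zero])
    (fun i hi => by rw [coeff_conjL, hb i hi, map_zero]), coeff_conjL,
    HahnSeries.coeff_mul_Icc F G ha hb, map_sum]
  exact Finset.sum_congr rfl fun i _ => map_mul _ _ _

theorem conjL_tmon (k : ℤ) : conjL (tmon n k) = tmon n k := by
  ext i : 2
  rw [coeff_conjL, tmon, HahnSeries.coeff_single]
  split_ifs <;> simp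

theorem conjL_rho (f : MvPowerSeries (Fin n) ℂ) :
    conjL (rho n f) = rho n (MvPowerSeries.map (starRingEnd ℂ) f) := by
  ext k α
  rw [coeff_conjL, MvPolynomial.coeff_map, coeff_rho, coeff_rho, MvPowerSeries.coeff_map]
  split_ifs <;> simp

theorem conjL_dX (j : Fin n) (F : Lau n) : conjL (dX j F) = dX j (conjL F) := by
  ext k : 2
  rw [coeff_conjL, coeff_dX, coeff_dX, coeff_conjL, MvPolynomial.pderiv_map]

theorem conjL_conjL (F : Lau n) : conjL (conjL F) = F := by
  ext k α
  rw [coeff_conjL, MvPolynomial.coeff_map, coeff_conjL, MvPolynomial.coeff_map, Complex.conj_conj]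

/-- Complex conjugation of the coefficients, on `ℂ((t))`. -/
noncomputable def conjS (s : Scal) : Scal := s.map (starRingEnd ℂ)

theorem coeff_conjS (s : Scal) (k : ℤ) : (conjS s).coeff k = starRingEnd ℂ (s.coeff k) := rfl

/-- Every power series in `t` vanishes below `0`. -/
theorem coeff_ofPowerSeries_neg {R : Type*} [CommRing R] (f : PowerSeries R) {k : ℤ} (hk : k < 0) :
    (HahnSeries.ofPowerSeries ℤ R f).coeff k = 0 := by
  rw [coeff_ofPowerSeries_int, if_neg (by omega)]

variable (D : LocalData n r)

/-- The coefficientwise Gaussian integral. -/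
noncomputable def LocalData.gaussL (F : Lau n) : Scal := F.map D.gaussInt

theorem coeff_gaussL (F : Lau n) (k : ℤ) : (D.gaussL F).coeff k = D.gaussInt (F.coeff k) := rfl

theorem gaussL_embC_mul (hD : D.IsRegular) (s : Scal) (F : Lau n) :
    D.gaussL (embC n s * F) = s * D.gaussL F := by
  obtain ⟨a, ha⟩ := HahnSeries.exists_lower s
  obtain ⟨b, hb⟩ := HahnSeries.exists_lower F
  ext k
  rw [HahnSeries.coeff_mul_Icc s _ (b := b) ha (fun i hi => by
    rw [coeff_gaussL, hb i hi, ← gaussLin_apply hD, map_zero]), coeff_gaussL,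
    HahnSeries.coeff_mul_Icc _ F (a := a) (fun i hi => by rw [coeff_embC, ha i hi, map_zero]) hb,
    ← gaussLin_apply hD, map_sum]
  refine Finset.sum_congr rfl fun i _ => ?_
  rw [coeff_embC, gaussLin_apply, gaussInt_C_mul, coeff_gaussL]

theorem gaussL_add (hD : D.IsRegular) (F G : Lau n) :
    D.gaussL (F + G) = D.gaussL F + D.gaussL G := by
  ext k
  exact gaussInt_add hD _ _

theorem gaussL_zero : D.gaussL (0 : Lau n) = 0 := by
  ext k
  exact D.gaussInt.map_zero

theorem gaussL_conjL (F : Lau n) : D.gaussL (conjL F) = conjS (D.gaussL F) := by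
  ext k
  exact gaussInt_conj _

theorem gaussL_sum (hD : D.IsRegular) {ι : Type*} (s : Finset ι) (F : ι → Lau n) :
    D.gaussL (∑ i ∈ s, F i) = ∑ i ∈ s, D.gaussL (F i) := by
  classical
  induction s using Finset.induction_on with
  | empty => simp [gaussL_zero]
  | insert a s ha ih => rw [Finset.sum_insert ha, Finset.sum_insert ha, gaussL_add D hD, ih]

/-! ### The exponential -/

theorem coeff_pow_eq_zero_of_lt {f : PowerSeries (MvPolynomial (Fin n) ℂ)}
    (hf : PowerSeries.constantCoeff f = 0) {k m : ℕ} (hk : k < m) :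
    PowerSeries.coeff k (f ^ m) = 0 := by
  refine PowerSeries.coeff_of_lt_order _ ?_
  have h1 : (1 : ℕ∞) ≤ f.order := by
    rw [PowerSeries.one_le_order_iff_constCoeff_eq_zero]
    exact hf
  calc (k : ℕ∞) < m := by exact_mod_cast hk
    _ ≤ m • f.order := by simpa using nsmul_le_nsmul_right h1 m
    _ ≤ (f ^ m).order := PowerSeries.le_order_pow _ _

/-- The partial sums of the exponential series. -/
noncomputable def expPartial (x : Lau n) (K : ℕ) : Lau n :=
  ∑ m ∈ Finset.range (K + 1), embC n (HahnSeries.C ((m.factorial : ℂ)⁻¹)) * x ^ m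

theorem coeff_embC_C_mul (c : ℂ) (F : Lau n) (k : ℤ) :
    (embC n (HahnSeries.C c) * F).coeff k = MvPolynomial.C c * F.coeff k := by
  have : embC n (HahnSeries.C c) = HahnSeries.single 0 (MvPolynomial.C c) := by
    ext i : 2
    rw [coeff_embC, HahnSeries.C_apply, HahnSeries.coeff_single, HahnSeries.coeff_single]
    split_ifs <;> simp
  rw [this, HahnSeries.coeff_single_mul_int, sub_zero]

/-- Since f has no constant term, f^m begins at order t^m, and truncating the exponential at m = K
is exact up to t^K. -/
theorem coeff_expSer_sub_expPartial {f : PowerSeries (MvPolynomial (Fin n) ℂ)}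
    (hf : PowerSeries.constantCoeff f = 0) (K : ℕ) {k : ℤ} (hk : k ≤ K) :
    (HahnSeries.ofPowerSeries ℤ _ (expSer f) -
      expPartial (HahnSeries.ofPowerSeries ℤ _ f) K).coeff k = 0 := by
  rw [HahnSeries.coeff_sub, expPartial, HahnSeries.coeff_sum]
  simp only [coeff_embC_C_mul, ← map_pow]
  by_cases h0 : k < 0
  · simp only [coeff_ofPowerSeries_neg _ h0, mul_zero, Finset.sum_const_zero, sub_zero]
  · obtain ⟨m, rfl⟩ := Int.eq_ofNat_of_zero_le (not_lt.1 h0)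
    simp only [coeff_ofPowerSeries_int, if_pos (not_lt.1 h0), Int.toNat_natCast]
    rw [expSer, PowerSeries.coeff_mk, sub_eq_zero]
    simp only [MvPolynomial.smul_eq_C_mul]
    refine Finset.sum_subset (Finset.range_mono (by omega)) fun l _ hl => ?_
    rw [Finset.mem_range, not_lt] at hl
    rw [coeff_pow_eq_zero_of_lt hf (by omega), mul_zero]

theorem dX_pow (j : Fin n) (x : Lau n) (m : ℕ) :
    dX j (x ^ (m + 1)) = ((m + 1 : ℕ) : Lau n) * (x ^ m * dX j x) := by
  induction m with
  | zero => simp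
  | succ m ih =>
    rw [pow_succ, dX_mul, ih]
    push_cast
    ring

theorem dX_embC (j : Fin n) (s : Scal) : dX j (embC n s) = 0 := by
  ext k : 2
  rw [coeff_dX, coeff_embC, MvPolynomial.pderiv_C]
  rfl

theorem dX_expPartial (j : Fin n) (x : Lau n) (K : ℕ) :
    dX j (expPartial x (K + 1)) = expPartial x K * dX j x := by
  rw [expPartial, Finset.sum_range_succ', dX_add, dX_sum, expPartial, Finset.sum_mul, pow_zero,
    mul_one, dX_embC, add_zero]
  refine Finset.sum_congr rfl fun m _ => ?_
  rw [dX_mul, dX_embC, mul_zero, add_zero, dX_pow]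
  have h : embC n (HahnSeries.C (((m + 1).factorial : ℂ)⁻¹)) * ((m + 1 : ℕ) : Lau n) =
      embC n (HahnSeries.C ((m.factorial : ℂ)⁻¹)) := by
    rw [← map_natCast (HahnSeries.C (Γ := ℤ) (R := MvPolynomial (Fin n) ℂ))]
    ext k : 2
    have e : (HahnSeries.C ((m + 1 : ℕ) : MvPolynomial (Fin n) ℂ) : Lau n) =
        embC n (HahnSeries.C ((m + 1 : ℕ) : ℂ)) := by
      ext i : 2
      rw [coeff_embC, HahnSeries.C_apply, HahnSeries.C_apply, HahnSeries.coeff_single,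
        HahnSeries.coeff_single]
      split_ifs <;> simp
    rw [e, coeff_embC_C_mul, coeff_embC, coeff_embC, ← map_mul]
    congr 1
    rw [HahnSeries.C_apply, HahnSeries.C_apply, HahnSeries.coeff_single, HahnSeries.coeff_single]
    split_ifs with hk
    · have h1 : (m.factorial : ℂ) ≠ 0 := Nat.cast_ne_zero.2 (Nat.factorial_ne_zero m)
      have h2 : ((m + 1 : ℕ) : ℂ) ≠ 0 := Nat.cast_ne_zero.2 (Nat.succ_ne_zero m)
      rw [Nat.factorial_succ]
      push_cast at h2 ⊢
      field_simp
    · rw [mul_zero]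
  rw [← mul_assoc, h, mul_assoc]

/-- Both sides are compared with partial sums, for which the identity holds with a drop of one in
the number of terms; each coefficient sees only finitely many terms. -/
theorem dX_expSer (j : Fin n) {f : PowerSeries (MvPolynomial (Fin n) ℂ)}
    (hf : PowerSeries.constantCoeff f = 0) :
    dX j (HahnSeries.ofPowerSeries ℤ _ (expSer f)) =
      HahnSeries.ofPowerSeries ℤ _ (expSer f) * dX j (HahnSeries.ofPowerSeries ℤ _ f) := by
  set x : Lau n := HahnSeries.ofPowerSeries ℤ _ f with hx
  set e : Lau n := HahnSeries.ofPowerSeries ℤ _ (expSer f) with he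
  have hx0 : ∀ k, k < 0 → (dX j x).coeff k = 0 := fun k hk => by
    rw [coeff_dX, hx, coeff_ofPowerSeries_int]
    split_ifs with h
    · rw [show (k + 1).toNat = 0 by omega, PowerSeries.coeff_zero_eq_constantCoeff_apply, hf,
        map_zero]
    · rw [map_zero]
  ext k : 2
  -- `dX` reads the coefficient at k + 1, so this truncation is taken one order later than the one
  -- multiplied by `dX j x`.
  have h1 : (dX j (e - expPartial x (k.toNat + 1))).coeff k = 0 := by
    rw [coeff_dX, coeff_expSer_sub_expPartial hf _ (by push_cast; omega), map_zero]
  have h2 : ((e - expPartial x k.toNat) * dX j x).coeff k = 0 :=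
    HahnSeries.coeff_mul_eq_zero_of_lt (a := k.toNat + 1) (b := 0)
      (fun i hi => coeff_expSer_sub_expPartial hf _ (by omega)) hx0 (by omega)
  rw [dX_sub, dX_expPartial, HahnSeries.coeff_sub] at h1
  rw [sub_mul, HahnSeries.coeff_sub] at h2
  exact (sub_eq_zero.1 h1).trans (sub_eq_zero.1 h2).symm

/-- The series `e^{-2 (φ/ħ - ½⟨y, Λ y⟩)}`. -/
noncomputable def LocalData.expL : Lau n :=
  HahnSeries.ofPowerSeries ℤ _ (expSer ((-2 : ℂ) • D.phaseRest))

theorem constantCoeff_phaseRest (c : ℂ) : PowerSeries.constantCoeff (c • D.phaseRest) = 0 := by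
  rw [← PowerSeries.coeff_zero_eq_constantCoeff_apply]
  simp [LocalData.phaseRest]

variable {D}

/-- The quadratic part of φ produces λ_j y_j at t⁻¹ and belongs to the Gaussian weight; the higher
order part is the gradient of `phaseRest` and belongs to the factor `expL`. -/
theorem tmon_mul_rho_dφ (hD : D.IsRegular) (j : Fin n) :
    tmon n (-2) * rho n (D.dφ j) = dX j (HahnSeries.ofPowerSeries ℤ _ D.phaseRest) +
      tmon n (-1) * HahnSeries.C (MvPolynomial.C (D.lam j : ℂ) * MvPolynomial.X j) := by
  ext k α
  rw [coeff_tmon_mul, HahnSeries.coeff_add, coeff_tmon_mul, HahnSeries.C_apply,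
    HahnSeries.coeff_single, coeff_dX, coeff_ofPowerSeries_int]
  by_cases hk : k = -1
  · subst hk
    rw [if_pos (by norm_num), if_pos (by norm_num), show (-1 : ℤ) - -2 = 1 by norm_num,
      coeff_rho_one fun i => hD.coeff_single_dφ i j]
    simp [LocalData.phaseRest]
  · rw [if_neg (show ¬k - -1 = 0 by omega), add_zero, coeff_rho]
    by_cases hk0 : 0 ≤ k + 1
    · rw [if_pos hk0, LocalData.phaseRest, PowerSeries.coeff_mk,
        if_neg (show ¬(k + 1).toNat = 0 by omega), MvPolynomial.coeff_pderiv, coeff_homPart, LocalData.dφ, MvPowerSeries.coeff_pderiv]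
      have : (α + Finsupp.single j 1 : Fin n →₀ ℕ).degree = α.degree + 1 := by simp
      rw [this]
      by_cases h : (α.degree : ℤ) = k - -2
      · rw [if_pos h, if_pos (by omega)]
      · rw [if_neg h, if_neg (by omega), zero_mul]
    · rw [if_neg hk0, map_zero, MvPolynomial.coeff_zero]
      split_ifs with h
      · have h0 : α = 0 := (Finsupp.degree_eq_zero_iff α).1 (by omega)
        subst h0
        exact hD.constantCoeff_dφ j
      · rfl

theorem dX_expL (j : Fin n) : dX j D.expL =
    D.expL * (embC n (HahnSeries.C (-2)) * dX j (HahnSeries.ofPowerSeries ℤ _ D.phaseRest)) := by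
  rw [LocalData.expL, dX_expSer j (constantCoeff_phaseRest D _)]
  congr 1
  ext k : 2
  rw [coeff_dX, coeff_embC_C_mul, coeff_dX, coeff_ofPowerSeries_int, coeff_ofPowerSeries_int]
  split_ifs
  · rw [PowerSeries.coeff_smul, Derivation.map_smul, MvPolynomial.smul_eq_C_mul]
  · simp

theorem embC_C_neg_two : embC n (HahnSeries.C (-2)) = -2 := by
  have h : (-2 : Lau n) = HahnSeries.C (-2 : MvPolynomial (Fin n) ℂ) := by
    rw [map_neg, map_ofNat]
  rw [h]
  ext k : 2
  rw [coeff_embC, HahnSeries.C_apply, HahnSeries.C_apply, HahnSeries.coeff_single,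
    HahnSeries.coeff_single]
  split_ifs
  · rw [map_neg, map_ofNat]
  · rw [map_zero]

/-- Integration by parts. -/
theorem gaussL_dX_sub (hD : D.IsRegular) (j : Fin n) (F : Lau n) :
    D.gaussL ((dX j F - 2 * (tmon n (-2) * (rho n (D.dφ j) * F))) * D.expL) = 0 := by
  -- Differentiating `expL` absorbs the contribution of `phaseRest` to -2 t⁻² ∂_jφ. What remains is
  -- the multiplication by -2 λ_j y_j t⁻¹, which `gaussInt_pderiv` balances against the derivative.
  have h1 : (dX j F - 2 * (tmon n (-2) * (rho n (D.dφ j) * F))) * D.expL =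
      dX j (F * D.expL) - 2 * (tmon n (-1) *
        (HahnSeries.C (MvPolynomial.C (D.lam j : ℂ) * MvPolynomial.X j) * (F * D.expL))) := by
    rw [← mul_assoc (tmon n (-2)), tmon_mul_rho_dφ hD, dX_mul, dX_expL, embC_C_neg_two]
    ring
  rw [h1]
  ext k
  rw [coeff_gaussL, two_mul, HahnSeries.coeff_sub, HahnSeries.coeff_add, coeff_dX, coeff_tmon_mul,
    HahnSeries.C_apply, HahnSeries.coeff_single_mul_int, sub_zero, sub_neg_eq_add,
    ← gaussLin_apply hD, map_sub, gaussLin_apply, gaussInt_pderiv hD, ← gaussLin_apply hD, ← map_sub]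
  have h2 : (MvPolynomial.C (2 * D.lam j : ℂ) : MvPolynomial (Fin n) ℂ) =
      2 * MvPolynomial.C (D.lam j : ℂ) := by
    rw [map_mul, map_ofNat]
  refine Eq.trans ?_ (map_zero (gaussLin hD))
  congr 1
  rw [h2]
  ring

end Functional

/-! ## The hermitian form and the symmetry of `Q` -/

section SymmetryIdentity

variable {n r : ℕ} (D : LocalData n r)

/-- The twisted divergence contains the logarithmic derivative of e^{-2φ/ħ}. Its two halves are
given to the factors P and v, whose derivatives thereby become `dConj`. -/
theorem dX_sub_mul_mul (j : Fin n) (f : MvPowerSeries (Fin n) ℂ) (P v : Lau n) :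
    dX j (rho n f * P * v) - 2 * (tmon n (-2) * (rho n (D.dφ j) * (rho n f * P * v))) =
      rho n (MvPowerSeries.pderiv ℂ j f) * P * v + rho n f * D.dConj j P * v
        + rho n f * P * D.dConj j v := by
  rw [dX_mul, dX_mul, dX_rho, LocalData.dConj, LocalData.dConj, LocalData.dφ]
  ring

/-- Green's identity. -/
theorem green_identity {p : Fin n → Fin n → MvPowerSeries (Fin n) ℂ}
    {β β' : Fin n → MvPowerSeries (Fin n) ℂ} {κ κ' : MvPowerSeries (Fin n) ℂ}
    (hp : ∀ i j, p i j = p j i)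
    (h1 : ∀ j, 2 * ∑ i, MvPowerSeries.pderiv ℂ i (p i j) + β j + β' j = 0)
    (h2 : ∑ i, ∑ j, MvPowerSeries.pderiv ℂ i (MvPowerSeries.pderiv ℂ j (p i j)) +
      ∑ j, MvPowerSeries.pderiv ℂ j (β j) = κ - κ') (P v : Lau n) :
    (-(∑ i, ∑ j, rho n (p i j) * D.dConj i (D.dConj j P) * v) + ∑ j, rho n (β j) * D.dConj j P * v
      + rho n κ * P * v) - (-(∑ i, ∑ j, rho n (p i j) * P * D.dConj i (D.dConj j v))
      + ∑ j, rho n (β' j) * P * D.dConj j v + rho n κ' * P * v) =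
    ∑ j, (dX j (-(∑ i, rho n (p i j) * D.dConj i P * v) + ∑ i, rho n (p i j) * P * D.dConj i v
        + rho n (β j + ∑ i, MvPowerSeries.pderiv ℂ i (p i j)) * P * v)
      - 2 * (tmon n (-2) * (rho n (D.dφ j) * (-(∑ i, rho n (p i j) * D.dConj i P * v)
        + ∑ i, rho n (p i j) * P * D.dConj i v
        + rho n (β j + ∑ i, MvPowerSeries.pderiv ℂ i (p i j)) * P * v)))) := by
  set q : Fin n → MvPowerSeries (Fin n) ℂ := fun j => ∑ i, MvPowerSeries.pderiv ℂ i (p i j) with hq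
  have hX : ∀ j, dX j (-(∑ i, rho n (p i j) * D.dConj i P * v)
        + ∑ i, rho n (p i j) * P * D.dConj i v + rho n (β j + q j) * P * v)
      - 2 * (tmon n (-2) * (rho n (D.dφ j) * (-(∑ i, rho n (p i j) * D.dConj i P * v)
        + ∑ i, rho n (p i j) * P * D.dConj i v + rho n (β j + q j) * P * v))) =
      -(∑ i, (rho n (MvPowerSeries.pderiv ℂ j (p i j)) * D.dConj i P * v
        + rho n (p i j) * D.dConj j (D.dConj i P) * v + rho n (p i j) * D.dConj i P * D.dConj j v))
      + ∑ i, (rho n (MvPowerSeries.pderiv ℂ j (p i j)) * P * D.dConj i v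
        + rho n (p i j) * D.dConj j P * D.dConj i v + rho n (p i j) * P * D.dConj j (D.dConj i v))
      + (rho n (MvPowerSeries.pderiv ℂ j (β j + q j)) * P * v + rho n (β j + q j) * D.dConj j P * v
        + rho n (β j + q j) * P * D.dConj j v) := fun j => by
    -- `A` is the twisted derivative; its additivity reduces the computation to single products.
    let A : Lau n → Lau n := fun F => dX j F - 2 * (tmon n (-2) * (rho n (D.dφ j) * F))
    have hadd : ∀ F G, A (F + G) = A F + A G := fun F G => by
      simp only [A, dX_add]
      ring
    have hneg : ∀ F, A (-F) = -A F := fun F => by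
      simp only [A, dX_neg]
      ring
    have hsum : ∀ F : Fin n → Lau n, A (∑ i, F i) = ∑ i, A (F i) := fun F => by
      simp only [A, dX_sum, Finset.mul_sum, Finset.sum_sub_distrib]
    change A _ = _
    rw [hadd, hadd, hneg, hsum, hsum]
    simp only [A, dX_sub_mul_mul]
  have ea : ∑ j, ∑ i, rho n (p i j) * D.dConj i P * D.dConj j v =
      ∑ j, ∑ i, rho n (p i j) * D.dConj j P * D.dConj i v := by
    rw [Finset.sum_comm]
    simp only [hp]
  have eb : ∑ j, ∑ i, rho n (p i j) * D.dConj j (D.dConj i P) * v =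
      ∑ i, ∑ j, rho n (p i j) * D.dConj i (D.dConj j P) * v :=
    Finset.sum_congr rfl fun i _ => Finset.sum_congr rfl fun j _ => by rw [hp]
  have eb' : ∑ j, ∑ i, rho n (p i j) * P * D.dConj j (D.dConj i v) =
      ∑ i, ∑ j, rho n (p i j) * P * D.dConj i (D.dConj j v) :=
    Finset.sum_congr rfl fun i _ => Finset.sum_congr rfl fun j _ => by rw [hp]
  have ec : ∑ j, ∑ i, rho n (MvPowerSeries.pderiv ℂ j (p i j)) * D.dConj i P * v =
      ∑ j, rho n (q j) * D.dConj j P * v := by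
    rw [Finset.sum_comm]
    refine Finset.sum_congr rfl fun i _ => ?_
    rw [hq, map_sum, Finset.sum_mul, Finset.sum_mul]
    exact Finset.sum_congr rfl fun j _ => by rw [hp]
  have ed : ∑ j, ∑ i, rho n (MvPowerSeries.pderiv ℂ j (p i j)) * P * D.dConj i v =
      ∑ j, rho n (q j) * P * D.dConj j v := by
    rw [Finset.sum_comm]
    refine Finset.sum_congr rfl fun i _ => ?_
    rw [hq, map_sum, Finset.sum_mul, Finset.sum_mul]
    exact Finset.sum_congr rfl fun j _ => by rw [hp]
  -- The first adjointness identity eliminates β'; the second is used below for the terms without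
  -- derivatives of P and v.
  have ee : ∑ j, rho n (β' j) * P * D.dConj j v =
      -(2 * ∑ j, rho n (q j) * P * D.dConj j v) - ∑ j, rho n (β j) * P * D.dConj j v := by
    rw [Finset.mul_sum, ← Finset.sum_neg_distrib, ← Finset.sum_sub_distrib]
    refine Finset.sum_congr rfl fun j _ => ?_
    have h3 : β' j = -(2 * q j) - β j := by
      have := h1 j
      linear_combination this
    rw [h3, map_sub, map_neg, map_mul, map_ofNat]
    ring
  have ef : ∑ j, rho n (MvPowerSeries.pderiv ℂ j (β j + q j)) * P * v =
      (rho n κ - rho n κ') * P * v := by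
    rw [← map_sub, ← h2, ← Finset.sum_mul, ← Finset.sum_mul, ← map_sum]
    congr 3
    simp only [map_add, Finset.sum_add_distrib, hq, map_sum]
    rw [add_comm]
    congr 1
    exact Finset.sum_congr rfl fun i _ => Finset.sum_congr rfl fun j _ => by rw [hp]
  rw [Finset.sum_congr rfl fun j _ => hX j]
  simp only [Finset.sum_add_distrib, Finset.sum_neg_distrib, map_add (rho n), add_mul]
  rw [ee]
  linear_combination ea + eb - eb' + ec - ed - ef

end SymmetryIdentity

/-! ### Algebraic properties and leading term of the hermitian form -/

section Form

variable {n r : ℕ} {D : LocalData n r}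

/-- The Taylor series of `γ[e_a, e_b] (det g_ij)^{1/2}`. -/
noncomputable def LocalData.gramSer (D : LocalData n r) (a b : Fin r) : MvPowerSeries (Fin n) ℂ :=
  taylorMat D.gram a b * taylor fun y => ((Real.sqrt (D.metric y).det : ℝ) : ℂ)

/-- The root of det g is moved into the Gram series and only the exponential is left as weight,
which is the shape required by the adjointness identities and by `gaussL_dX_sub`. -/
theorem form_eq (u v : S0 n r) : D.form u v =
    D.gaussL ((∑ a, ∑ b, conjL (comp u a) * rho n (D.gramSer a b) * comp v b) * D.expL) := by
  rw [LocalData.form, LocalData.gaussL]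
  congr 1
  simp only [Finset.sum_mul]
  refine Finset.sum_congr rfl fun a _ => Finset.sum_congr rfl fun b _ => ?_
  rw [LocalData.gramSer, map_mul (rho n), LocalData.omega, map_mul, map_mul]
  change conjL (comp u a) * (rho n _ * (D.expL * rho n _)) * comp v b = _
  ring

namespace LocalData.IsRegular

theorem contDiffAt_sqrt_det (hD : D.IsRegular) :
    ContDiffAt ℝ ∞ (fun y => ((Real.sqrt (D.metric y).det : ℝ) : ℂ)) 0 :=
  Complex.ofRealCLM.contDiff.contDiffAt.comp (0 : Vec n)
    ((ContDiffAt.matrix_det hD.metric_smooth).sqrt hD.det_ne_zero)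

theorem gramSer_eq (hD : D.IsRegular) (a b : Fin r) : D.gramSer a b =
    taylor fun y => D.gram y a b * ((Real.sqrt (D.metric y).det : ℝ) : ℂ) :=
  (taylor_mul (hD.gram_smooth a b) hD.contDiffAt_sqrt_det).symm

theorem contDiffAt_gram_sqrt (hD : D.IsRegular) (a b : Fin r) :
    ContDiffAt ℝ ∞ (fun y => D.gram y a b * ((Real.sqrt (D.metric y).det : ℝ) : ℂ)) 0 :=
  (hD.gram_smooth a b).mul hD.contDiffAt_sqrt_det

theorem map_conj_taylor_ofReal {f : Vec n → ℝ}
    (hf : ContDiffAt ℝ ∞ (fun y => (f y : ℂ)) 0) :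
    MvPowerSeries.map (starRingEnd ℂ) (taylor fun y => (f y : ℂ)) = taylor fun y => (f y : ℂ) := by
  rw [← taylor_conj hf]
  simp

theorem map_conj_gramSer (hD : D.IsRegular) (a b : Fin r) :
    MvPowerSeries.map (starRingEnd ℂ) (D.gramSer a b) = D.gramSer b a := by
  rw [hD.gramSer_eq, hD.gramSer_eq, ← taylor_conj (hD.contDiffAt_gram_sqrt a b)]
  refine taylor_congr ?_
  filter_upwards [hD.gram_herm] with y hy
  rw [map_mul, hy, Complex.conj_ofReal]

theorem map_conj_invSer (hD : D.IsRegular) (i j : Fin n) :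
    MvPowerSeries.map (starRingEnd ℂ) (D.invSer i j) = D.invSer i j :=
  map_conj_taylor_ofReal (hD.contDiffAt_inv i j)

theorem map_conj_φSer (hD : D.IsRegular) :
    MvPowerSeries.map (starRingEnd ℂ) D.φSer = D.φSer :=
  map_conj_taylor_ofReal hD.contDiffAt_φ

theorem map_conj_dφ (hD : D.IsRegular) (j : Fin n) :
    MvPowerSeries.map (starRingEnd ℂ) (D.dφ j) = D.dφ j := by
  rw [hD.dφ_eq]
  exact map_conj_taylor_ofReal (hD.contDiffAt_pd_φ j)

theorem contDiffAt_V (hD : D.IsRegular) : ContDiffAt ℝ ∞ (fun y => (D.V y : ℂ)) 0 :=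
  Complex.ofRealCLM.contDiff.contDiffAt.comp (0 : Vec n) hD.V_smooth

theorem conjL_dConj (hD : D.IsRegular) (j : Fin n) (F : Lau n) :
    conjL (D.dConj j F) = D.dConj j (conjL F) := by
  rw [LocalData.dConj, conjL_sub, conjL_dX, conjL_mul, conjL_mul, conjL_tmon, conjL_rho]
  change _ - _ * (rho n (MvPowerSeries.map (starRingEnd ℂ) (D.dφ j)) * _) = _
  rw [hD.map_conj_dφ]
  rfl

theorem conjL_expL (hD : D.IsRegular) : conjL D.expL = D.expL := by
  have h0 : PowerSeries.map (MvPolynomial.map (starRingEnd ℂ)) ((-2 : ℂ) • D.phaseRest) =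
      (-2 : ℂ) • D.phaseRest := by
    ext k α
    rw [PowerSeries.coeff_map, MvPolynomial.coeff_map, PowerSeries.coeff_smul,
      MvPolynomial.coeff_smul, smul_eq_mul, map_mul, map_neg, Complex.conj_ofNat,
      LocalData.phaseRest, PowerSeries.coeff_mk]
    split_ifs
    · simp
    · rw [coeff_homPart]
      split_ifs
      · rw [← MvPowerSeries.coeff_map, hD.map_conj_φSer]
      · rw [map_zero]
  ext k : 2
  rw [coeff_conjL, LocalData.expL, coeff_ofPowerSeries_int]
  split_ifs
  · rw [expSer, PowerSeries.coeff_mk, map_sum]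
    refine Finset.sum_congr rfl fun m _ => ?_
    rw [MvPolynomial.smul_eq_C_mul, map_mul, MvPolynomial.map_C, map_inv₀, map_natCast,
      ← PowerSeries.coeff_map, map_pow, h0]
  · rw [map_zero]

theorem invSer_symm (hD : D.IsRegular) (i j : Fin n) : D.invSer i j = D.invSer j i := by
  refine taylor_congr ?_
  filter_upwards [hD.metric_posDef] with y hy
  have h := hy.1.inv.apply i j
  simp only [star_trivial] at h
  rw [h]

end LocalData.IsRegular

theorem conjL_mul_rho_mul (hD : D.IsRegular) (P v : Lau n) (a b : Fin r) :
    conjL (conjL P * rho n (D.gramSer a b) * v) = conjL v * rho n (D.gramSer b a) * P := by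
  rw [conjL_mul, conjL_mul, conjL_conjL, conjL_rho, hD.map_conj_gramSer]
  ring

theorem form_conj_symm (hD : D.IsRegular) (u v : S0 n r) :
    conjS (D.form u v) = D.form v u := by
  rw [form_eq, form_eq, ← gaussL_conjL, conjL_mul, hD.conjL_expL, conjL_sum, Finset.sum_comm]
  congr 2
  rw [Finset.sum_comm]
  simp only [conjL_sum, conjL_mul_rho_mul hD]
  exact Finset.sum_comm

theorem form_smul_right (hD : D.IsRegular) (s : Scal) (u v : S0 n r) :
    D.form u (s • v) = s * D.form u v := by
  rw [form_eq, form_eq, ← gaussL_embC_mul D hD, ← mul_assoc, Finset.mul_sum]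
  congr 2
  refine Finset.sum_congr rfl fun a _ => ?_
  rw [Finset.mul_sum]
  refine Finset.sum_congr rfl fun b _ => ?_
  rw [comp_smul]
  ring

theorem form_add_right (hD : D.IsRegular) (u v w : S0 n r) :
    D.form u (v + w) = D.form u v + D.form u w := by
  rw [form_eq, form_eq, form_eq, ← gaussL_add D hD, ← add_mul, ← Finset.sum_add_distrib]
  congr 2
  refine Finset.sum_congr rfl fun a _ => ?_
  rw [← Finset.sum_add_distrib]
  refine Finset.sum_congr rfl fun b _ => ?_
  rw [comp_add]
  ring

theorem conjS_add (s t : Scal) : conjS (s + t) = conjS s + conjS t := by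
  ext k
  simp [coeff_conjS]

theorem conjS_mul (s t : Scal) : conjS (s * t) = conjS s * conjS t := by
  obtain ⟨a, ha⟩ := HahnSeries.exists_lower s
  obtain ⟨b, hb⟩ := HahnSeries.exists_lower t
  ext k
  rw [HahnSeries.coeff_mul_Icc (conjS s) (conjS t) (a := a) (b := b)
    (fun i hi => by rw [coeff_conjS, ha i hi, map_zero])
    (fun i hi => by rw [coeff_conjS, hb i hi, map_zero]), coeff_conjS,
    HahnSeries.coeff_mul_Icc s t ha hb, map_sum]
  exact Finset.sum_congr rfl fun i _ => map_mul _ _ _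

theorem form_smul_left (hD : D.IsRegular) (s : Scal) (u v : S0 n r) :
    D.form (s • u) v = conjS s * D.form u v := by
  rw [← form_conj_symm hD, form_smul_right hD, conjS_mul, form_conj_symm hD]

theorem form_add_left (hD : D.IsRegular) (u v w : S0 n r) :
    D.form (u + v) w = D.form u w + D.form v w := by
  rw [← form_conj_symm hD, form_add_right hD, conjS_add, form_conj_symm hD, form_conj_symm hD]

theorem form_sum_right (hD : D.IsRegular) {ι : Type*} (s : Finset ι) (u : S0 n r)
    (v : ι → S0 n r) : D.form u (∑ i ∈ s, v i) = ∑ i ∈ s, D.form u (v i) := by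
  classical
  have h0 : D.form u 0 = 0 := by
    have := form_smul_right hD 0 u 0
    rwa [smul_zero, zero_mul] at this
  induction s using Finset.induction_on with
  | empty => simp [h0]
  | insert a s ha ih => rw [Finset.sum_insert ha, Finset.sum_insert ha, form_add_right hD, ih]

theorem form_sum_left (hD : D.IsRegular) {ι : Type*} (s : Finset ι) (u : ι → S0 n r)
    (v : S0 n r) : D.form (∑ i ∈ s, u i) v = ∑ i ∈ s, D.form (u i) v := by
  classical
  have h0 : D.form 0 v = 0 := by
    have := form_smul_left hD 0 0 v
    rwa [smul_zero, show conjS (0 : Scal) = 0 by ext k; simp [coeff_conjS], zero_mul] at this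
  induction s using Finset.induction_on with
  | empty => simp [h0]
  | insert a s ha ih => rw [Finset.sum_insert ha, Finset.sum_insert ha, form_add_left hD, ih]

/-! ### Leading term of the form -/

theorem coeff_expL_zero : D.expL.coeff 0 = 1 := by
  rw [LocalData.expL, coeff_ofPowerSeries_int, if_pos le_rfl, expSer]
  simp

theorem coeff_expL_neg {k : ℤ} (hk : k < 0) : D.expL.coeff k = 0 :=
  coeff_ofPowerSeries_neg _ hk

theorem constantCoeff_gramSer (hD : D.IsRegular) (a b : Fin r) :
    MvPowerSeries.constantCoeff (D.gramSer a b) = if a = b then 1 else 0 := by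
  rw [hD.gramSer_eq, constantCoeff_taylor, hD.gram_zero, hD.metric_zero, Matrix.det_one,
    Real.sqrt_one, Complex.ofReal_one, mul_one, Matrix.one_apply]

theorem coeff_integrand_neg {u v : S0 n r} (hu : ∀ a, ∀ k < 0, (comp u a).coeff k = 0)
    (hv : ∀ a, ∀ k < 0, (comp v a).coeff k = 0) {k : ℤ} (hk : k < 0) :
    (∑ a, ∑ b, conjL (comp u a) * rho n (D.gramSer a b) * comp v b).coeff k = 0 := by
  simp only [HahnSeries.coeff_sum]
  refine Finset.sum_eq_zero fun a _ => Finset.sum_eq_zero fun b _ => ?_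
  refine HahnSeries.coeff_mul_eq_zero_of_lt (a := 0) (b := 0) (fun i hi => ?_) (hv b) (by omega)
  refine HahnSeries.coeff_mul_eq_zero_of_lt (a := 0) (b := 0) (fun i hi => ?_)
    (fun i hi => coeff_eq_zero_of_mem_lauFil (rho_mem_lauFil _) hi) (by omega)
  rw [coeff_conjL, hu a i hi, map_zero]

theorem coeff_form_neg {u v : S0 n r} (hu : ∀ a, ∀ k < 0, (comp u a).coeff k = 0)
    (hv : ∀ a, ∀ k < 0, (comp v a).coeff k = 0) {k : ℤ} (hk : k < 0) :
    (D.form u v).coeff k = 0 := by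
  rw [form_eq, coeff_gaussL, HahnSeries.coeff_mul_eq_zero_of_lt (a := 0) (b := 0)
    (fun i hi => coeff_integrand_neg hu hv hi) (fun i hi => coeff_expL_neg hi) (by omega)]
  exact D.gaussInt.map_zero

/-- At order t^0 only leading terms contribute: the Gram matrix and det g are 1 at the origin, and
the exponential of the higher order phase begins with 1. -/
theorem coeff_form_zero (hD : D.IsRegular) {u v : S0 n r}
    (hu : ∀ a, ∀ k < 0, (comp u a).coeff k = 0) (hv : ∀ a, ∀ k < 0, (comp v a).coeff k = 0) :
    (D.form u v).coeff 0 = ∑ a, D.gaussInt (MvPolynomial.map (starRingEnd ℂ) ((comp u a).coeff 0) *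
      (comp v a).coeff 0) := by
  have hc : ∀ a, ∀ k < 0, (conjL (comp u a)).coeff k = 0 := fun a k hk => by
    rw [coeff_conjL, hu a k hk, map_zero]
  have hr : ∀ a b : Fin r, (rho n (D.gramSer a b)).coeff 0 =
      MvPolynomial.C (if a = b then 1 else 0) := fun a b => by
    have h := rho_mul_coeff_zero (D.gramSer a b) (tmon_mem_lauFil (n := n) 0)
    rw [tmon_zero, mul_one, HahnSeries.coeff_one, if_pos rfl, mul_one,
      constantCoeff_gramSer hD] at h
    exact h
  rw [form_eq, coeff_gaussL, HahnSeries.coeff_mul_zero_of_nonneg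
    (fun i hi => coeff_integrand_neg hu hv hi) (fun i hi => coeff_expL_neg hi), coeff_expL_zero,
    mul_one, HahnSeries.coeff_sum, ← gaussLin_apply hD, map_sum]
  refine Finset.sum_congr rfl fun a _ => ?_
  rw [gaussLin_apply, HahnSeries.coeff_sum, Finset.sum_eq_single a]
  · rw [HahnSeries.coeff_mul_zero_of_nonneg ?_ (hv a), HahnSeries.coeff_mul_zero_of_nonneg (hc a)
      (fun i hi => coeff_eq_zero_of_mem_lauFil (rho_mem_lauFil _) hi), hr, if_pos rfl, map_one,
      mul_one, coeff_conjL]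
    exact fun i hi => HahnSeries.coeff_mul_eq_zero_of_lt (hc a)
      (fun i hi => coeff_eq_zero_of_mem_lauFil (rho_mem_lauFil _) hi) (by omega)
  · intro b _ hb
    rw [HahnSeries.coeff_mul_zero_of_nonneg ?_ (hv b), HahnSeries.coeff_mul_zero_of_nonneg (hc a)
      (fun i hi => coeff_eq_zero_of_mem_lauFil (rho_mem_lauFil _) hi), hr, if_neg (Ne.symm hb),
      map_zero, mul_zero, zero_mul]
    exact fun i hi => HahnSeries.coeff_mul_eq_zero_of_lt (hc a)
      (fun i hi => coeff_eq_zero_of_mem_lauFil (rho_mem_lauFil _) hi) (by omega)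
  · simp

end Form

/-! ## The symmetry of `Q` -/

section Symmetry

variable {n r : ℕ} {D : LocalData n r}

namespace LocalData.IsRegular

theorem contDiffAt_inv_gram (hD : D.IsRegular) (i j : Fin n) (a b : Fin r) :
    ContDiffAt ℝ ∞ (fun z => (((D.metric z)⁻¹ i j : ℝ) : ℂ) * (D.gram z a b *
      ((Real.sqrt (D.metric z).det : ℝ) : ℂ))) 0 :=
  (hD.contDiffAt_inv i j).mul (hD.contDiffAt_gram_sqrt a b)

theorem invSer_mul_gramSer (hD : D.IsRegular) (i j : Fin n) (a b : Fin r) :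
    D.invSer i j * D.gramSer a b = taylor fun z => (((D.metric z)⁻¹ i j : ℝ) : ℂ) *
      (D.gram z a b * ((Real.sqrt (D.metric z).det : ℝ) : ℂ)) := by
  rw [hD.gramSer_eq]
  exact (taylor_mul (hD.contDiffAt_inv i j) (hD.contDiffAt_gram_sqrt a b)).symm

/-- The Taylor series of `∑_k conj (A k a) γ_kb` for a matrix-valued function `A`. -/
theorem taylor_conj_mul_gram (hD : D.IsRegular) {A : Vec n → Matrix (Fin r) (Fin r) ℂ}
    (hA : ∀ k a, ContDiffAt ℝ ∞ (fun y => A y k a) 0) (a b : Fin r) :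
    (taylor fun y => ∑ k, starRingEnd ℂ (A y k a) * (D.gram y k b *
      ((Real.sqrt (D.metric y).det : ℝ) : ℂ))) =
      ∑ k, MvPowerSeries.map (starRingEnd ℂ) (taylorMat A k a) * D.gramSer k b := by
  have hc : ∀ k, ContDiffAt ℝ ∞ (fun y => starRingEnd ℂ (A y k a)) 0 := fun k =>
    Complex.conjCLE.contDiff.contDiffAt.comp (0 : Vec n) (hA k a)
  rw [taylor_sum _ fun k _ => (hc k).mul (hD.contDiffAt_gram_sqrt k b)]
  refine Finset.sum_congr rfl fun k _ => ?_
  rw [taylor_mul (hc k) (hD.contDiffAt_gram_sqrt k b), taylor_conj (hA k a), hD.gramSer_eq]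
  rfl

theorem taylor_gram_mul (hD : D.IsRegular) {A : Vec n → Matrix (Fin r) (Fin r) ℂ}
    (hA : ∀ k a, ContDiffAt ℝ ∞ (fun y => A y k a) 0) (a b : Fin r) :
    (taylor fun y => ∑ k, (D.gram y a k * ((Real.sqrt (D.metric y).det : ℝ) : ℂ)) * A y k b) =
      ∑ k, D.gramSer a k * taylorMat A k b := by
  rw [taylor_sum _ fun k _ => (hD.contDiffAt_gram_sqrt a k).mul (hA k b)]
  refine Finset.sum_congr rfl fun k _ => ?_
  rw [taylor_mul (hD.contDiffAt_gram_sqrt a k) (hA k b), hD.gramSer_eq]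
  rfl

theorem contDiffAt_conj_mul_gram (hD : D.IsRegular) {A : Vec n → Matrix (Fin r) (Fin r) ℂ}
    (hA : ∀ k a, ContDiffAt ℝ ∞ (fun y => A y k a) 0) (a b : Fin r) :
    ContDiffAt ℝ ∞ (fun y => ∑ k, starRingEnd ℂ (A y k a) * (D.gram y k b *
      ((Real.sqrt (D.metric y).det : ℝ) : ℂ))) 0 :=
  ContDiffAt.sum fun k _ => ContDiffAt.mul
    (Complex.conjCLE.contDiff.contDiffAt.comp (0 : Vec n) (hA k a)) (hD.contDiffAt_gram_sqrt k b)

theorem contDiffAt_gram_mul (hD : D.IsRegular) {A : Vec n → Matrix (Fin r) (Fin r) ℂ}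
    (hA : ∀ k a, ContDiffAt ℝ ∞ (fun y => A y k a) 0) (a b : Fin r) :
    ContDiffAt ℝ ∞ (fun y => ∑ k, (D.gram y a k * ((Real.sqrt (D.metric y).det : ℝ) : ℂ)) *
      A y k b) 0 :=
  ContDiffAt.sum fun k _ => (hD.contDiffAt_gram_sqrt a k).mul (hA k b)

theorem w_series (hD : D.IsRegular) (a b : Fin r) :
    ∑ k, MvPowerSeries.map (starRingEnd ℂ) (taylorMat D.w k a) * D.gramSer k b =
      ∑ k, D.gramSer a k * taylorMat D.w k b := by
  rw [← hD.taylor_conj_mul_gram hD.w_smooth, ← hD.taylor_gram_mul hD.w_smooth]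
  refine taylor_congr ?_
  filter_upwards [hD.w_symm] with y hy
  simp only [← mul_assoc, ← Finset.sum_mul, mul_right_comm _ ((Real.sqrt _ : ℝ) : ℂ)]
  rw [hy]

theorem adjoint_first (hD : D.IsRegular) (a b : Fin r) (j : Fin n) :
    2 * ∑ i, MvPowerSeries.pderiv ℂ i (D.invSer i j * D.gramSer a b) +
      ∑ k, MvPowerSeries.map (starRingEnd ℂ) (taylorMat (D.b j) k a) * D.gramSer k b +
      ∑ k, D.gramSer a k * taylorMat (D.b j) k b = 0 := by
  have hp := fun i => (hD.contDiffAt_inv_gram i j a b).pd i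
  have h2 : ContDiffAt ℝ ∞ (fun _ : Vec n => (2 : ℂ)) 0 := contDiffAt_const
  have hs : ContDiffAt ℝ ∞ (fun y => ∑ i, pd i (fun z => (((D.metric z)⁻¹ i j : ℝ) : ℂ) *
      (D.gram z a b * ((Real.sqrt (D.metric z).det : ℝ) : ℂ))) y) 0 :=
    ContDiffAt.sum fun i _ => hp i
  have hb := hD.contDiffAt_conj_mul_gram (hD.b_smooth j) a b
  have hb' := hD.contDiffAt_gram_mul (hD.b_smooth j) a b
  rw [← hD.taylor_conj_mul_gram (hD.b_smooth j), ← hD.taylor_gram_mul (hD.b_smooth j)]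
  simp only [hD.invSer_mul_gramSer, pderiv_taylor (hD.contDiffAt_inv_gram _ _ a b)]
  rw [← taylor_sum _ fun i _ => hp i]
  have e2 : (2 : MvPowerSeries (Fin n) ℂ) = taylor fun _ => 2 := by
    rw [taylor_const, map_ofNat]
  rw [e2, ← taylor_mul h2 hs, ← taylor_add (h2.mul hs) hb, ← taylor_add ((h2.mul hs).add hb) hb',
    ← taylor_zero]
  refine taylor_congr ?_
  filter_upwards [hD.adjoint] with y hy
  exact (hy a b).1 j

theorem adjoint_second (hD : D.IsRegular) (a b : Fin r) :
    ∑ i, ∑ j, MvPowerSeries.pderiv ℂ i (MvPowerSeries.pderiv ℂ j (D.invSer i j * D.gramSer a b)) +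
      ∑ j, MvPowerSeries.pderiv ℂ j
        (∑ k, MvPowerSeries.map (starRingEnd ℂ) (taylorMat (D.b j) k a) * D.gramSer k b) =
      ∑ k, MvPowerSeries.map (starRingEnd ℂ) (taylorMat D.c k a) * D.gramSer k b -
        ∑ k, D.gramSer a k * taylorMat D.c k b := by
  have hp := fun i j => ((hD.contDiffAt_inv_gram i j a b).pd j).pd i
  have hb := fun j => hD.contDiffAt_conj_mul_gram (hD.b_smooth j) a b
  have hc := hD.contDiffAt_conj_mul_gram hD.c_smooth a b
  have hc' := hD.contDiffAt_gram_mul hD.c_smooth a b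
  rw [eq_sub_iff_add_eq, ← hD.taylor_conj_mul_gram hD.c_smooth, ← hD.taylor_gram_mul hD.c_smooth]
  simp only [← hD.taylor_conj_mul_gram (hD.b_smooth _), hD.invSer_mul_gramSer,
    pderiv_taylor (hD.contDiffAt_inv_gram _ _ a b),
    pderiv_taylor ((hD.contDiffAt_inv_gram _ _ a b).pd _), pderiv_taylor (hb _)]
  have hs1 : ∀ i, ContDiffAt ℝ ∞ (fun y => ∑ j, pd i (pd j fun z =>
      (((D.metric z)⁻¹ i j : ℝ) : ℂ) * (D.gram z a b *
        ((Real.sqrt (D.metric z).det : ℝ) : ℂ))) y) 0 := fun i => ContDiffAt.sum fun j _ => hp i j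
  have hs2 := ContDiffAt.sum (s := Finset.univ) fun i _ => hs1 i
  have hs3 := ContDiffAt.sum (s := Finset.univ) fun j _ => (hb j).pd j
  rw [Finset.sum_congr rfl fun i _ => (taylor_sum Finset.univ fun j _ => hp i j).symm,
    ← taylor_sum _ fun i _ => hs1 i, ← taylor_sum _ fun j _ => (hb j).pd j, ← taylor_add hs2 hs3,
    ← taylor_add (hs2.add hs3) hc']
  refine taylor_congr ?_
  filter_upwards [hD.adjoint] with y hy
  exact eq_sub_iff_add_eq.1 (hy a b).2

theorem conjL_comp_Q (hD : D.IsRegular) (u : S0 n r) (a : Fin r) :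
    conjL (comp (D.Q u) a) = tmon n (-2) *
    (tmon n 4 * (-(∑ i, ∑ j, rho n (D.invSer i j) * D.dConj i (D.dConj j (conjL (comp u a))))
      + (∑ j, ∑ b, rho n (MvPowerSeries.map (starRingEnd ℂ) (taylorMat (D.b j) a b)) *
        D.dConj j (conjL (comp u b)))
      + ∑ b, rho n (MvPowerSeries.map (starRingEnd ℂ) (taylorMat D.c a b)) * conjL (comp u b))
    + tmon n 2 * (∑ b, rho n (MvPowerSeries.map (starRingEnd ℂ) (taylorMat D.w a b)) *
        conjL (comp u b))
    + rho n (taylor fun y => (D.V y : ℂ)) * conjL (comp u a)) := by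
  rw [comp_Q]
  simp only [conjL_mul, conjL_add, conjL_neg, conjL_sum, conjL_tmon, conjL_rho, hD.conjL_dConj,
    hD.map_conj_invSer, map_conj_taylor_ofReal hD.contDiffAt_V]

end LocalData.IsRegular

/-- This and the next three lemmas move matrix coefficients acting on a vector onto the Gram matrix,
so that Green's identity can be applied to each pair of indices. -/
theorem sum_conj_matrix_mul {R ι : Type*} [CommRing R] [Fintype ι] (A G : ι → ι → R)
    (P V : ι → R) : ∑ a, ∑ b, (∑ k, A a k * P k) * G a b * V b =
      ∑ a, ∑ b, (∑ k, A k a * G k b) * P a * V b := by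
  simp only [Finset.sum_mul]
  rw [Finset.sum_congr rfl fun a _ => Finset.sum_comm, Finset.sum_comm]
  refine Finset.sum_congr rfl fun k _ => ?_
  rw [Finset.sum_comm]
  exact Finset.sum_congr rfl fun a _ => Finset.sum_congr rfl fun b _ => by ring

theorem sum_matrix_mul {R ι : Type*} [CommRing R] [Fintype ι] (A G : ι → ι → R)
    (P V : ι → R) : ∑ a, ∑ b, P a * G a b * (∑ k, A b k * V k) =
      ∑ a, ∑ b, (∑ k, G a k * A k b) * P a * V b := by
  simp only [Finset.sum_mul, Finset.mul_sum]
  refine Finset.sum_congr rfl fun a _ => ?_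
  rw [Finset.sum_comm]
  exact Finset.sum_congr rfl fun b _ => Finset.sum_congr rfl fun k _ => by ring

theorem sum_conj_matrix_mul_sum {R ι κ : Type*} [CommRing R] [Fintype ι] [Fintype κ]
    (A : κ → ι → ι → R) (G : ι → ι → R) (P : κ → ι → R) (V : ι → R) :
    ∑ a, ∑ b, (∑ j, ∑ k, A j a k * P j k) * G a b * V b =
      ∑ a, ∑ b, ∑ j, (∑ k, A j k a * G k b) * P j a * V b := by
  have h := Finset.sum_congr rfl fun j (_ : j ∈ Finset.univ) =>
    sum_conj_matrix_mul (A j) G (P j) V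
  rw [Finset.sum_comm, Finset.sum_congr rfl fun a _ => Finset.sum_comm] at h
  conv_rhs at h => rw [Finset.sum_comm, Finset.sum_congr rfl fun a _ => Finset.sum_comm]
  rw [← h]
  simp only [Finset.sum_mul]

theorem sum_matrix_mul_sum {R ι κ : Type*} [CommRing R] [Fintype ι] [Fintype κ]
    (A : κ → ι → ι → R) (G : ι → ι → R) (P : ι → R) (V : κ → ι → R) :
    ∑ a, ∑ b, P a * G a b * (∑ j, ∑ k, A j b k * V j k) =
      ∑ a, ∑ b, ∑ j, (∑ k, G a k * A j k b) * P a * V j b := by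
  have h := Finset.sum_congr rfl fun j (_ : j ∈ Finset.univ) =>
    sum_matrix_mul (A j) G P (V j)
  rw [Finset.sum_comm, Finset.sum_congr rfl fun a _ => Finset.sum_comm] at h
  conv_rhs at h => rw [Finset.sum_comm, Finset.sum_congr rfl fun a _ => Finset.sum_comm]
  rw [← h]
  simp only [Finset.mul_sum]

theorem sum_sum_combination {R ι : Type*} [CommRing R] [Fintype ι] (s t u : R)
    (x₁ x₂ x₃ x₄ x₅ : ι → ι → R) :
    ∑ a, ∑ b, s * (t * (-(x₁ a b) + x₂ a b + x₃ a b) + u * x₄ a b + x₅ a b) =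
      s * (t * (-(∑ a, ∑ b, x₁ a b) + ∑ a, ∑ b, x₂ a b + ∑ a, ∑ b, x₃ a b)
        + u * ∑ a, ∑ b, x₄ a b + ∑ a, ∑ b, x₅ a b) := by
  simp only [← Finset.mul_sum, Finset.sum_add_distrib, Finset.sum_neg_distrib]

/-- The flux in Green's identity for the operator `Q`. -/
noncomputable def LocalData.flux (D : LocalData n r) (P V : Fin r → Lau n) (a b : Fin r)
    (j : Fin n) : Lau n :=
  -(∑ i, rho n (D.invSer i j * D.gramSer a b) * D.dConj i (P a) * V b)
    + ∑ i, rho n (D.invSer i j * D.gramSer a b) * P a * D.dConj i (V b)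
    + rho n ((∑ k, MvPowerSeries.map (starRingEnd ℂ) (taylorMat (D.b j) k a) * D.gramSer k b)
      + ∑ i, MvPowerSeries.pderiv ℂ i (D.invSer i j * D.gramSer a b)) * P a * V b

/-- The potential contributes equally to both sides, and so does W by `w_series`. For the part
coming from L, Green's identity is applied for each pair of frame indices; the factor t² is ħ⁻¹ ħ².
-/
theorem integrand_Q (hD : D.IsRegular) (u v : S0 n r) :
    ∑ a, ∑ b, conjL (comp (D.Q u) a) * rho n (D.gramSer a b) * comp v b =
      ∑ a, ∑ b, conjL (comp u a) * rho n (D.gramSer a b) * comp (D.Q v) b +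
      tmon n 2 * ∑ a, ∑ b, ∑ j, (dX j (D.flux (fun a => conjL (comp u a)) (comp v) a b j) -
        2 * (tmon n (-2) * (rho n (D.dφ j) *
          D.flux (fun a => conjL (comp u a)) (comp v) a b j))) := by
  have e2 : tmon n (-2) * tmon n 4 = tmon n 2 := by rw [tmon_mul_tmon]; rfl
  set P : Fin r → Lau n := fun a => conjL (comp u a) with hP
  set V : Fin r → Lau n := comp v with hV
  have hPa : ∀ a, conjL (comp u a) = P a := fun a => rfl
  have hA : ∑ a, ∑ b, conjL (comp (D.Q u) a) * rho n (D.gramSer a b) * V b =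
      tmon n (-2) * (tmon n 4 * (-(∑ a, ∑ b, ∑ i, ∑ j,
          rho n (D.invSer i j * D.gramSer a b) * D.dConj i (D.dConj j (P a)) * V b)
        + ∑ a, ∑ b, ∑ j, rho n (∑ k, MvPowerSeries.map (starRingEnd ℂ) (taylorMat (D.b j) k a) *
          D.gramSer k b) * D.dConj j (P a) * V b
        + ∑ a, ∑ b, rho n (∑ k, MvPowerSeries.map (starRingEnd ℂ) (taylorMat D.c k a) *
          D.gramSer k b) * P a * V b)
      + tmon n 2 * ∑ a, ∑ b, rho n (∑ k, MvPowerSeries.map (starRingEnd ℂ) (taylorMat D.w k a) *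
          D.gramSer k b) * P a * V b
      + ∑ a, ∑ b, rho n (taylor fun y => (D.V y : ℂ)) * P a * rho n (D.gramSer a b) * V b) := by
    simp only [map_sum (rho n), map_mul (rho n)]
    rw [← sum_conj_matrix_mul_sum, ← sum_conj_matrix_mul, ← sum_conj_matrix_mul,
      ← sum_sum_combination]
    refine Finset.sum_congr rfl fun a _ => Finset.sum_congr rfl fun b _ => ?_
    have h1 : ∑ i, ∑ j, rho n (D.invSer i j) * rho n (D.gramSer a b) *
        D.dConj i (D.dConj j (P a)) * V b =
        (∑ i, ∑ j, rho n (D.invSer i j) * D.dConj i (D.dConj j (P a))) *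
          rho n (D.gramSer a b) * V b := by
      simp only [Finset.sum_mul]
      exact Finset.sum_congr rfl fun i _ => Finset.sum_congr rfl fun j _ => by ring
    rw [hD.conjL_comp_Q, h1]
    ring
  have hB : ∑ a, ∑ b, P a * rho n (D.gramSer a b) * comp (D.Q v) b =
      tmon n (-2) * (tmon n 4 * (-(∑ a, ∑ b, ∑ i, ∑ j,
          rho n (D.invSer i j * D.gramSer a b) * P a * D.dConj i (D.dConj j (V b)))
        + ∑ a, ∑ b, ∑ j, rho n (∑ k, D.gramSer a k * taylorMat (D.b j) k b) * P a *
          D.dConj j (V b)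
        + ∑ a, ∑ b, rho n (∑ k, D.gramSer a k * taylorMat D.c k b) * P a * V b)
      + tmon n 2 * ∑ a, ∑ b, rho n (∑ k, D.gramSer a k * taylorMat D.w k b) * P a * V b
      + ∑ a, ∑ b, rho n (taylor fun y => (D.V y : ℂ)) * P a * rho n (D.gramSer a b) * V b) := by
    simp only [map_sum (rho n), map_mul (rho n)]
    rw [← sum_matrix_mul_sum, ← sum_matrix_mul, ← sum_matrix_mul, ← sum_sum_combination]
    refine Finset.sum_congr rfl fun a _ => Finset.sum_congr rfl fun b _ => ?_
    have h1 : ∑ i, ∑ j, rho n (D.invSer i j) * rho n (D.gramSer a b) * P a *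
        D.dConj i (D.dConj j (V b)) =
        P a * rho n (D.gramSer a b) *
          (∑ i, ∑ j, rho n (D.invSer i j) * D.dConj i (D.dConj j (V b))) := by
      simp only [Finset.mul_sum]
      exact Finset.sum_congr rfl fun i _ => Finset.sum_congr rfl fun j _ => by ring
    rw [comp_Q, h1]
    ring
  have hG := Finset.sum_congr rfl fun a (_ : a ∈ Finset.univ) =>
    Finset.sum_congr rfl fun b (_ : b ∈ Finset.univ) =>
    green_identity D (p := fun i j => D.invSer i j * D.gramSer a b)
      (β := fun j => ∑ k, MvPowerSeries.map (starRingEnd ℂ) (taylorMat (D.b j) k a) * D.gramSer k b)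
      (β' := fun j => ∑ k, D.gramSer a k * taylorMat (D.b j) k b)
      (κ := ∑ k, MvPowerSeries.map (starRingEnd ℂ) (taylorMat D.c k a) * D.gramSer k b)
      (κ' := ∑ k, D.gramSer a k * taylorMat D.c k b)
      (fun i j => by rw [hD.invSer_symm]) (hD.adjoint_first a b) (hD.adjoint_second a b) (P a) (V b)
  simp only [Finset.sum_add_distrib, Finset.sum_neg_distrib, Finset.sum_sub_distrib] at hG
  simp only [Finset.sum_sub_distrib]
  rw [hA, hB]
  simp only [hD.w_series]
  simp only [LocalData.flux]
  linear_combination tmon n 2 * hG + (-(∑ a, ∑ b, ∑ i, ∑ j,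
          rho n (D.invSer i j * D.gramSer a b) * D.dConj i (D.dConj j (P a)) * V b)
        + ∑ a, ∑ b, ∑ j, rho n (∑ k, MvPowerSeries.map (starRingEnd ℂ) (taylorMat (D.b j) k a) *
          D.gramSer k b) * D.dConj j (P a) * V b
        + ∑ a, ∑ b, rho n (∑ k, MvPowerSeries.map (starRingEnd ℂ) (taylorMat D.c k a) *
          D.gramSer k b) * P a * V b) * e2 - (-(∑ a, ∑ b, ∑ i, ∑ j,
          rho n (D.invSer i j * D.gramSer a b) * P a * D.dConj i (D.dConj j (V b)))
        + ∑ a, ∑ b, ∑ j, rho n (∑ k, D.gramSer a k * taylorMat (D.b j) k b) * P a *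
          D.dConj j (V b)
        + ∑ a, ∑ b, rho n (∑ k, D.gramSer a k * taylorMat D.c k b) * P a * V b) * e2

/-- By `integrand_Q` the two integrands differ by a twisted divergence, whose Gaussian integral is
zero. -/
theorem form_Q (hD : D.IsRegular) (u v : S0 n r) : D.form (D.Q u) v = D.form u (D.Q v) := by
  rw [form_eq, form_eq, integrand_Q hD, add_mul, gaussL_add D hD, add_eq_left, ← embC_tpow,
    mul_assoc, gaussL_embC_mul D hD]
  simp only [Finset.sum_mul, gaussL_sum D hD, gaussL_dX_sub hD, Finset.sum_const_zero, mul_zero]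

end Symmetry

/-! ## The operator `Q₀` on polynomials -/

section LeadingTerm

variable {n r : ℕ} {D : LocalData n r}

/-- A vector T y in the kernel satisfies h(T y, T y) = h(y, T(T y)) = 0, so kernel and range meet
trivially; rank-nullity does the rest. -/
theorem ker_sup_range_eq_top_of_symmetric {V : Type*} [AddCommGroup V] [Module ℂ V]
    [FiniteDimensional ℂ V] (T : V →ₗ[ℂ] V) (h : V → V → ℂ) (h0 : ∀ x, h x 0 = 0)
    (hT : ∀ x y, h (T x) y = h x (T y)) (hdef : ∀ x, h x x = 0 → x = 0) :
    LinearMap.ker T ⊔ LinearMap.range T = ⊤ := by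
  refine Submodule.eq_top_of_disjoint _ _ ?_ ?_
  · rw [add_comm, LinearMap.finrank_range_add_finrank_ker]
  · rw [Submodule.disjoint_def]
    rintro _ hx ⟨y, rfl⟩
    refine hdef _ ?_
    rw [hT, LinearMap.mem_ker.1 hx, h0]

/-- The polynomials of degree at most `d`. -/
noncomputable def polyDeg (n r d : ℕ) : Submodule ℂ (PolyY n r) :=
  Submodule.pi Set.univ fun _ => MvPolynomial.restrictTotalDegree (Fin n) ℂ d

theorem mem_polyDeg {d : ℕ} {q : PolyY n r} : q ∈ polyDeg n r d ↔ ∀ a, (q a).totalDegree ≤ d := by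
  simp [polyDeg, Submodule.mem_pi, MvPolynomial.mem_restrictTotalDegree]

instance (d : ℕ) : FiniteDimensional ℂ (polyDeg n r d) := by
  let f : polyDeg n r d →ₗ[ℂ] (Fin r → MvPolynomial.restrictTotalDegree (Fin n) ℂ d) :=
    LinearMap.pi fun a => (LinearMap.proj a ∘ₗ (polyDeg n r d).subtype).codRestrict _
      fun q => q.2 a (Set.mem_univ a)
  refine Module.Finite.of_injective f fun p q h => Subtype.ext (funext fun a => ?_)
  exact congrArg Subtype.val (congrFun h a)

/-- The Gaussian inner product of polynomials. -/
noncomputable def LocalData.gaussForm (D : LocalData n r) (p q : PolyY n r) : ℂ :=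
  ∑ a, D.gaussInt (MvPolynomial.map (starRingEnd ℂ) (p a) * q a)

theorem comp_constS0_neg (q : PolyY n r) (a : Fin r) (k : ℤ) (hk : k < 0) :
    (comp (constS0 n r q) a).coeff k = 0 := by
  rw [coeff_comp_constS0, if_neg hk.ne]

theorem exists_degree_bound (q : PolyY n r) : ∃ d, q ∈ polyDeg n r d :=
  ⟨Finset.univ.sup fun a => (q a).totalDegree, mem_polyDeg.2 fun a =>
    Finset.le_sup (f := fun a => (q a).totalDegree) (Finset.mem_univ a)⟩

theorem comp_Q_constS0_neg (hD : D.IsRegular) (q : PolyY n r) (a : Fin r) (k : ℤ) (hk : k < 0) :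
    (comp (D.Q (constS0 n r q)) a).coeff k = 0 := by
  obtain ⟨d, hd⟩ := exists_degree_bound q
  exact coeff_eq_zero_of_mem_lauFil (hD.Q_mem_lauFil (comp_constS0_mem (mem_polyDeg.1 hd)) a) hk

theorem gaussForm_conj (p q : PolyY n r) :
    starRingEnd ℂ (D.gaussForm p q) = D.gaussForm q p := by
  rw [LocalData.gaussForm, map_sum]
  refine Finset.sum_congr rfl fun a _ => ?_
  rw [← gaussInt_conj, map_mul, mul_comm]
  congr 2
  ext α
  simp [MvPolynomial.coeff_map]

theorem gaussForm_add_right (hD : D.IsRegular) (p q s : PolyY n r) :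
    D.gaussForm p (q + s) = D.gaussForm p q + D.gaussForm p s := by
  simp only [LocalData.gaussForm, Pi.add_apply, mul_add, gaussInt_add hD, Finset.sum_add_distrib]

theorem gaussForm_smul_right (c : ℂ) (p q : PolyY n r) :
    D.gaussForm p (c • q) = c * D.gaussForm p q := by
  simp only [LocalData.gaussForm, Pi.smul_apply, MvPolynomial.smul_eq_C_mul, Finset.mul_sum]
  refine Finset.sum_congr rfl fun a _ => ?_
  rw [mul_left_comm, gaussInt_C_mul]

theorem gaussForm_smul_left (c : ℂ) (p q : PolyY n r) :
    D.gaussForm (c • p) q = starRingEnd ℂ c * D.gaussForm p q := by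
  rw [← gaussForm_conj _ _, gaussForm_smul_right, map_mul, gaussForm_conj _ _]

theorem gaussForm_add_left (hD : D.IsRegular) (p q s : PolyY n r) :
    D.gaussForm (p + q) s = D.gaussForm p s + D.gaussForm q s := by
  rw [← gaussForm_conj _ _, gaussForm_add_right hD, map_add, gaussForm_conj _ _,
    gaussForm_conj _ _]

theorem gaussForm_self_nonneg (p : PolyY n r) : 0 ≤ (D.gaussForm p p).re := by
  rw [LocalData.gaussForm, Complex.re_sum]
  exact Finset.sum_nonneg fun a _ => gaussInt_conj_mul_self_nonneg _

theorem eq_zero_of_gaussForm_self (hD : D.IsRegular) {p : PolyY n r}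
    (h : D.gaussForm p p = 0) : p = 0 := by
  have h1 := congrArg Complex.re h
  rw [LocalData.gaussForm, Complex.re_sum, Complex.zero_re,
    Finset.sum_eq_zero_iff_of_nonneg fun a _ => gaussInt_conj_mul_self_nonneg _] at h1
  exact funext fun a => eq_zero_of_gaussInt_conj_mul_self hD (h1 a (Finset.mem_univ a))

/-- This is the coefficient of t^0 in `form_Q` for series that are constant in t. -/
theorem gaussForm_Q₀ (hD : D.IsRegular) (p q : PolyY n r) :
    D.gaussForm (D.Q₀ p) q = D.gaussForm p (D.Q₀ q) := by
  have h := congrArg (fun s : Scal => s.coeff 0) (form_Q hD (constS0 n r p) (constS0 n r q))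
  rw [coeff_form_zero hD (comp_Q_constS0_neg hD p) (comp_constS0_neg q),
    coeff_form_zero hD (comp_constS0_neg p) (comp_Q_constS0_neg hD q)] at h
  simp only [coeff_comp_constS0, if_true] at h
  exact h

/-- The coefficient `Q_{l/2}` of `Q`, acting on polynomials. -/
noncomputable def LocalData.Qcoeff (D : LocalData n r) (l : ℕ) : PolyY n r →ₗ[ℂ] PolyY n r where
  toFun q := tcoeff (D.Q (constS0 n r q) : FormalY n r) l
  map_add' p q := by rw [map_add, map_add]; rfl
  map_smul' s q := by
    rw [map_smul, LinearMap.map_smul_of_tower]; rfl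

theorem Qcoeff_mem (hD : D.IsRegular) (l d : ℕ) {q : PolyY n r} (hq : q ∈ polyDeg n r d) :
    D.Qcoeff l q ∈ polyDeg n r (d + l) := by
  refine mem_polyDeg.2 fun a => totalDegree_le_of_coeff fun α hα => ?_
  have := hD.Q_mem_lauFil (comp_constS0_mem (mem_polyDeg.1 hq)) a l α hα
  omega

/-- `Q₀ - E₀` decomposes the polynomials of degree at most `d` into its range and its kernel. -/
theorem exists_Q₀_decomposition (hD : D.IsRegular) (E₀ : ℝ) {d : ℕ} {v : PolyY n r}
    (hv : v ∈ polyDeg n r d) : ∃ s ∈ polyDeg n r d,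
      ∃ k ∈ Module.End.eigenspace D.Q₀ (E₀ : ℂ), v = D.Q₀ s - (E₀ : ℂ) • s + k := by
  let T : PolyY n r →ₗ[ℂ] PolyY n r := D.Q₀ - (E₀ : ℂ) • (LinearMap.id : PolyY n r →ₗ[ℂ] PolyY n r)
  have hT : ∀ q, T q = D.Q₀ q + (-(E₀ : ℂ)) • q := fun q => by
    rw [neg_smul, ← sub_eq_add_neg]
    rfl
  have hmap : ∀ q ∈ polyDeg n r d, T q ∈ polyDeg n r d :=
    fun q hq => sub_mem (Qcoeff_mem hD 0 d hq) (Submodule.smul_mem _ _ hq)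
  have hsymm : ∀ p q : PolyY n r, D.gaussForm (T p) q = D.gaussForm p (T q) := fun p q => by
    rw [hT, hT, gaussForm_add_left hD, gaussForm_add_right hD, gaussForm_Q₀ hD,
      gaussForm_smul_left, gaussForm_smul_right, map_neg, Complex.conj_ofReal]
  have htop := ker_sup_range_eq_top_of_symmetric
    (T.restrict hmap) (fun p q => D.gaussForm p.1 q.1)
    (fun p => by
      have := gaussForm_smul_right (D := D) 0 p.1 0
      simpa using this)
    (fun p q => hsymm p.1 q.1) (fun p hp => Subtype.ext (eq_zero_of_gaussForm_self hD hp))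
  have hmem : (⟨v, hv⟩ : polyDeg n r d) ∈ (⊤ : Submodule ℂ (polyDeg n r d)) := Submodule.mem_top
  rw [← htop, Submodule.mem_sup] at hmem
  obtain ⟨k, hk, _, ⟨s, rfl⟩, hks⟩ := hmem
  refine ⟨s.1, s.2, k.1, ?_, ?_⟩
  · have := congrArg Subtype.val (LinearMap.mem_ker.1 hk)
    exact Module.End.mem_eigenspace_iff.2 (sub_eq_zero.1 this)
  · have := congrArg Subtype.val hks
    rw [add_comm] at this
    exact this.symm

theorem eigenspace_le_polyDeg (hD : D.IsRegular) {μ : Fin r → ℝ}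
    (hμ : (D.w 0).charpoly = ∏ k, (Polynomial.X - Polynomial.C (μ k : ℂ))) (E₀ : ℝ) :
    Module.End.eigenspace D.Q₀ (E₀ : ℂ) ≤ polyDeg n r (D.maxDegree μ E₀) := fun _ hq =>
  mem_polyDeg.2 (hD.totalDegree_le_of_mem_eigenspace hμ hq)

/-- An orthonormal basis of the eigenspace. -/
theorem exists_orthonormal_eigenbasis (hD : D.IsRegular) (K : Submodule ℂ (PolyY n r))
    [FiniteDimensional ℂ K] : ∃ χ : Fin (Module.finrank ℂ K) → PolyY n r, (∀ i, χ i ∈ K) ∧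
      (∀ i j, D.gaussForm (χ i) (χ j) = if i = j then 1 else 0) ∧
      ∀ v ∈ K, ∃ c : Fin (Module.finrank ℂ K) → ℂ, v = ∑ i, c i • χ i := by
  let core : InnerProductSpace.Core ℂ K :=
    { inner := fun p q => D.gaussForm p.1 q.1
      conj_inner_symm := fun p q => gaussForm_conj _ _
      re_inner_nonneg := fun p => gaussForm_self_nonneg _
      add_left := fun p q s => gaussForm_add_left hD _ _ _
      smul_left := fun p q c => gaussForm_smul_left _ _ _
      definite := fun p hp => Subtype.ext (eq_zero_of_gaussForm_self hD hp) }
  let _ : NormedAddCommGroup K := core.toNormedAddCommGroup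
  let _ : InnerProductSpace ℂ K := InnerProductSpace.ofCore core.toCore
  let e := stdOrthonormalBasis ℂ K
  refine ⟨fun i => (e i).1, fun i => (e i).2, fun i j => orthonormal_iff_ite.1 e.orthonormal i j,
    fun v hv => ⟨fun i => e.repr ⟨v, hv⟩ i, ?_⟩⟩
  have := congrArg Subtype.val (e.sum_repr ⟨v, hv⟩)
  rw [Submodule.coe_sum] at this
  exact this.symm

/-! ### The action of `Q` on series -/

theorem comp_tpow_smul (k : ℤ) (u : S0 n r) (a : Fin r) :
    comp (tpow k • u) a = tmon n k * comp u a := by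
  rw [comp_smul, embC_tpow]

theorem comp_sum {ι : Type*} (s : Finset ι) (u : ι → S0 n r) (a : Fin r) :
    comp (∑ i ∈ s, u i) a = ∑ i ∈ s, comp (u i) a := by
  classical
  induction s using Finset.induction_on with
  | empty => simp [comp_zero]
  | insert b s hb ih => rw [Finset.sum_insert hb, Finset.sum_insert hb, comp_add, ih]

/-- The expansion Q = ∑ t^l Q_l is justified coefficientwise: Q is linear over ℂ((t)) on the
truncation of u after t^k, and it cannot lower the order of the remainder, which begins at t^{k+1}.
-/
theorem tcoeff_Q (hD : D.IsRegular) {u : S0 n r} {d : ℤ} (hu : ∀ a, comp u a ∈ lauFil n 0 d)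
    (k : ℕ) : tcoeff (D.Q u : FormalY n r) k = ∑ l ∈ Finset.range (k + 1),
      D.Qcoeff l (tcoeff (u : FormalY n r) ((k - l : ℕ) : ℤ)) := by
  set s : S0 n r := ∑ i ∈ Finset.range (k + 1),
    tpow i • constS0 n r (tcoeff (u : FormalY n r) (i : ℤ)) with hs
  have hcs : ∀ a (m : ℤ), (comp s a).coeff m = if m < k + 1 then (comp u a).coeff m else 0 := by
    intro a m
    rw [hs, comp_sum, HahnSeries.coeff_sum]
    simp only [comp_tpow_smul, coeff_tmon_mul, coeff_comp_constS0]
    split_ifs with h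
    · by_cases h0 : m < 0
      · rw [coeff_eq_zero_of_mem_lauFil (hu a) h0]
        exact Finset.sum_eq_zero fun i _ => if_neg (by omega)
      · obtain ⟨m, rfl⟩ := Int.eq_ofNat_of_zero_le (not_lt.1 h0)
        rw [Finset.sum_eq_single m]
        · rw [if_pos (sub_self _)]
          rfl
        · exact fun i _ hi => if_neg (by omega)
        · intro hm
          rw [Finset.mem_range] at hm
          omega
    · refine Finset.sum_eq_zero fun i hi => if_neg ?_
      rw [Finset.mem_range] at hi
      omega
  have hrest : ∀ a, comp (u - s) a ∈ lauFil n (k + 1) d := by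
    intro a m α h
    have hsub : comp (u - s) a = comp u a - comp s a := by
      rw [eq_sub_iff_add_eq, ← comp_add]
      exact congrArg (comp · a) (sub_add_cancel u s)
    rw [hsub, HahnSeries.coeff_sub, hcs] at h
    split_ifs at h with hm
    · simp at h
    · rw [sub_zero] at h
      have := hu a m α h
      omega
  have hu' : D.Q u = D.Q s + D.Q (u - s) := by
    rw [← map_add]
    exact congrArg D.Q (add_sub_cancel s u).symm
  funext a
  have h1 : (comp (D.Q (u - s)) a).coeff k = 0 :=
    coeff_eq_zero_of_mem_lauFil (hD.Q_mem_lauFil hrest a) (by omega)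
  rw [← coeff_comp, hu', comp_add, HahnSeries.coeff_add, h1, add_zero, hs, map_sum, comp_sum,
    HahnSeries.coeff_sum, Finset.sum_apply, ← Finset.sum_range_reflect]
  refine Finset.sum_congr rfl fun i hi => ?_
  have hi := Finset.mem_range.1 hi
  rw [map_smul, comp_tpow_smul, coeff_tmon_mul, show k + 1 - 1 - i = k - i by omega,
    show (k : ℤ) - ((k - i : ℕ) : ℤ) = i by omega]
  rfl

/-- The series `∑_k t^k p_k`, for polynomials `p_k` of degree at most `k + d`. -/
noncomputable def seriesS0 {d : ℕ} (p : ℕ → PolyY n r) (hp : ∀ k, p k ∈ polyDeg n r (d + k)) :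
    S0 n r :=
  ⟨ofCoeff (fun k => if 0 ≤ k then p k.toNat else 0) 0 fun k hk => if_neg (by omega), d,
    fun k a α h => by
      rw [tcoeff_ofCoeff] at h
      split_ifs at h with hk
      · have h1 := MvPolynomial.le_totalDegree h
        have h2 := mem_polyDeg.1 (hp k.toNat) a
        change α.degree ≤ _ at h1
        omega
      · simp at h⟩

theorem tcoeff_seriesS0 {d : ℕ} (p : ℕ → PolyY n r) (hp : ∀ k, p k ∈ polyDeg n r (d + k))
    (k : ℤ) : tcoeff (seriesS0 p hp : FormalY n r) k = if 0 ≤ k then p k.toNat else 0 := rfl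

theorem comp_seriesS0_mem {d : ℕ} (p : ℕ → PolyY n r) (hp : ∀ k, p k ∈ polyDeg n r (d + k))
    (a : Fin r) : comp (seriesS0 p hp) a ∈ lauFil n 0 d := by
  intro k α h
  rw [coeff_comp, tcoeff_seriesS0] at h
  split_ifs at h with hk
  · have h1 := MvPolynomial.le_totalDegree (MvPolynomial.mem_support_iff.2 h)
    have h2 := mem_polyDeg.1 (hp k.toNat) a
    change α.degree ≤ _ at h1
    omega
  · simp at h

end LeadingTerm

/-! ## Formal eigenvectors -/

section FormalEigenvectors

variable {n r : ℕ} {D : LocalData n r}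

/-- The inclusion `ℂ[[t]] ⊆ ℂ((t))`. -/
noncomputable abbrev ofPS : PowerSeries ℂ →+* Scal := HahnSeries.ofPowerSeries ℤ ℂ

theorem ofPS_injective : Function.Injective ofPS := HahnSeries.ofPowerSeries_injective

theorem conjS_ofPS (f : PowerSeries ℂ) : conjS (ofPS f) = ofPS (star f) := by
  ext k
  rw [coeff_conjS, coeff_ofPowerSeries_int, coeff_ofPowerSeries_int]
  split_ifs
  · rw [PowerSeries.coeff_star]
  · rw [map_zero]

theorem exists_ofPS {s : Scal} (hs : ∀ k < 0, s.coeff k = 0) : ∃ f, ofPS f = s := by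
  refine ⟨PowerSeries.mk fun k => s.coeff k, ?_⟩
  ext k
  rw [coeff_ofPowerSeries_int]
  split_ifs with hk
  · rw [PowerSeries.coeff_mk, Int.toNat_of_nonneg hk]
  · rw [hs k (not_le.1 hk)]

theorem embC_ofPS_mem (f : PowerSeries ℂ) : embC n (ofPS f) ∈ lauFil n 0 0 := by
  intro k α h
  rw [coeff_embC, MvPolynomial.coeff_C, coeff_ofPowerSeries_int] at h
  split_ifs at h with h0 hk
  · subst h0
    exact ⟨hk, by simpa using hk⟩
  all_goals simp at h

theorem ofPS_smul_smul (f g : PowerSeries ℂ) (u : S0 n r) :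
    ofPS f • ofPS g • u = ofPS (f * g) • u := by
  rw [map_mul]
  exact (mul_smul (ofPS f) (ofPS g) u).symm

theorem sum_ofPS_smul {ι : Type*} (s : Finset ι) (f : ι → PowerSeries ℂ) (u : S0 n r) :
    ∑ i ∈ s, ofPS (f i) • u = ofPS (∑ i ∈ s, f i) • u := by
  rw [map_sum]
  exact (Finset.sum_smul (R := Scal)).symm

theorem comp_ofPS_smul_mem {d : ℤ} (f : PowerSeries ℂ) {u : S0 n r}
    (hu : ∀ a, comp u a ∈ lauFil n 0 d) (a : Fin r) : comp (ofPS f • u) a ∈ lauFil n 0 d := by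
  rw [comp_smul]
  simpa using mul_mem_lauFil (embC_ofPS_mem f) (hu a)

/-- An invariant family whose Gram matrix has leading term `1` gives rise to orthonormal
eigenvectors. -/
theorem exists_eigenvectors_of_invariant (hD : D.IsRegular) {d : ℤ} {m : ℕ}
    (Ψ : Fin m → S0 n r) (hΨ : ∀ i a, comp (Ψ i) a ∈ lauFil n 0 d)
    (M : Matrix (Fin m) (Fin m) (PowerSeries ℂ))
    (hQ : ∀ j, D.Q (Ψ j) = ∑ i, ofPS (M i j) • Ψ i)
    (hΨ1 : ∀ i j, (D.form (Ψ i) (Ψ j)).coeff 0 = if i = j then 1 else 0)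
    (a : ℂ) (hM : coeffMat 0 M = a • 1) :
    ∃ (f : Fin m → PowerSeries ℝ) (ψ : Fin m → S0 n r),
      (∀ j, (((PowerSeries.constantCoeff (f j) : ℝ)) : ℂ) = a) ∧
      (∀ j, D.Q (ψ j) = realSeries (f j) • ψ j) ∧
      (∀ i j, D.form (ψ i) (ψ j) = if i = j then 1 else 0) ∧
      ∀ j b, comp (ψ j) b ∈ lauFil n 0 d := by
  have hneg : ∀ i b, ∀ k < 0, (comp (Ψ i) b).coeff k = 0 := fun i b k hk =>
    coeff_eq_zero_of_mem_lauFil (hΨ i b) hk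
  -- The Gram matrix of the family has no negative powers of t, so it can be treated over ℂ[[t]],
  -- where Rellich's theorem is available.
  choose G hG using fun i j => exists_ofPS fun k hk => coeff_form_neg (D := D) (hneg i) (hneg j) hk
  have hG1 : coeffMat 0 (Matrix.of G) = 1 := by
    ext i j
    have h := hΨ1 i j
    rw [← hG, coeff_ofPowerSeries_int, if_pos le_rfl] at h
    rw [Matrix.one_apply]
    exact h
  have hGstar : ∀ i j, star (G i j) = G j i := fun i j => ofPS_injective <| by
    rw [← conjS_ofPS, hG, form_conj_symm hD, hG]
  -- The symmetry of Q, evaluated on the family, is the self-adjointness of M for G; the adjoint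
  -- appears because the form is conjugate-linear in its first argument.
  have hGM : Matrix.of G * M = M.conjTranspose * Matrix.of G := by
    ext1 i j
    refine ofPS_injective ?_
    have h := form_Q hD (Ψ i) (Ψ j)
    rw [hQ, hQ, form_sum_left hD, form_sum_right hD] at h
    simp only [form_smul_left hD, form_smul_right hD, conjS_ofPS, ← hG, ← map_mul, ← map_sum] at h
    rw [Matrix.mul_apply, Matrix.mul_apply]
    simp only [Matrix.of_apply, Matrix.conjTranspose_apply]
    rw [h]
    simp only [mul_comm]
  obtain ⟨f, Z, hZ, hMZ⟩ := hasOrthonormalEigenbasis m (Fintype.card_fin m) (Matrix.of G) M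
    (Matrix.ext fun i j => hGstar j i) hG1 hGM
  refine ⟨f, fun j => ∑ i, ofPS (Z i j) • Ψ i, fun j => ?_, fun j => ?_, fun i j => ?_, fun j b => ?_⟩
  · rw [← constantCoeff_eigenvalue hM hZ hMZ j, ← PowerSeries.coeff_zero_eq_constantCoeff_apply,
      ← PowerSeries.coeff_zero_eq_constantCoeff_apply, PowerSeries.coeff_map]
    rfl
  · rw [map_sum, Finset.smul_sum]
    simp only [map_smul, hQ, Finset.smul_sum, ofPS_smul_smul, realSeries]
    rw [Finset.sum_comm]
    refine Finset.sum_congr rfl fun i _ => ?_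
    have h := congrFun (congrFun hMZ i) j
    rw [Matrix.mul_apply, Matrix.mul_diagonal] at h
    rw [sum_ofPS_smul]
    simp only [mul_comm (Z _ j)]
    rw [h, mul_comm]
  · rw [form_sum_left hD]
    simp only [form_sum_right hD, form_smul_left hD, form_smul_right hD, conjS_ofPS, ← hG,
      ← map_mul, ← map_sum]
    have h := congrFun (congrFun hZ i) j
    rw [Matrix.mul_assoc, Matrix.mul_apply] at h
    simp only [Matrix.mul_apply, Matrix.conjTranspose_apply, Matrix.of_apply,
      Matrix.one_apply] at h
    simp only [Finset.mul_sum] at h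
    rw [Finset.sum_congr rfl fun k _ => Finset.sum_congr rfl fun l _ => by
      rw [mul_comm (Z l j) (G k l)], h]
    split_ifs <;> simp
  · rw [comp_sum]
    exact AddSubgroup.sum_mem _ fun i _ => comp_ofPS_smul_mem _ (hΨ i) b

/-- The invariant family obtained from a recursion for its coefficients. -/
theorem Q_seriesS0 (hD : D.IsRegular) {d m : ℕ} (Ψ : ℕ → Fin m → PolyY n r)
    (hΨ : ∀ j k, Ψ k j ∈ polyDeg n r (d + k)) (M : ℕ → Fin m → Fin m → ℂ)
    (h : ∀ k j, ∑ l ∈ Finset.range (k + 1), D.Qcoeff l (Ψ (k - l) j) =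
      ∑ l ∈ Finset.range (k + 1), ∑ i, M l i j • Ψ (k - l) i) (j : Fin m) :
    D.Q (seriesS0 (fun k => Ψ k j) (hΨ j)) =
      ∑ i, ofPS (mkMat (fun l => Matrix.of (M l)) i j) • seriesS0 (fun k => Ψ k i) (hΨ i) := by
  have hneg : ∀ (i : Fin m) (k : ℤ), k < 0 →
      tcoeff (seriesS0 (fun k => Ψ k i) (hΨ i) : FormalY n r) k = 0 := fun i k hk => by
    rw [tcoeff_seriesS0, if_neg (not_le.2 hk)]
  refine S0_ext fun a => ?_
  ext1
  funext k
  have hmem : ∀ (u : Fin m → S0 n r), (∀ i b, comp (u i) b ∈ lauFil n 0 d) →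
      ∀ b, comp (∑ i, u i) b ∈ lauFil n 0 d := fun u hu b => by
    rw [comp_sum]
    exact AddSubgroup.sum_mem _ fun i _ => hu i b
  rcases lt_or_ge k 0 with hk | hk
  · rw [coeff_eq_zero_of_mem_lauFil (hD.Q_mem_lauFil (comp_seriesS0_mem _ (hΨ j)) a) hk,
      coeff_eq_zero_of_mem_lauFil (hmem _ (fun i b =>
        comp_ofPS_smul_mem _ (comp_seriesS0_mem _ (hΨ i)) b) a) hk]
  · obtain ⟨k, rfl⟩ := Int.eq_ofNat_of_zero_le hk
    rw [coeff_comp, tcoeff_Q hD (comp_seriesS0_mem _ (hΨ j)), comp_sum, HahnSeries.coeff_sum]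
    have h1 : ∀ l ∈ Finset.range (k + 1), D.Qcoeff l (tcoeff
        (seriesS0 (fun k => Ψ k j) (hΨ j) : FormalY n r) ((k - l : ℕ) : ℤ)) =
        D.Qcoeff l (Ψ (k - l) j) := fun l _ => by
      rw [tcoeff_seriesS0, if_pos (Int.natCast_nonneg _), Int.toNat_natCast]
    rw [Finset.sum_congr rfl h1, h, Finset.sum_comm, Finset.sum_apply]
    refine Finset.sum_congr rfl fun i _ => ?_
    rw [coeff_comp]
    refine congrFun ?_ a
    change _ = tcoeff (ofPS _ • (seriesS0 (fun k => Ψ k i) (hΨ i) : FormalY n r)) (k : ℤ)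
    rw [tcoeff_smul _ _ (a := 0) (b := 0) (fun l hl => coeff_ofPowerSeries_neg _ hl) (hneg i),
      sub_zero]
    refine Finset.sum_bij' (fun l _ => (l : ℤ)) (fun l _ => l.toNat) ?_ ?_ ?_ ?_ ?_
    · intro l hl
      rw [Finset.mem_range] at hl
      rw [Finset.mem_Icc]
      omega
    · intro l hl
      rw [Finset.mem_Icc] at hl
      rw [Finset.mem_range]
      omega
    · exact fun l _ => Int.toNat_natCast l
    · exact fun l hl => Int.toNat_of_nonneg (Finset.mem_Icc.1 hl).1
    · intro l hl
      rw [Finset.mem_range] at hl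
      rw [coeff_ofPowerSeries_int, if_pos (Int.natCast_nonneg l), Int.toNat_natCast,
        tcoeff_seriesS0, if_pos (by omega), show ((k : ℤ) - l).toNat = k - l by omega]
      simp [mkMat]

end FormalEigenvectors

theorem mainTheorem4 {n r : ℕ}
    -- the Riemannian manifold and the hermitian vector bundle of rank `r`
    {M : Type*} [TopologicalSpace M] [T2Space M] [SecondCountableTopology M]
    [ChartedSpace (Vec n) M] [IsManifold (𝓡 n) ∞ M] (g : SmoothMetric n M)
    {E : M → Type*} [TopologicalSpace (Bundle.TotalSpace (Fib r) E)]
    [∀ q, TopologicalSpace (E q)] [∀ q, AddCommGroup (E q)] [∀ q, Module ℂ (E q)]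
    [FiberBundle (Fib r) E] [VectorBundle ℂ (Fib r) E] [VectorBundle ℝ (Fib r) E]
    [ContMDiffVectorBundle ∞ (Fib r) E (𝓡 n)] (γ : HermitianMetric n r E)
    -- the Schrödinger operator and the solution of the eikonal equation
    (L : Sec n r E →ₗ[ℝ] Sec n r E) (W : ∀ q, E q →ₗ[ℂ] E q) (V : M → ℝ) (p : M)
    (hH : IsSchrodingerSetup g γ L W V p)
    (U : Set M) (φ : M → ℝ) (hφ : IsEikonalSolution g V p U φ)
    -- normal coordinates, the parallel frame, and the expressions of the data in them
    (x : OpenPartialHomeomorph M (Vec n)) (e : Fin r → ∀ q, E q) (D : LocalData n r)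
    (hD : IsNormalData g γ L W V φ p x e D)
    -- the eigenvalues of `W(p)`, with multiplicities
    (μ : Fin r → ℝ)
    (hμ : (D.w 0).charpoly = ∏ k, (Polynomial.X - Polynomial.C (μ k : ℂ)))
    -- an element of the spectrum of `Q₀` and its multiplicity
    (E₀ : ℝ) (hE₀ : (E₀ : ℂ) ∈ spectrum ℂ D.Q₀) (m₀ : ℕ)
    (hm₀ : m₀ = Module.finrank ℂ (Module.End.eigenspace D.Q₀ (E₀ : ℂ))) :
    ∃ (F : Fin m₀ → PowerSeries ℝ) (ψ : Fin m₀ → S0 n r),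
      (∀ j, PowerSeries.constantCoeff (F j) = E₀) ∧
      (∀ j, Module.End.HasEigenvector D.Q (realSeries (F j)) (ψ j)) ∧
      (∀ i j, D.form (ψ i) (ψ j) = if i = j then 1 else 0) ∧
      (∀ j, ∀ k : ℤ, k < 0 → tcoeff (ψ j : FormalY n r) k = 0) ∧
      (∀ j, ∀ k : ℕ, ∀ a, (tcoeff (ψ j : FormalY n r) k a).totalDegree
        ≤ k + D.maxDegree μ E₀) := by
  have hR := hD.isRegular hH hφ
  set N := D.maxDegree μ E₀
  have hK := eigenspace_le_polyDeg hR hμ E₀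
  have : FiniteDimensional ℂ (Module.End.eigenspace D.Q₀ (E₀ : ℂ)) :=
    Submodule.finiteDimensional_of_le hK
  subst hm₀
  obtain ⟨χ, hχK, hχ1, hχ⟩ := exists_orthonormal_eigenbasis hR (Module.End.eigenspace D.Q₀ (E₀ : ℂ))
  -- The filtration by degree at most N + k carries the degree bound through the recursion: the
  -- eigenspace lies in step 0, and Q_{l/2} raises the step by at most l.
  obtain ⟨Ψ, M, hΨ0, hM0, hΨ, hrec⟩ := exists_invariant_family D.Qcoeff
    (fun k => polyDeg n r (N + k))
    (fun k l hkl q hq => mem_polyDeg.2 fun a => (mem_polyDeg.1 hq a).trans (by omega))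
    (fun l k v hv => by
      rw [← Nat.add_assoc]
      exact Qcoeff_mem hR l _ hv) (E₀ : ℂ) χ (fun i => hK (hχK i))
    (fun i => Module.End.mem_eigenspace_iff.1 (hχK i))
    (fun k v hv => by
      obtain ⟨s, hs, q, hq, rfl⟩ := exists_Q₀_decomposition hR E₀ hv
      obtain ⟨c, rfl⟩ := hχ q hq
      exact ⟨s, hs, c, rfl⟩)
  have hmem := fun i => comp_seriesS0_mem (fun k => Ψ k i) fun k => hΨ k i
  have hneg : ∀ i a, ∀ k < 0, (comp (seriesS0 (fun k => Ψ k i) fun k => hΨ k i) a).coeff k = 0 :=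
    fun i a k hk => coeff_eq_zero_of_mem_lauFil (hmem i a) hk
  obtain ⟨f, ψ, hf, hψQ, hψ1, hψ⟩ := exists_eigenvectors_of_invariant hR _ hmem
    (mkMat fun l => Matrix.of (M l)) (Q_seriesS0 hR Ψ (fun j k => hΨ k j) M hrec)
    (fun i j => by
      rw [coeff_form_zero hR (hneg i) (hneg j), ← hχ1 i j, ← hΨ0]
      rfl) (E₀ : ℂ) (by
      rw [coeffMat_mkMat, hM0]
      ext i j
      simp [Matrix.one_apply])
  refine ⟨f, ψ, fun j => Complex.ofReal_injective (hf j),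
    fun j => ⟨Module.End.mem_eigenspace_iff.2 (hψQ j), fun h0 => ?_⟩, hψ1, fun j k hk => ?_,
    fun j k a => totalDegree_le_of_coeff fun α hα => ?_⟩
  -- An eigenvector must be nonzero, which follows here from its norm being 1.
  · have h1 := hψ1 j j
    rw [if_pos rfl, h0] at h1
    have h2 := form_smul_right hR 0 0 (0 : S0 n r)
    rw [smul_zero, zero_mul, h1] at h2
    exact one_ne_zero h2
  · exact funext fun a => coeff_eq_zero_of_mem_lauFil (hψ j a) hk
  · have := hψ j a k α hα
    omega
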